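/- **Setting.** On field values $q=(\gamma_{kl},\alpha,\beta^k)$ (symmetric tensor, scalar, vector in three space dimensions) with canonical momenta $p=(\pi^{kl},\sigma,\rho_k)$, consider the Hamiltonian formulations of general relativity with live gauge whose principal part is $$\partial_t q=M^{-1}p+F^i\partial_i q,\qquad \partial_t p=F^{i\dagger}\partial_i p+V^{ij}\partial_i\partial_j q,$$ where the coefficients are evaluated at a background $(\gamma_{ij},\alpha,\beta^i)$ with $\gamma_{ij}$ positive definite and $\alpha>0$, and, for formulation parameters $C_1,\dots,C_7\in\mathbb R$, with $\gamma=\det(\gamma_{ij})$, $$M^{-1}=\tfrac{\alpha}{\sqrt\gamma}\begin{pmatrix}2\gamma_{k(m}\gamma_{n)l}-\gamma_{kl}\gamma_{mn}&-(\tfrac12+C_1)\alpha\gamma_{kl}&0\\-(\tfrac12+C_1)\alpha\gamma_{mn}&(\tfrac14+2C_4)\alpha^2&0\\0&0&-(1+2C_6)\alpha^2\gamma^{km}\end{pmatrix},$$ $$F^j=\begin{pmatrix}\beta^j\delta^{(m}_l\delta^{n)}_k&0&2\delta^j_{(l}\gamma_{k)m}\\0&\beta^j&C_7\alpha\delta^j_m\\\alpha^2\big((1+C_2)\gamma^{j(m}\gamma^{n)k}-\tfrac12(C_2-C_3+1)\gamma^{jk}\gamma^{mn}\big)&-(1+C_5)\alpha\gamma^{jk}&\beta^j\delta^k_m\end{pmatrix},$$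 $$V^{ij}=\sqrt\gamma\begin{pmatrix}V_{11}^{ij\,kl\,mn}&\gamma^{i(k}\gamma^{l)j}-\gamma^{ij}\gamma^{kl}&0\\\gamma^{i(m}\gamma^{n)j}-\gamma^{ij}\gamma^{mn}&0&0\\0&0&0\end{pmatrix},$$ $$V_{11}^{ij\,kl\,mn}=-\tfrac{\alpha}{2}\big(\gamma^{ij}\gamma^{kl}\gamma^{mn}+\gamma^{i(k}\gamma^{l)(m}\gamma^{n)j}+\gamma^{i(m}\gamma^{n)(k}\gamma^{l)j}-\gamma^{ij}\gamma^{k(m}\gamma^{n)l}-\gamma^{kl}\gamma^{i(m}\gamma^{n)j}-\gamma^{mn}\gamma^{i(k}\gamma^{l)j}\big).$$ Put $2\lambda_\pm^2=(2C_1+C_2+C_3-C_7+2)\pm(-2C_1+C_2+C_3+C_7)$ and $\lambda_V^2=1+C_2$. A system of this form is called strongly (symmetric) hyperbolic if it has a reduction to a first order system $\partial_t u=A^p\partial_p u$ in the variables $(q,\partial_i q,p)$, with arbitrary additions of the auxiliary constraints, that is strongly hyperbolic (for every covector $s\neq0$ the symbol $A^ps_p$ has real eigenvalues and a complete set of eigenvectors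 depending locally continuously on $s$), respectively symmetric hyperbolic (there is a symmetric positive definite $H$ with all $HA^p$ symmetric). A candidate symmetrizer is a symmetric form $H^{ij}$ on the $u_i=(\partial_i q,p)$, not necessarily positive, whose energy density $u_i^\dagger H^{ij}u_j$ is conserved by the principal part; equivalently, with $S_i=\mathrm{diag}(s_i,1)$ and $A^p{}_i{}^j$ the principal part matrix, $S_iH^{ij}A^p{}_j{}^ks_pS_k$ is symmetric for all $s$. Write $s_iH^{ij}s_j$ for $S_iH^{ij}S_j$. **Statement.** Consider the two-parameter family, with free parameters $\lambda_-^2>0$ and $C_5>-1$, given by $$\lambda_+^2=(1+C_5)\lambda_-^2,\quad \lambda_V^2=\tfrac14(1+C_5)(1+3\lambda_-^2),\quad C_4=\tfrac18(\lambda_-^2-1),$$ $$C_6=\tfrac18\big(C_5(3\lambda_-^2+1)+3(\lambda_-^2-1)\big),\quad C_7=0,$$ and satisfying $\lambda_+^2\ne\lambda_-^2$, i.e. $C_5\neq0$. Every such pair $(\lambda_-^2,C_5)$ is realized by some $C_1,\dots,C_7$. 1. For every member of the family and every background, the system has Hamiltonian structure (with invertible $M^{-1}$) and is strongly hyperbolic,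 but it is not symmetric hyperbolic; moreover there is no candidate symmetrizer $H^{ij}$ for which $s_iH^{ij}s_j$ is positive definite for all covectors $s\ne0$. 2. For generic $(\lambda_-^2,C_5)$, i.e. outside the zero set of some nonzero real polynomial in these two parameters, and for every background, the space of candidate symmetrizers with the block structure that does not couple $(\partial_i\gamma_{kl},\partial_i\alpha,\rho_k)$ with $(\partial_i\beta^k,\pi^{kl},\sigma)$ is $76$-dimensional; and no candidate symmetrizer at all, in this space or not, has positive definite $s_iH^{ij}s_j$ for even a single covector $s\neq0$. 3. Hence general relativity has Hamiltonian formulations that are strongly but not symmetric hyperbolic. -/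

import Mathlib

open Topology

noncomputable section

/-! ### First order systems `∂ₜ u = Aᵖ ∂ₚ u` in three space dimensions (principal parts) -/

section FirstOrder

variable {U : Type*} [AddCommGroup U] [Module ℝ U]

/-- The principal symbol `Aᵖ sₚ`. -/
def firstOrderSymbol (A : Fin 3 → U →ₗ[ℝ] U) (s : Fin 3 → ℝ) : U →ₗ[ℝ] U :=
  ∑ p, s p • A p

/-- Strong hyperbolicity: the principal symbol has real eigenvalues and a complete set of
eigenvectors which depend (locally) continuously on the spatial covector `s ≠ 0`. -/
def IsStronglyHyperbolicFirstOrder [TopologicalSpace U] (A : Fin 3 → U →ₗ[ℝ] U) : Prop :=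
  ∀ s₀ : Fin 3 → ℝ, s₀ ≠ 0 →
    ∃ N ∈ 𝓝 s₀,
      ∃ (e : (Fin 3 → ℝ) → Module.Basis (Fin (Module.finrank ℝ U)) ℝ U)
        (ev : (Fin 3 → ℝ) → Fin (Module.finrank ℝ U) → ℝ),
        (∀ k, ContinuousOn (fun s => e s k) N) ∧
        ∀ s ∈ N, ∀ k, firstOrderSymbol A s (e s k) = ev s k • e s k

/-- A quadratic form, given by its bilinear form, is positive definite. -/
def IsPosDefForm (H : LinearMap.BilinForm ℝ U) : Prop :=
  ∀ u : U, u ≠ 0 → 0 < H u u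

/-- Symmetric hyperbolicity: there is a symmetric positive definite `H` such that
every `H Aᵖ` is symmetric. -/
def IsSymmetricHyperbolicFirstOrder (A : Fin 3 → U →ₗ[ℝ] U) : Prop :=
  ∃ H : LinearMap.BilinForm ℝ U,
    (∀ u u', H u u' = H u' u) ∧ IsPosDefForm H ∧ ∀ p u u', H u (A p u') = H (A p u) u'

end FirstOrder

/-! ### First order in time, second order in space systems -/

/-- The principal part of a system
`∂ₜ v = A₁ⁱ ∂ᵢ v + A₂ w`, `∂ₜ w = B₁ⁱʲ ∂ᵢ ∂ⱼ v + B₂ⁱ ∂ᵢ w`. -/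
structure SecondOrderSystem (V W : Type*) [AddCommGroup V] [Module ℝ V]
    [AddCommGroup W] [Module ℝ W] where
  A₁ : Fin 3 → V →ₗ[ℝ] V
  A₂ : W →ₗ[ℝ] V
  B₁ : Fin 3 → Fin 3 → V →ₗ[ℝ] W
  B₂ : Fin 3 → W →ₗ[ℝ] W

namespace SecondOrderSystem

variable {V W : Type*} [AddCommGroup V] [Module ℝ V] [AddCommGroup W] [Module ℝ W]

/-- The right hand side of the equation for `v`, in terms of `dᵢ = ∂ᵢ v` and `w`. -/
def rhsV (S : SecondOrderSystem V W) : ((Fin 3 → V) × W) →ₗ[ℝ] V :=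
  (∑ j, S.A₁ j ∘ₗ LinearMap.proj j) ∘ₗ LinearMap.fst ℝ (Fin 3 → V) W +
    S.A₂ ∘ₗ LinearMap.snd ℝ (Fin 3 → V) W

/-- The coefficient of `∂ₚ` in the equation for `w`, acting on `(dⱼ, w)`. -/
def rhsW (S : SecondOrderSystem V W) (p : Fin 3) : ((Fin 3 → V) × W) →ₗ[ℝ] W :=
  (∑ j, S.B₁ p j ∘ₗ LinearMap.proj j) ∘ₗ LinearMap.fst ℝ (Fin 3 → V) W +
    S.B₂ p ∘ₗ LinearMap.snd ℝ (Fin 3 → V) W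

/-- The principal part matrix `Aᵖᵢʲ = ((A₁ʲ δᵖᵢ, A₂ δᵖᵢ), (B₁ᵖʲ, B₂ᵖ))`, acting on `(∂ⱼ v, w)`. -/
def principalPart (S : SecondOrderSystem V W) (p : Fin 3) :
    ((Fin 3 → V) × W) →ₗ[ℝ] ((Fin 3 → V) × W) :=
  (LinearMap.single ℝ (fun _ : Fin 3 => V) p ∘ₗ S.rhsV).prod (S.rhsW p)

/-- The map `S_i = diag(s_i, 1)`, `(a, b) ↦ (s_i a, b)`. -/
def contraction (s : Fin 3 → ℝ) : (V × W) →ₗ[ℝ] ((Fin 3 → V) × W) :=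
  ((LinearMap.pi fun i => s i • LinearMap.id) ∘ₗ LinearMap.fst ℝ V W).prod
    (LinearMap.snd ℝ V W)

/-- A candidate symmetrizer `Hⁱʲ`: a symmetric form on the `(∂ᵢ v, w)` such that
`S_i Hⁱʲ Aᵖⱼᵏ s_p S_k` is symmetric for every spatial covector `s`, i.e. such that
the energy with density `u_i† Hⁱʲ u_j`, `u_i = (∂ᵢ v, w)`, is conserved by the principal part. -/
def IsCandidate (S : SecondOrderSystem V W)
    (H : LinearMap.BilinForm ℝ ((Fin 3 → V) × W)) : Prop :=
  (∀ u u', H u u' = H u' u) ∧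
    ∀ (s : Fin 3 → ℝ) (x y : V × W),
      H (contraction s x) (firstOrderSymbol S.principalPart s (contraction s y)) =
        H (firstOrderSymbol S.principalPart s (contraction s x)) (contraction s y)

/-- The principal minor `s_i Hⁱʲ s_j`, a form on the `(v, w)`. -/
def minor (H : LinearMap.BilinForm ℝ ((Fin 3 → V) × W)) (s : Fin 3 → ℝ) :
    LinearMap.BilinForm ℝ (V × W) :=
  H.compl₁₂ (contraction s) (contraction s)

/-- The principal symbol
`Pˢ = ((A₁ⁱ s_i, A₂), (B₁ⁱʲ s_i s_j, B₂ⁱ s_i))` applied to `(a, b)`. -/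
def symbol (S : SecondOrderSystem V W) (s : Fin 3 → ℝ) (x : V × W) : V × W :=
  (∑ i, s i • S.A₁ i x.1 + S.A₂ x.2,
    ∑ i, ∑ j, (s i * s j) • S.B₁ i j x.1 + ∑ i, s i • S.B₂ i x.2)

/-- `A` is the principal part of a reduction of `S` to first order, with variables `v`,
`dᵢ` (standing for `∂ᵢ v`) and `w`.

On the constraint surface `dᵢ = ∂ᵢ v` the first order system has to coincide with `S`;
for the terms of highest order this says that `A` maps the amplitudes `(0, s_i a, b)` of a plane
wave with covector `s` to `(0, s_i a', b')` with `(a', b') = Pˢ (a, b)`.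
Multiples of the auxiliary constraints `∂ᵢ v - dᵢ` and
`∂ᵢ dⱼ - ∂ⱼ dᵢ` may be added to every equation. In particular, the coefficients of `∂ₚ v` are free:
they are compensated by terms without derivatives. -/
def IsFirstOrderReduction (S : SecondOrderSystem V W)
    (A : Fin 3 → (V × (Fin 3 → V) × W) →ₗ[ℝ] (V × (Fin 3 → V) × W)) : Prop :=
  ∀ (s : Fin 3 → ℝ) (x : V × W),
    firstOrderSymbol A s (0, contraction s x) = (0, contraction s (S.symbol s x))

/-- There is a reduction to first order that is strongly hyperbolic. -/
def IsStronglyHyperbolic [TopologicalSpace V] [TopologicalSpace W]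
    (S : SecondOrderSystem V W) : Prop :=
  ∃ A, S.IsFirstOrderReduction A ∧ IsStronglyHyperbolicFirstOrder A

/-- There is a reduction to first order that is symmetric hyperbolic. -/
def IsSymmetricHyperbolic (S : SecondOrderSystem V W) : Prop :=
  ∃ A, S.IsFirstOrderReduction A ∧ IsSymmetricHyperbolicFirstOrder A

/-- `S` is, in its principal part, the system of canonical equations of motion
`∂ₜ v = ∂H/∂w`, `∂ₜ w = ∂ᵢ (∂H/∂(∂ᵢ v))` of a Hamiltonian density
`½ h(u, u)`, `u = (∂ᵢ v, w)`, where `v` are the positions, `w` the momenta and `pair` is the pairing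
of momenta and positions; moreover the Legendre transformation is invertible. -/
def HasHamiltonianStructure (S : SecondOrderSystem V W) (pair : W →ₗ[ℝ] V →ₗ[ℝ] ℝ) : Prop :=
  ∃ h : LinearMap.BilinForm ℝ ((Fin 3 → V) × W),
    (∀ u u', h u u' = h u' u) ∧
    (∀ (d : Fin 3 → V) (w w' : W), pair w' (S.rhsV (d, w)) = h (d, w) (0, w')) ∧
    (∀ (dd : Fin 3 → Fin 3 → V) (dw : Fin 3 → W), (∀ i j, dd i j = dd j i) → ∀ v' : V,
      pair (∑ i, S.rhsW i (dd i, dw i)) v' = ∑ i, h (dd i, dw i) (Pi.single i v', 0)) ∧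
    Function.Bijective S.A₂

end SecondOrderSystem

/-! ### The Hamiltonian formulations of general relativity -/

/-- Formulation parameters. -/
structure FormulationParameters where
  C₁ : ℝ
  C₂ : ℝ
  C₃ : ℝ
  C₄ : ℝ
  C₅ : ℝ
  C₆ : ℝ
  C₇ : ℝ

namespace FormulationParameters

/-- `λ₊²`. -/
def lamPlusSq (C : FormulationParameters) : ℝ :=
  ((2 * C.C₁ + C.C₂ + C.C₃ - C.C₇ + 2) + (-2 * C.C₁ + C.C₂ + C.C₃ + C.C₇)) / 2

/-- `λ₋²`. -/
def lamMinusSq (C : FormulationParameters) : ℝ :=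
  ((2 * C.C₁ + C.C₂ + C.C₃ - C.C₇ + 2) - (-2 * C.C₁ + C.C₂ + C.C₃ + C.C₇)) / 2

/-- `λ_V²`. -/
def lamVSq (C : FormulationParameters) : ℝ := 1 + C.C₂

/-- The two parameter family with free parameters `λ₋²` and `C₅`.
The last condition is the nondegeneracy condition
`λ₊² ≠ λ₋²`, equivalently `λ₊² ≠ (1 + 2 C₅) λ₋²`. -/
structure InNonSymFamily (C : FormulationParameters) : Prop where
  lamV : C.lamVSq = (1 + C.C₅) * (1 + 3 * C.lamMinusSq) / 4
  lamPlus : C.lamPlusSq = (1 + C.C₅) * C.lamMinusSq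
  c4 : C.C₄ = (C.lamMinusSq - 1) / 8
  c6 : C.C₆ = (C.C₅ * (3 * C.lamMinusSq + 1) + 3 * (C.lamMinusSq - 1)) / 8
  c7 : C.C₇ = 0
  lamMinus_pos : 0 < C.lamMinusSq
  c5_gt : -1 < C.C₅
  c5_ne : C.C₅ ≠ 0

end FormulationParameters

/-- The values at a point of the background fields: the spatial metric, the lapse, the shift. -/
structure Background where
  metric : Matrix (Fin 3) (Fin 3) ℝ
  metric_posDef : metric.PosDef
  lapse : ℝ
  lapse_pos : 0 < lapse
  shift : Fin 3 → ℝ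

/-- Components of `(γ_{kl}, α, βᵏ)` and of the momenta `(π^{kl}, σ, ρ_k)`. -/
abbrev FieldIdx : Type := (Fin 3 × Fin 3) ⊕ (Unit ⊕ Fin 3)

/-- Field values: one symmetric tensor, one scalar and one vector. -/
def FieldSpace : Submodule ℝ (FieldIdx → ℝ) where
  carrier := {q | ∀ k l, q (.inl (k, l)) = q (.inl (l, k))}
  add_mem' := fun ha hb k l => by simp [ha k l, hb k l]
  zero_mem' := fun _ _ => rfl
  smul_mem' := fun c _ ha k l => by simp [ha k l]

/-- The pairing `π^{kl} γ_{kl} + σ α + ρ_k βᵏ` of momenta and positions. -/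
def fieldPairing : FieldSpace →ₗ[ℝ] FieldSpace →ₗ[ℝ] ℝ :=
  (dotProductBilin ℝ ℝ).compl₁₂ FieldSpace.subtype FieldSpace.subtype

/-- The operator on symmetric fields given by a matrix. -/
def fieldOperator (M : Matrix FieldIdx FieldIdx ℝ)
    (hM : ∀ k l c, M (.inl (k, l)) c = M (.inl (l, k)) c) : FieldSpace →ₗ[ℝ] FieldSpace :=
  M.mulVecLin.restrict (p := FieldSpace) (q := FieldSpace) fun q _ k l => by
    simp [Matrix.mulVec, dotProduct, hM k l]

/-- Kronecker's `δ`. -/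
def kron (i j : Fin 3) : ℝ := if i = j then 1 else 0

namespace Background

/-- The square root of the determinant of the metric. -/
def vol (b : Background) : ℝ := Real.sqrt b.metric.det

/-- The inverse metric. -/
def inv (b : Background) : Matrix (Fin 3) (Fin 3) ℝ := b.metric⁻¹

theorem metric_symm (b : Background) (k l : Fin 3) : b.metric k l = b.metric l k := by
  have h := b.metric_posDef.isHermitian
  simpa using (h.apply k l).symm

theorem inv_symm (b : Background) (k l : Fin 3) : b.inv k l = b.inv l k := by
  have h := b.metric_posDef.isHermitian.inv
  simpa [inv] using (h.apply k l).symm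

/-- `γ^{i(k} γ^{l)j}`. -/
def inv2 (b : Background) (i k l j : Fin 3) : ℝ :=
  (b.inv i k * b.inv l j + b.inv i l * b.inv k j) / 2

/-- `γ^{i(k} γ^{l)(m} γ^{n)j}`. -/
def inv3 (b : Background) (i k l m n j : Fin 3) : ℝ :=
  (b.inv i k * b.inv l m * b.inv n j + b.inv i l * b.inv k m * b.inv n j +
    b.inv i k * b.inv l n * b.inv m j + b.inv i l * b.inv k n * b.inv m j) / 4

/-- The matrix `M⁻¹` of the Hamiltonian. -/
def massInv (b : Background) (C : FormulationParameters) : Matrix FieldIdx FieldIdx ℝ :=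
  (b.lapse / b.vol) • Matrix.of fun r c => match r, c with
  | .inl (k, l), .inl (m, n) =>
      (b.metric k m * b.metric n l + b.metric k n * b.metric m l) - b.metric k l * b.metric m n
  | .inl (k, l), .inr (.inl _) => -(1 / 2 + C.C₁) * b.lapse * b.metric k l
  | .inl _, .inr (.inr _) => 0
  | .inr (.inl _), .inl (m, n) => -(1 / 2 + C.C₁) * b.lapse * b.metric m n
  | .inr (.inl _), .inr (.inl _) => (1 / 4 + 2 * C.C₄) * b.lapse ^ 2
  | .inr (.inl _), .inr (.inr _) => 0
  | .inr (.inr _), .inl _ => 0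
  | .inr (.inr _), .inr (.inl _) => 0
  | .inr (.inr k), .inr (.inr m) => -(1 + 2 * C.C₆) * b.lapse ^ 2 * b.inv k m

/-- The matrices `Fʲ` of the Hamiltonian. -/
def mixed (b : Background) (C : FormulationParameters) (j : Fin 3) :
    Matrix FieldIdx FieldIdx ℝ :=
  Matrix.of fun r c => match r, c with
  | .inl (k, l), .inl (m, n) =>
      b.shift j * ((kron m l * kron n k + kron n l * kron m k) / 2)
  | .inl _, .inr (.inl _) => 0
  | .inl (k, l), .inr (.inr m) => kron j l * b.metric k m + kron j k * b.metric l m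
  | .inr (.inl _), .inl _ => 0
  | .inr (.inl _), .inr (.inl _) => b.shift j
  | .inr (.inl _), .inr (.inr m) => C.C₇ * b.lapse * kron j m
  | .inr (.inr k), .inl (m, n) =>
      b.lapse ^ 2 * ((1 + C.C₂) * b.inv2 j m n k -
        1 / 2 * (C.C₂ - C.C₃ + 1) * (b.inv j k * b.inv m n))
  | .inr (.inr k), .inr (.inl _) => -(1 + C.C₅) * b.lapse * b.inv j k
  | .inr (.inr k), .inr (.inr m) => b.shift j * kron k m

/-- The matrices `Vⁱʲ` of the Hamiltonian. -/
def potential (b : Background) (i j : Fin 3) : Matrix FieldIdx FieldIdx ℝ :=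
  b.vol • Matrix.of fun r c => match r, c with
  | .inl (k, l), .inl (m, n) =>
      -b.lapse * (b.inv i j * b.inv k l * b.inv m n + b.inv3 i k l m n j + b.inv3 i m n k l j -
        b.inv i j * b.inv2 k m n l - b.inv k l * b.inv2 i m n j -
        b.inv m n * b.inv2 i k l j) / 2
  | .inl (k, l), .inr (.inl _) => b.inv2 i k l j - b.inv i j * b.inv k l
  | .inr (.inl _), .inl (m, n) => b.inv2 i m n j - b.inv i j * b.inv m n
  | _, _ => 0

theorem massInv_symm (b : Background) (C : FormulationParameters) (k l : Fin 3) (c : FieldIdx) :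
    b.massInv C (.inl (k, l)) c = b.massInv C (.inl (l, k)) c := by
  rcases c with ⟨m, n⟩ | _ | m <;>
    simp only [massInv, Matrix.smul_apply, Matrix.of_apply, smul_eq_mul, b.metric_symm l k]
  rw [b.metric_symm n l, b.metric_symm n k, b.metric_symm k m, b.metric_symm l m]
  ring

theorem mixed_symm (b : Background) (C : FormulationParameters) (j k l : Fin 3) (c : FieldIdx) :
    b.mixed C j (.inl (k, l)) c = b.mixed C j (.inl (l, k)) c := by
  rcases c with ⟨m, n⟩ | _ | m <;> simp only [mixed, Matrix.of_apply] <;> ring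

theorem mixed_transpose_symm (b : Background) (C : FormulationParameters) (j k l : Fin 3)
    (c : FieldIdx) :
    (b.mixed C j).transpose (.inl (k, l)) c = (b.mixed C j).transpose (.inl (l, k)) c := by
  rcases c with ⟨m, n⟩ | _ | m <;>
    simp only [mixed, Matrix.transpose_apply, Matrix.of_apply, inv2, b.inv_symm l k] <;> ring

theorem potential_symm (b : Background) (i j k l : Fin 3) (c : FieldIdx) :
    b.potential i j (.inl (k, l)) c = b.potential i j (.inl (l, k)) c := by
  rcases c with ⟨m, n⟩ | _ | m <;>
    simp only [potential, Matrix.smul_apply, Matrix.of_apply, smul_eq_mul, inv2, inv3,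
      b.inv_symm l k]
  · rw [b.inv_symm k m, b.inv_symm k n, b.inv_symm l m, b.inv_symm l n]
    ring
  · ring

end Background

/-- The principal part of the Hamiltonian formulation of general relativity with parameters `C`
at a background `b`:
`∂ₜ q = M⁻¹ p + Fⁱ ∂ᵢ q`, `∂ₜ p = Fⁱ† ∂ᵢ p + Vⁱʲ ∂ᵢ ∂ⱼ q`,
where `q = (γ_{kl}, α, βᵏ)` and `p = (π^{kl}, σ, ρ_k)`. -/
def grSystem (C : FormulationParameters) (b : Background) :
    SecondOrderSystem FieldSpace FieldSpace where
  A₁ j := fieldOperator (b.mixed C j) (b.mixed_symm C j)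
  A₂ := fieldOperator (b.massInv C) (b.massInv_symm C)
  B₁ i j := fieldOperator (b.potential i j) (b.potential_symm i j)
  B₂ j := fieldOperator (b.mixed C j).transpose (b.mixed_transpose_symm C j)

/-- The only nonzero components of `u` are those of `(∂ᵢ γ_{kl}, ∂ᵢ α, ρ_k)`. -/
def IsFirstBlock (u : (Fin 3 → FieldSpace) × FieldSpace) : Prop :=
  (∀ i k, (u.1 i).1 (.inr (.inr k)) = 0) ∧
    (∀ kl, u.2.1 (.inl kl) = 0) ∧ u.2.1 (.inr (.inl ())) = 0

/-- The only nonzero components of `u` are those of `(∂ᵢ βᵏ, π^{kl}, σ)`. -/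
def IsSecondBlock (u : (Fin 3 → FieldSpace) × FieldSpace) : Prop :=
  (∀ i kl, (u.1 i).1 (.inl kl) = 0) ∧ (∀ i, (u.1 i).1 (.inr (.inl ())) = 0) ∧
    ∀ k, u.2.1 (.inr (.inr k)) = 0

/-- The space of all candidate symmetrizers with the block structure in which
`(∂ᵢ γ_{kl}, ∂ᵢ α, ρ_k)` and `(∂ᵢ βᵏ, π^{kl}, σ)` are not coupled. -/
def blockCandidates (S : SecondOrderSystem FieldSpace FieldSpace) :
    Submodule ℝ (LinearMap.BilinForm ℝ ((Fin 3 → FieldSpace) × FieldSpace)) where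
  carrier := {H | S.IsCandidate H ∧ ∀ u u', IsFirstBlock u → IsSecondBlock u' → H u u' = 0}
  add_mem' := by
    rintro H K ⟨⟨h1, h2⟩, h3⟩ ⟨⟨k1, k2⟩, k3⟩
    refine ⟨⟨fun u u' => ?_, fun s x y => ?_⟩, fun u u' hu hu' => ?_⟩
    · simp only [LinearMap.add_apply, h1 u u', k1 u u']
    · simp only [LinearMap.add_apply, h2 s x y, k2 s x y]
    · simp only [LinearMap.add_apply, h3 u u' hu hu', k3 u u' hu hu', add_zero]
  zero_mem' := ⟨⟨fun _ _ => rfl, fun _ _ _ => rfl⟩, fun _ _ _ _ => rfl⟩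
  smul_mem' := by
    rintro c H ⟨⟨h1, h2⟩, h3⟩
    refine ⟨⟨fun u u' => ?_, fun s x y => ?_⟩, fun u u' hu hu' => ?_⟩
    · simp only [LinearMap.smul_apply, h1 u u']
    · simp only [LinearMap.smul_apply, h2 s x y]
    · simp only [LinearMap.smul_apply, h3 u u' hu hu', smul_zero]

end

/-! Write l = λ₋², c = C₅ and v = (1 + c)(1 + 3l)/4. In an orthonormal frame of the background, with
suitable powers of the lapse absorbed into the fields, replace the momentum by w = (∂ₜ − βⁱ∂ᵢ)q/α;
this is a change of variables because M⁻¹ is invertible. For a flat background without shift, w has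
the symbol F q + M⁻¹ p, and its time derivative has the symbol (F² + M⁻¹V) q + (F M⁻¹ + M⁻¹F†) p.
For the parameters of the family the second bracket vanishes (`flatMass_flatMixedTranspose`) and the
first is an explicit operator W_s (`waveOp`, `flatMixed_flatMixed_add`). So every member, at every
background, is equivalent to the wave system ∂ₜ²q = W(∂)q, up to an overall factor α and advection
along the shift (`waveAmplitude_symbol`, `isCandidate_congr_iff`). In W the vector decouples, and
the scalar only acts as a source of the tensor.

Strong hyperbolicity. For a unit covector s the operator W_s is diagonalizable with the positive
eigenvalues l, v, (1 + c)l and 1 (`span_eigenvectors_waveOp`). Each eigenvector a with eigenvalue κ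
gives two eigenvectors of the first order symbol, with speeds ±√κ, and these span its range; the
remaining modes lie in the kernel. By rotation covariance one eigenbasis serves for all s:
Householder reflections carry it along continuously.

No positive symmetrizer. Let K be the part of a candidate that is quadratic in w. Conservation makes
W_s symmetric for K, for every s. Now ss is an eigenvector of W_s with eigenvalue (1 + c)l, while
W_s δ = l δ − c ss for the flat metric δ. Symmetry on this pair gives c(l K(ss, δ) + K(ss, ss)) = 0.
As c ≠ 0, summing over an orthonormal frame yields l K(δ, δ) = −Σ K(eᵢeᵢ, eᵢeᵢ), which no positive
definite K satisfies (`candidate_waveSystem_not_pos`). Since K enters the minor for every s, this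
excludes positivity even for a single covector. A symmetrizer of a first order reduction would
restrict to a positive candidate, so symmetric hyperbolicity fails too.

Dimension. A candidate of the wave system consists of K, a coupling L_s of w with derivatives, and a
derivative part whose contractions with s are K(·, W_s ·). For generic parameters and block
structure, W-symmetry leaves three constants in K and one in L. The derivative part is then fixed up
to forms antisymmetric both in the two derivatives and in the two components, of which there are 3 ·
(21 + 3) = 72. Together this makes 76. -/

noncomputable section

/-! ### Components of field values -/

/-- The tensor component. -/
def ten : FieldSpace →ₗ[ℝ] Matrix (Fin 3) (Fin 3) ℝ where
  toFun q := Matrix.of fun k l => q.1 (.inl (k, l))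
  map_add' _ _ := rfl
  map_smul' _ _ := rfl

/-- The scalar component. -/
def scal : FieldSpace →ₗ[ℝ] ℝ where
  toFun q := q.1 (.inr (.inl ()))
  map_add' _ _ := rfl
  map_smul' _ _ := rfl

/-- The vector component. -/
def vec : FieldSpace →ₗ[ℝ] Fin 3 → ℝ where
  toFun q k := q.1 (.inr (.inr k))
  map_add' _ _ := rfl
  map_smul' _ _ := rfl

theorem ten_symm (q : FieldSpace) (k l : Fin 3) : ten q k l = ten q l k := q.2 k l

theorem ten_transpose (q : FieldSpace) : (ten q).transpose = ten q := by
  ext k l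
  exact ten_symm q l k

theorem coe_inl (q : FieldSpace) (k l : Fin 3) : q.1 (.inl (k, l)) = ten q k l := rfl
theorem coe_scal (q : FieldSpace) (x : Unit) : q.1 (.inr (.inl x)) = scal q := rfl
theorem coe_vec (q : FieldSpace) (k : Fin 3) : q.1 (.inr (.inr k)) = vec q k := rfl

theorem field_ext {q r : FieldSpace} (h₁ : ten q = ten r) (h₂ : scal q = scal r)
    (h₃ : vec q = vec r) : q = r := by
  apply Subtype.ext
  funext c
  rcases c with ⟨k, l⟩ | _ | k
  · exact congrFun (congrFun h₁ k) l
  · exact h₂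
  · exact congrFun h₃ k

/-- The field value with given components; the tensor is symmetrized. -/
def mkField : (Matrix (Fin 3) (Fin 3) ℝ × ℝ × (Fin 3 → ℝ)) →ₗ[ℝ] FieldSpace where
  toFun x := ⟨Sum.elim (fun kl => (x.1 kl.1 kl.2 + x.1 kl.2 kl.1) / 2)
      (Sum.elim (fun _ => x.2.1) x.2.2), fun k l => by simp [add_comm]⟩
  map_add' x y := by
    apply Subtype.ext
    funext c
    rcases c with ⟨k, l⟩ | _ | k <;> simp
    ring
  map_smul' t x := by
    apply Subtype.ext
    funext c
    rcases c with ⟨k, l⟩ | _ | k <;> simp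
    ring

@[simp]
theorem ten_mkField (x : Matrix (Fin 3) (Fin 3) ℝ × ℝ × (Fin 3 → ℝ)) (k l : Fin 3) :
    ten (mkField x) k l = (x.1 k l + x.1 l k) / 2 := rfl

@[simp]
theorem scal_mkField (x : Matrix (Fin 3) (Fin 3) ℝ × ℝ × (Fin 3 → ℝ)) :
    scal (mkField x) = x.2.1 := rfl

@[simp]
theorem vec_mkField (x : Matrix (Fin 3) (Fin 3) ℝ × ℝ × (Fin 3 → ℝ)) :
    vec (mkField x) = x.2.2 := rfl

theorem mkField_eta (q : FieldSpace) : mkField (ten q, scal q, vec q) = q := by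
  refine field_ext ?_ rfl rfl
  ext k l
  simp [ten_symm q l k]

theorem fieldOperator_coe (M : Matrix FieldIdx FieldIdx ℝ)
    (hM : ∀ k l c, M (.inl (k, l)) c = M (.inl (l, k)) c) (q : FieldSpace) :
    (fieldOperator M hM q).1 = M.mulVec q.1 := rfl

/-- The components of an operator given by a matrix. -/
theorem fieldOperator_apply (M : Matrix FieldIdx FieldIdx ℝ)
    (hM : ∀ k l c, M (.inl (k, l)) c = M (.inl (l, k)) c) (q : FieldSpace) (r : FieldIdx) :
    (fieldOperator M hM q).1 r = (∑ m, ∑ n, M r (.inl (m, n)) * ten q m n) +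
      (M r (.inr (.inl ())) * scal q + ∑ m, M r (.inr (.inr m)) * vec q m) := by
  rw [fieldOperator_coe]
  simp only [Matrix.mulVec, dotProduct, Fintype.sum_sum_type, Fintype.sum_prod_type,
    Finset.univ_unique, Finset.sum_singleton]
  rfl

theorem fieldPairing_apply (p q : FieldSpace) : fieldPairing p q = p.1 ⬝ᵥ q.1 := rfl

theorem fieldPairing_comm (p q : FieldSpace) : fieldPairing p q = fieldPairing q p := by
  simp only [fieldPairing_apply, dotProduct_comm]

theorem fieldPairing_fieldOperator (M N : Matrix FieldIdx FieldIdx ℝ)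
    (hM : ∀ k l c, M (.inl (k, l)) c = M (.inl (l, k)) c)
    (hN : ∀ k l c, N (.inl (k, l)) c = N (.inl (l, k)) c) (h : N = M.transpose)
    (p q : FieldSpace) :
    fieldPairing p (fieldOperator M hM q) = fieldPairing (fieldOperator N hN p) q := by
  simp only [fieldPairing_apply, fieldOperator_coe]
  rw [h, Matrix.dotProduct_mulVec, Matrix.mulVec_transpose]

/-! ### Hamiltonian structure -/

theorem massInv_transpose (b : Background) (C : FormulationParameters) :
    b.massInv C = (b.massInv C).transpose := by
  ext r c
  rcases r with ⟨k, l⟩ | _ | k <;> rcases c with ⟨m, n⟩ | _ | m <;>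
    simp [Background.massInv, b.metric_symm, b.inv_symm]
  left
  ring

theorem potential_transpose (b : Background) (i j : Fin 3) :
    b.potential i j = (b.potential j i).transpose := by
  ext r c
  rcases r with ⟨k, l⟩ | _ | k <;> rcases c with ⟨m, n⟩ | _ | m <;>
    simp only [Background.potential, Matrix.transpose_apply, Matrix.smul_apply, Matrix.of_apply,
      smul_eq_mul, Background.inv2, Background.inv3]
  · rw [b.inv_symm j i, b.inv_symm m l, b.inv_symm m k, b.inv_symm n l, b.inv_symm n k,
      b.inv_symm j m, b.inv_symm j n, b.inv_symm j k, b.inv_symm j l, b.inv_symm m i,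
      b.inv_symm n i, b.inv_symm k i, b.inv_symm l i]
    ring
  · rw [b.inv_symm j i, b.inv_symm j k, b.inv_symm j l, b.inv_symm k i, b.inv_symm l i]
    ring
  · rw [b.inv_symm j i, b.inv_symm j m, b.inv_symm j n, b.inv_symm m i, b.inv_symm n i]
    ring

/-- The bilinear form of the Hamiltonian density. -/
def hamiltonianForm (C : FormulationParameters) (b : Background) :
    LinearMap.BilinForm ℝ ((Fin 3 → FieldSpace) × FieldSpace) :=
  LinearMap.mk₂ ℝ
    (fun u u' => fieldPairing u.2 ((grSystem C b).A₂ u'.2) +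
      ∑ j, fieldPairing u.2 ((grSystem C b).A₁ j (u'.1 j)) +
      ∑ j, fieldPairing u'.2 ((grSystem C b).A₁ j (u.1 j)) +
      ∑ i, ∑ j, fieldPairing ((grSystem C b).B₁ i j (u.1 j)) (u'.1 i))
    (fun u u' w => by simp [Finset.sum_add_distrib]; ring)
    (fun t u w => by simp [Finset.mul_sum, mul_add])
    (fun u u' w => by simp [Finset.sum_add_distrib]; ring)
    (fun t u w => by simp [Finset.mul_sum, mul_add])

theorem hamiltonianForm_apply (C : FormulationParameters) (b : Background)
    (u u' : (Fin 3 → FieldSpace) × FieldSpace) :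
    hamiltonianForm C b u u' = fieldPairing u.2 ((grSystem C b).A₂ u'.2) +
      ∑ j, fieldPairing u.2 ((grSystem C b).A₁ j (u'.1 j)) +
      ∑ j, fieldPairing u'.2 ((grSystem C b).A₁ j (u.1 j)) +
      ∑ i, ∑ j, fieldPairing ((grSystem C b).B₁ i j (u.1 j)) (u'.1 i) := rfl

/-- The canonical form of the equations amounts to three facts: M⁻¹ is symmetric, the operators `B₂
j` are the transposes of `A₁ j`, and transposing the potential exchanges its two derivative indices.
Only the invertibility of M⁻¹ depends on the parameters. -/
theorem hasHamiltonianStructure_of_bijective (C : FormulationParameters) (b : Background)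
    (hb : Function.Bijective (grSystem C b).A₂) :
    (grSystem C b).HasHamiltonianStructure fieldPairing := by
  have hA₂ : ∀ p q, fieldPairing p ((grSystem C b).A₂ q) = fieldPairing q ((grSystem C b).A₂ p) :=
    fun p q => by
      rw [fieldPairing_comm q]
      exact fieldPairing_fieldOperator _ _ (b.massInv_symm C) (b.massInv_symm C)
        (massInv_transpose b C) p q
  have hA₁ : ∀ j p q, fieldPairing p ((grSystem C b).A₁ j q) =
      fieldPairing ((grSystem C b).B₂ j p) q := fun j p q =>
    fieldPairing_fieldOperator _ _ (b.mixed_symm C j) (b.mixed_transpose_symm C j) rfl p q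
  have hB₁ : ∀ i j p q, fieldPairing ((grSystem C b).B₁ i j p) q =
      fieldPairing ((grSystem C b).B₁ j i q) p := fun i j p q => by
    rw [fieldPairing_comm]
    exact fieldPairing_fieldOperator _ (b.potential j i) (b.potential_symm i j)
      (b.potential_symm j i) (potential_transpose b j i) q p
  refine ⟨hamiltonianForm C b, fun u u' => ?_, fun d w w' => ?_, fun dd dw _ v' => ?_, hb⟩
  · simp only [hamiltonianForm_apply]
    rw [hA₂ u.2 u'.2, Finset.sum_comm]
    simp only [hB₁ _ _ (u.1 _) (u'.1 _)]
    ring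
  · simp only [hamiltonianForm_apply, SecondOrderSystem.rhsV]
    simp [hA₂ w w', add_comm]
  · simp only [hamiltonianForm_apply, SecondOrderSystem.rhsW]
    simp [Pi.single_apply, Finset.sum_add_distrib, apply_ite, hA₁, add_comm]

/-! ### Plane wave amplitudes and the conservation condition -/

namespace SecondOrderSystem

variable {V W : Type*} [AddCommGroup V] [Module ℝ V] [AddCommGroup W] [Module ℝ W]

@[simp]
theorem contraction_fst (s : Fin 3 → ℝ) (x : V × W) (i : Fin 3) :
    (contraction s x).1 i = s i • x.1 := rfl

@[simp]
theorem contraction_snd (s : Fin 3 → ℝ) (x : V × W) : (contraction s x).2 = x.2 := rfl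

/-- The first order symbol maps amplitudes of plane waves to amplitudes of plane waves. -/
theorem firstOrderSymbol_contraction (S : SecondOrderSystem V W) (s : Fin 3 → ℝ) (x : V × W) :
    firstOrderSymbol S.principalPart s (contraction s x) = contraction s (S.symbol s x) := by
  refine Prod.ext ?_ ?_
  · funext i
    simp [firstOrderSymbol, principalPart, rhsV, symbol, Prod.fst_sum, Pi.single_apply]
  · simp [firstOrderSymbol, principalPart, rhsW, symbol, Prod.snd_sum, Finset.sum_add_distrib,
      Finset.smul_sum, smul_smul]

theorem isCandidate_iff (S : SecondOrderSystem V W)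
    (H : LinearMap.BilinForm ℝ ((Fin 3 → V) × W)) :
    S.IsCandidate H ↔ (∀ u u', H u u' = H u' u) ∧ ∀ (s : Fin 3 → ℝ) (x y : V × W),
      H (contraction s x) (contraction s (S.symbol s y)) =
        H (contraction s (S.symbol s x)) (contraction s y) := by
  simp only [IsCandidate, firstOrderSymbol_contraction]

end SecondOrderSystem

open SecondOrderSystem

/-! ### Decoupled wave equations -/

/-- The spatial operator of a system of wave equations for a tensor, a scalar and a vector, in which
only the scalar is coupled, as a source, to the tensor. -/
def waveOp (l c : ℝ) (s : Fin 3 → ℝ) : FieldSpace →ₗ[ℝ] FieldSpace where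
  toFun q := mkField
    ((s ⬝ᵥ s) • ten q + ((1 + c) * (1 + 3 * l) / 2 - 2) • Matrix.vecMulVec s ((ten q).mulVec s) +
      ((1 - (1 + c) * (1 + l) / 2) * (ten q).trace - 2 * c * scal q) • Matrix.vecMulVec s s +
      ((1 - l) / 2 * (s ⬝ᵥ (ten q).mulVec s - s ⬝ᵥ s * (ten q).trace)) •
        (1 : Matrix (Fin 3) (Fin 3) ℝ),
    l * (s ⬝ᵥ s) * scal q,
    ((1 + c) * (1 + 3 * l) / 4 * (s ⬝ᵥ s)) • vec q +
      ((1 + c) * (l - 1) / 4 * (s ⬝ᵥ vec q)) • s)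
  map_add' q r := by
    rw [← map_add]
    congr 1
    refine Prod.ext ?_ (Prod.ext ?_ ?_)
    · ext i j
      simp [Matrix.add_mulVec, Matrix.vecMulVec_apply]
      ring
    · simp; ring
    · ext i; simp; ring
  map_smul' t q := by
    refine Eq.trans ?_ (map_smul mkField t _)
    congr 1
    refine Prod.ext ?_ (Prod.ext ?_ ?_)
    · ext i j
      simp [Matrix.smul_mulVec, Matrix.vecMulVec_apply]
      ring
    · simp; ring
    · ext i; simp; ring

theorem ten_waveOp (l c : ℝ) (s : Fin 3 → ℝ) (q : FieldSpace) (i j : Fin 3) :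
    ten (waveOp l c s q) i j = (s ⬝ᵥ s) * ten q i j +
      ((1 + c) * (1 + 3 * l) / 4 - 1) * (s i * (ten q).mulVec s j + s j * (ten q).mulVec s i) +
      ((1 - (1 + c) * (1 + l) / 2) * (ten q).trace - 2 * c * scal q) * (s i * s j) +
      ((1 - l) / 2 * (s ⬝ᵥ (ten q).mulVec s - s ⬝ᵥ s * (ten q).trace)) *
        (1 : Matrix (Fin 3) (Fin 3) ℝ) i j := by
  simp only [waveOp, LinearMap.coe_mk, AddHom.coe_mk, ten_mkField, Matrix.add_apply,
    Matrix.smul_apply, smul_eq_mul, Matrix.vecMulVec_apply, ten_symm q j i]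
  rw [show (1 : Matrix (Fin 3) (Fin 3) ℝ) j i = (1 : Matrix (Fin 3) (Fin 3) ℝ) i j by
    simp [Matrix.one_apply, eq_comm]]
  ring

theorem scal_waveOp (l c : ℝ) (s : Fin 3 → ℝ) (q : FieldSpace) :
    scal (waveOp l c s q) = l * (s ⬝ᵥ s) * scal q := rfl

theorem vec_waveOp (l c : ℝ) (s : Fin 3 → ℝ) (q : FieldSpace) (i : Fin 3) :
    vec (waveOp l c s q) i = (1 + c) * (1 + 3 * l) / 4 * (s ⬝ᵥ s) * vec q i +
      (1 + c) * (l - 1) / 4 * (s ⬝ᵥ vec q) * s i := rfl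

/-- The tensor `s_(k p_l)`. -/
def symTen (s p : Fin 3 → ℝ) : FieldSpace := mkField (Matrix.vecMulVec s p, 0, 0)

/-- The flat metric. -/
def flatTen : FieldSpace := mkField (1, 0, 0)

/-- A unit scalar. -/
def scalField : FieldSpace := mkField (0, 1, 0)

/-- A vector. -/
def vecField (β : Fin 3 → ℝ) : FieldSpace := mkField (0, 0, β)

section components

variable (s p : Fin 3 → ℝ) (i j : Fin 3)

theorem ten_symTen : ten (symTen s p) i j = (s i * p j + s j * p i) / 2 := rfl
theorem scal_symTen : scal (symTen s p) = 0 := rfl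
theorem vec_symTen : vec (symTen s p) = 0 := rfl
theorem ten_flatTen : ten flatTen = 1 := by
  ext i j
  simp only [flatTen, ten_mkField, Matrix.one_apply, eq_comm (a := j)]
  ring
theorem scal_flatTen : scal flatTen = 0 := rfl
theorem vec_flatTen : vec flatTen = 0 := rfl
theorem ten_scalField : ten scalField = 0 := by
  ext i j
  simp [scalField]
theorem scal_scalField : scal scalField = 1 := rfl
theorem vec_scalField : vec scalField = 0 := rfl
theorem ten_vecField : ten (vecField s) = 0 := by
  ext i j
  simp [vecField]
theorem scal_vecField : scal (vecField s) = 0 := rfl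
theorem vec_vecField : vec (vecField s) = s := rfl

end components

theorem symTen_comm (s p : Fin 3 → ℝ) : symTen s p = symTen p s :=
  field_ext (by ext i j; simp only [ten_symTen]; ring) rfl rfl

theorem symTen_add_left (s s' p : Fin 3 → ℝ) : symTen (s + s') p = symTen s p + symTen s' p :=
  field_ext (by ext i j; simp [ten_symTen]; ring) (by simp [scal_symTen]) (by simp [vec_symTen])

theorem symTen_add_right (s p p' : Fin 3 → ℝ) : symTen s (p + p') = symTen s p + symTen s p' := by
  rw [symTen_comm, symTen_add_left, symTen_comm p, symTen_comm p']

theorem symTen_sub_left (s s' p : Fin 3 → ℝ) : symTen (s - s') p = symTen s p - symTen s' p :=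
  field_ext (by ext i j; simp [ten_symTen]; ring) (by simp [scal_symTen]) (by simp [vec_symTen])

theorem symTen_sub_right (s p p' : Fin 3 → ℝ) : symTen s (p - p') = symTen s p - symTen s p' := by
  rw [symTen_comm, symTen_sub_left, symTen_comm p, symTen_comm p']

theorem vecField_add (β β' : Fin 3 → ℝ) : vecField (β + β') = vecField β + vecField β' :=
  field_ext (by simp [ten_vecField]) (by simp [scal_vecField]) (by simp [vec_vecField])

theorem vecField_smul (t : ℝ) (β : Fin 3 → ℝ) : vecField (t • β) = t • vecField β :=
  field_ext (by simp [ten_vecField]) (by simp [scal_vecField]) (by simp [vec_vecField])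

/-- Unit vectors. -/
abbrev unitVec (i : Fin 3) : Fin 3 → ℝ := Pi.single i 1

theorem field_eq_sum (q : FieldSpace) :
    q = (∑ i, ∑ j, ten q i j • symTen (unitVec i) (unitVec j)) + scal q • scalField +
      vecField (vec q) := by
  refine field_ext ?_ ?_ ?_
  · ext i j
    simp only [map_add, map_smul, Matrix.add_apply, Matrix.smul_apply, ten_symTen,
      ten_scalField, ten_vecField, Fin.sum_univ_three, Matrix.zero_apply]
    fin_cases i <;> fin_cases j <;>
      simp [ten_symm q 1 0, ten_symm q 2 0, ten_symm q 2 1] <;> ring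
  · simp [scal_symTen, scal_scalField, scal_vecField]
  · simp [vec_symTen, vec_scalField, vec_vecField]

theorem flatTen_eq_sum : flatTen = ∑ i, symTen (unitVec i) (unitVec i) := by
  refine field_ext ?_ ?_ ?_
  · ext i j
    simp only [map_add, Matrix.add_apply, ten_symTen, ten_flatTen, Fin.sum_univ_three]
    fin_cases i <;> fin_cases j <;> simp
  · simp [scal_symTen, scal_flatTen]
  · simp [vec_symTen, vec_flatTen]

section

variable (l c : ℝ) (s p : Fin 3 → ℝ)

theorem waveOp_symTen : waveOp l c s (symTen p p) = (s ⬝ᵥ s) • symTen p p +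
    ((((1 + c) * (1 + 3 * l) / 2 - 2) * (s ⬝ᵥ p)) • symTen s p) +
    ((1 - (1 + c) * (1 + l) / 2) * (p ⬝ᵥ p)) • symTen s s +
    ((1 - l) / 2 * ((s ⬝ᵥ p) ^ 2 - (s ⬝ᵥ s) * (p ⬝ᵥ p))) • flatTen := by
  refine field_ext ?_ ?_ ?_
  · ext i j
    simp [ten_waveOp, ten_symTen, ten_flatTen, scal_symTen, Matrix.mulVec, dotProduct,
      Fin.sum_univ_three, Matrix.trace]
    ring
  · simp [scal_waveOp, scal_symTen, scal_flatTen]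
  · ext i
    simp [vec_waveOp, vec_symTen, vec_flatTen]

theorem waveOp_symTen_self : waveOp l c s (symTen s s) =
    ((1 + c) * l * (s ⬝ᵥ s)) • symTen s s := by
  rw [waveOp_symTen, ← sub_eq_zero]
  module

theorem waveOp_flatTen : waveOp l c s flatTen = (l * (s ⬝ᵥ s)) • flatTen - c • symTen s s := by
  refine field_ext ?_ ?_ ?_
  · ext i j
    simp [ten_waveOp, ten_symTen, ten_flatTen, scal_flatTen]
    ring
  · simp [scal_waveOp, scal_symTen, scal_flatTen]
  · ext i
    simp [vec_waveOp, vec_symTen, vec_flatTen]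

theorem waveOp_scalField :
    waveOp l c s scalField = (l * (s ⬝ᵥ s)) • scalField - (2 * c) • symTen s s := by
  refine field_ext ?_ ?_ ?_
  · ext i j
    simp only [ten_waveOp, ten_symTen, ten_scalField, scal_scalField, map_sub, map_smul,
      Matrix.sub_apply, Matrix.smul_apply, smul_eq_mul, Matrix.zero_apply, Matrix.trace_zero,
      Matrix.zero_mulVec, dotProduct_zero, Pi.zero_apply]
    ring
  · simp [scal_waveOp, scal_symTen, scal_scalField]
  · ext i
    simp [vec_waveOp, vec_symTen, vec_scalField]

theorem waveOp_vecField : waveOp l c s (vecField p) =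
    ((1 + c) * (1 + 3 * l) / 4 * (s ⬝ᵥ s)) • vecField p +
      ((1 + c) * (l - 1) / 4 * (s ⬝ᵥ p)) • vecField s := by
  refine field_ext ?_ ?_ ?_
  · ext i j
    simp [ten_waveOp, ten_vecField, scal_vecField]
  · simp [scal_waveOp, scal_vecField]
  · ext i
    simp [vec_waveOp, vec_vecField]

end

/-- The system of wave equations given by `waveOp`. -/
def waveSystem (l c : ℝ) : SecondOrderSystem FieldSpace FieldSpace where
  A₁ _ := 0
  A₂ := LinearMap.id
  B₁ i j := (1 / 2 : ℝ) •
    (waveOp l c (unitVec i + unitVec j) - waveOp l c (unitVec i) - waveOp l c (unitVec j))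
  B₂ _ := 0

/-- The operator is a quadratic form in the covector and `B₁` is its polarization. -/
theorem sum_waveSystem_B₁ (l c : ℝ) (s : Fin 3 → ℝ) (q : FieldSpace) :
    ∑ i, ∑ j, (s i * s j) • (waveSystem l c).B₁ i j q = waveOp l c s q := by
  refine field_ext ?_ ?_ ?_
  · ext k m
    simp only [waveSystem, Fin.sum_univ_three, LinearMap.smul_apply, LinearMap.sub_apply, map_add,
      map_smul, map_sub, Matrix.add_apply, Matrix.smul_apply, Matrix.sub_apply, ten_waveOp,
      Matrix.mulVec, dotProduct, smul_eq_mul, Pi.add_apply]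
    fin_cases k <;> fin_cases m <;>
      simp [ten_symm q 1 0, ten_symm q 2 0, ten_symm q 2 1] <;> ring
  · simp [waveSystem, Fin.sum_univ_three, scal_waveOp, dotProduct]
    ring
  · ext k
    simp only [waveSystem, Fin.sum_univ_three, LinearMap.smul_apply, LinearMap.sub_apply, map_add,
      map_smul, map_sub, Pi.add_apply, Pi.smul_apply, Pi.sub_apply, vec_waveOp,
      dotProduct, smul_eq_mul]
    fin_cases k <;> simp <;> ring

theorem symbol_waveSystem (l c : ℝ) (s : Fin 3 → ℝ) (x : FieldSpace × FieldSpace) :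
    (waveSystem l c).symbol s x = (x.2, waveOp l c s x.1) := by
  simp only [symbol, sum_waveSystem_B₁]
  simp [waveSystem]

/-- The conditions for candidate symmetrizers of the wave system. -/
theorem isCandidate_waveSystem_iff (l c : ℝ)
    (H : LinearMap.BilinForm ℝ ((Fin 3 → FieldSpace) × FieldSpace)) :
    (waveSystem l c).IsCandidate H ↔ (∀ u u', H u u' = H u' u) ∧ ∀ s : Fin 3 → ℝ,
      (∀ a b, H (contraction s (a, 0)) (contraction s (b, 0)) =
        H (0, a) (0, waveOp l c s b)) ∧
      (∀ a b, H (0, a) (contraction s (b, 0)) = H (0, b) (contraction s (a, 0))) ∧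
      (∀ a b, H (0, waveOp l c s a) (contraction s (b, 0)) =
        H (0, waveOp l c s b) (contraction s (a, 0))) := by
  -- Amplitudes without position part do not see the covector, so the kinetic part of the form is
  -- the same for all of them.
  have h0 : ∀ (s : Fin 3 → ℝ) (a : FieldSpace),
      contraction s ((0 : FieldSpace), a) = (0, a) := fun s a => by
    refine Prod.ext ?_ rfl
    funext i
    simp
  have hc : ∀ (s : Fin 3 → ℝ) (a b : FieldSpace),
      contraction s (a, b) = contraction s (a, (0 : FieldSpace)) + (0, b) := fun s a b => by
    rw [← h0 s b, ← map_add]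
    simp
  rw [isCandidate_iff]
  simp only [symbol_waveSystem]
  constructor
  -- Testing on amplitudes with only a position or only a momentum separates the three conditions;
  -- by bilinearity these tests are also sufficient.
  · rintro ⟨hs, h⟩
    refine ⟨hs, fun s => ⟨fun a b => ?_, fun a b => ?_, fun a b => ?_⟩⟩
    · have := h s (0, a) (b, 0)
      simp only [h0, map_zero] at this
      exact this.symm
    · have := h s (0, b) (0, a)
      simp only [h0, map_zero] at this
      rw [this, hs]
    · have := h s (b, 0) (a, 0)
      simp only [h0] at this
      rw [← this, hs]
  · rintro ⟨hs, h⟩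
    refine ⟨hs, fun s x y => ?_⟩
    obtain ⟨h₁, h₂, h₃⟩ := h s
    rw [hc s x.2, hc s y.2, ← Prod.mk.eta (p := x), ← Prod.mk.eta (p := y), hc s x.1 x.2,
      hc s y.1 y.2]
    simp only [map_add, LinearMap.add_apply]
    linear_combination hs (contraction s (x.1, 0)) (contraction s (y.2, 0)) + h₁ y.2 x.1 +
      hs (0, y.2) (0, waveOp l c s x.1) + h₂ x.2 y.2 + hs (0, y.2) (contraction s (x.2, 0)) +
      hs (contraction s (x.1, 0)) (0, waveOp l c s y.1) + h₃ y.1 x.1 - h₁ x.2 y.1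

/-- Both sides equal the derivative part of the form on the contracted amplitudes, which is
symmetric. -/
theorem candidate_waveOp_symm {l c : ℝ}
    {H : LinearMap.BilinForm ℝ ((Fin 3 → FieldSpace) × FieldSpace)}
    (hH : (waveSystem l c).IsCandidate H) (s : Fin 3 → ℝ) (a b : FieldSpace) :
    H (0, a) (0, waveOp l c s b) = H (0, waveOp l c s a) (0, b) := by
  obtain ⟨hs, h⟩ := (isCandidate_waveSystem_iff l c H).1 hH
  rw [← (h s).1, hs, (h s).1, hs]

/-- There is no positive definite candidate symmetrizer. -/
theorem candidate_waveSystem_not_pos {l c : ℝ} (hl : 0 < l) (hc : c ≠ 0)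
    {H : LinearMap.BilinForm ℝ ((Fin 3 → FieldSpace) × FieldSpace)}
    (hH : (waveSystem l c).IsCandidate H) :
    ¬ ∀ a : FieldSpace, a ≠ 0 → 0 < H (0, a) (0, a) := by
  intro hpos
  have hadd : ∀ a b b' : FieldSpace, H (0, a) (0, b + b') = H (0, a) (0, b) + H (0, a) (0, b') :=
    fun a b b' => by rw [← map_add]; simp
  have hsum : ∀ (a : FieldSpace), H (0, flatTen) (0, a) =
      ∑ i, H (0, symTen (unitVec i) (unitVec i)) (0, a) := fun a => by
    rw [flatTen_eq_sum]
    simp only [Fin.sum_univ_three, ← LinearMap.add_apply, ← map_add, Prod.mk_add_mk, add_zero]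
  -- Symmetry on the pair formed by the square of a unit vector, with eigenvalue (1 + c)l, and the
  -- flat metric, which is mapped to l times itself minus c times that square. The terms with l
  -- alone cancel and a common factor c remains.
  have key : ∀ i, l * H (0, symTen (unitVec i) (unitVec i)) (0, flatTen) =
      - H (0, symTen (unitVec i) (unitVec i)) (0, symTen (unitVec i) (unitVec i)) := fun i => by
    have h := candidate_waveOp_symm hH (unitVec i) (symTen (unitVec i) (unitVec i)) flatTen
    have hsmul : ∀ (t : ℝ) (a : FieldSpace),
        ((0 : Fin 3 → FieldSpace), t • a) = t • (0, a) := fun t a => by simp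
    have hsub : ∀ a b : FieldSpace, ((0 : Fin 3 → FieldSpace), a - b) = (0, a) - (0, b) :=
      fun a b => by simp
    rw [waveOp_flatTen, waveOp_symTen_self] at h
    simp only [hsub, hsmul, map_sub, map_smul, LinearMap.smul_apply, smul_eq_mul] at h
    simp only [single_dotProduct, Pi.single_eq_same, mul_one] at h
    apply mul_left_cancel₀ hc
    linear_combination -h
  have hne : ∀ i, symTen (unitVec i) (unitVec i) ≠ 0 := fun i h => by
    have := congrArg (fun q => ten q i i) h
    simp [ten_symTen] at this
  have h0 : flatTen ≠ 0 := fun h => by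
    have := congrArg (fun q => ten q 0 0) h
    simp [ten_flatTen] at this
  have h1 := hpos _ h0
  -- Summing `key` over the frame turns l K(δ, δ) > 0 into a negative sum of three positive numbers.
  rw [hsum] at h1
  have h2 := mul_pos hl h1
  rw [Finset.mul_sum] at h2
  simp only [key, Fin.sum_univ_three] at h2
  linarith [hpos _ (hne 0), hpos _ (hne 1), hpos _ (hne 2)]

/-! ### Uniqueness of candidate symmetrizers of the wave system -/

/-- The part of a form that is quadratic in the momenta. -/
def kineticForm (H : LinearMap.BilinForm ℝ ((Fin 3 → FieldSpace) × FieldSpace)) :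
    LinearMap.BilinForm ℝ FieldSpace :=
  H.compl₁₂ (LinearMap.inr ℝ (Fin 3 → FieldSpace) FieldSpace)
    (LinearMap.inr ℝ (Fin 3 → FieldSpace) FieldSpace)

/-- The part of a form that couples momenta and derivatives `s_i q`. -/
def crossForm (H : LinearMap.BilinForm ℝ ((Fin 3 → FieldSpace) × FieldSpace)) (s : Fin 3 → ℝ) :
    LinearMap.BilinForm ℝ FieldSpace :=
  H.compl₁₂ (LinearMap.inr ℝ (Fin 3 → FieldSpace) FieldSpace)
    (contraction s ∘ₗ LinearMap.inl ℝ FieldSpace FieldSpace)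

theorem kineticForm_apply (H : LinearMap.BilinForm ℝ ((Fin 3 → FieldSpace) × FieldSpace))
    (a b : FieldSpace) : kineticForm H a b = H (0, a) (0, b) := rfl

theorem crossForm_apply (H : LinearMap.BilinForm ℝ ((Fin 3 → FieldSpace) × FieldSpace))
    (s : Fin 3 → ℝ) (a b : FieldSpace) :
    crossForm H s a b = H (0, a) (contraction s (b, 0)) := rfl

theorem crossForm_add (H : LinearMap.BilinForm ℝ ((Fin 3 → FieldSpace) × FieldSpace))
    (s s' : Fin 3 → ℝ) (a b : FieldSpace) :
    crossForm H (s + s') a b = crossForm H s a b + crossForm H s' a b := by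
  simp only [crossForm_apply]
  rw [← map_add]
  congr 1
  refine Prod.ext ?_ (by simp)
  funext i
  simp [add_smul]

theorem crossForm_smul (H : LinearMap.BilinForm ℝ ((Fin 3 → FieldSpace) × FieldSpace))
    (t : ℝ) (s : Fin 3 → ℝ) (a b : FieldSpace) :
    crossForm H (t • s) a b = t * crossForm H s a b := by
  simp only [crossForm_apply]
  rw [← smul_eq_mul, ← map_smul]
  congr 1
  refine Prod.ext ?_ (by simp)
  funext i
  simp [mul_smul]

theorem crossForm_sub (H : LinearMap.BilinForm ℝ ((Fin 3 → FieldSpace) × FieldSpace))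
    (s s' : Fin 3 → ℝ) (a b : FieldSpace) :
    crossForm H (s - s') a b = crossForm H s a b - crossForm H s' a b := by
  rw [sub_eq_add_neg, crossForm_add, ← neg_one_smul ℝ s', crossForm_smul]
  ring

theorem vec_eq_sum (s : Fin 3 → ℝ) : s = ∑ i, s i • unitVec i := by
  funext j
  fin_cases j <;> simp [Fin.sum_univ_three]

theorem crossForm_eq_zero {H : LinearMap.BilinForm ℝ ((Fin 3 → FieldSpace) × FieldSpace)}
    {a b : FieldSpace} (h : ∀ i, crossForm H (unitVec i) a b = 0) (s : Fin 3 → ℝ) :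
    crossForm H s a b = 0 := by
  rw [vec_eq_sum s]
  simp only [Fin.sum_univ_three, crossForm_add, crossForm_smul, h, mul_zero, add_zero]

theorem field_functional_eq_zero (g : FieldSpace →ₗ[ℝ] ℝ)
    (h₁ : ∀ i j, g (symTen (unitVec i) (unitVec j)) = 0) (h₂ : g scalField = 0)
    (h₃ : ∀ β, g (vecField β) = 0) (q : FieldSpace) : g q = 0 := by
  rw [field_eq_sum q]
  simp [h₁, h₂, h₃]

theorem symTen_polarization (g : FieldSpace →ₗ[ℝ] ℝ) (h : ∀ r, g (symTen r r) = 0)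
    (r p : Fin 3 → ℝ) : g (symTen r p) = 0 := by
  have := h (r + p)
  simp only [symTen_add_left, symTen_add_right, map_add, h, symTen_comm p r] at this
  linarith

/-- The parameters for which the space of candidate symmetrizers has the generic dimension. -/
structure GenericParameters (l c : ℝ) : Prop where
  ne_one : l ≠ 1
  ne_vector : l ≠ (1 + c) * (1 + 3 * l) / 4
  vector_ne_one : (1 + c) * (1 + 3 * l) / 4 ≠ 1
  longitudinal_ne_one : (1 + c) * l ≠ 1
  trace_ne : l - 1 - c * (1 + l) ≠ 0

section uniqueness

variable {l c : ℝ} {H : LinearMap.BilinForm ℝ ((Fin 3 → FieldSpace) × FieldSpace)}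

theorem kineticForm_waveOp (hH : (waveSystem l c).IsCandidate H) (s : Fin 3 → ℝ)
    (a b : FieldSpace) :
    kineticForm H a (waveOp l c s b) = kineticForm H (waveOp l c s a) b :=
  candidate_waveOp_symm hH s a b

theorem kineticForm_comm (hH : (waveSystem l c).IsCandidate H) (a b : FieldSpace) :
    kineticForm H a b = kineticForm H b a :=
  hH.1 _ _

theorem crossForm_comm (hH : (waveSystem l c).IsCandidate H) (s : Fin 3 → ℝ)
    (a b : FieldSpace) : crossForm H s a b = crossForm H s b a :=
  (((isCandidate_waveSystem_iff l c H).1 hH).2 s).2.1 a b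

theorem crossForm_waveOp (hH : (waveSystem l c).IsCandidate H) (s : Fin 3 → ℝ)
    (a b : FieldSpace) :
    crossForm H s (waveOp l c s a) b = crossForm H s a (waveOp l c s b) := by
  rw [crossForm_comm hH s a]
  exact (((isCandidate_waveSystem_iff l c H).1 hH).2 s).2.2 a b

/-- The scalar is a source of the tensor, so symmetry of K on a tensor and the scalar expresses the
whole tensor part of K through its tensor-scalar part. The latter has to be a multiple of the trace,
and a single constant, the value on the flat metric, controls everything. -/
theorem kineticForm_ten_scal_eq_zero (hc : c ≠ 0) (hg : GenericParameters l c)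
    (hH : (waveSystem l c).IsCandidate H) (h0 : kineticForm H flatTen scalField = 0) :
    (∀ r p, kineticForm H (symTen r p) scalField = 0) ∧
      ∀ r p r' p', kineticForm H (symTen r p) (symTen r' p') = 0 := by
  have e : ∀ r s : Fin 3 → ℝ, l * (s ⬝ᵥ s) * kineticForm H (symTen r r) scalField -
      2 * c * kineticForm H (symTen r r) (symTen s s) =
      (s ⬝ᵥ s) * kineticForm H (symTen r r) scalField +
      ((1 + c) * (1 + 3 * l) / 2 - 2) * (s ⬝ᵥ r) * kineticForm H (symTen s r) scalField +
      (1 - (1 + c) * (1 + l) / 2) * (r ⬝ᵥ r) * kineticForm H (symTen s s) scalField := fun r s => by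
    have := kineticForm_waveOp hH s (symTen r r) scalField
    rw [waveOp_scalField, waveOp_symTen] at this
    simpa [h0] using this
  -- Antisymmetrizing `e` in r and s removes K(rr, ss) and the mixed term; what is left carries the
  -- factor (l − 1 − c(1 + l))/2. Hence K(rr, scalar) is proportional to r · r.
  have e' : ∀ r s : Fin 3 → ℝ, (s ⬝ᵥ s) * kineticForm H (symTen r r) scalField =
      (r ⬝ᵥ r) * kineticForm H (symTen s s) scalField := fun r s => by
    have h₁ := e r s
    have h₂ := e s r
    rw [kineticForm_comm hH (symTen s s) (symTen r r), symTen_comm r s, dotProduct_comm r s] at h₂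
    apply mul_left_cancel₀ hg.trace_ne
    linear_combination 2 * h₁ - 2 * h₂
  have e'' : ∀ r : Fin 3 → ℝ, kineticForm H (symTen r r) scalField = 0 := by
    have hu : ∀ i, kineticForm H (symTen (unitVec i) (unitVec i)) scalField =
        kineticForm H (symTen (unitVec 0) (unitVec 0)) scalField := fun i => by
      simpa using e' (unitVec i) (unitVec 0)
    have h00 : kineticForm H (symTen (unitVec 0) (unitVec 0)) scalField = 0 := by
      rw [flatTen_eq_sum] at h0
      simp only [Fin.sum_univ_three, map_add, LinearMap.add_apply] at h0
      linarith [hu 1, hu 2]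
    intro r
    simpa [h00] using e' r (unitVec 0)
  have e3 : ∀ r p, kineticForm H (symTen r p) scalField = 0 :=
    symTen_polarization ((kineticForm H).flip scalField) e''
  have e4 : ∀ r s, kineticForm H (symTen r r) (symTen s s) = 0 := fun r s => by
    have := e r s
    simp only [e3] at this
    apply mul_left_cancel₀ hc
    linarith
  exact ⟨e3, fun r p r' p' => symTen_polarization ((kineticForm H).flip (symTen r' p'))
    (fun r => symTen_polarization (kineticForm H (symTen r r)) (e4 r) r' p') r p⟩

/-- For l ≠ 1 longitudinal and transverse vectors have different speeds in every direction, so the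
vector part of K is a multiple of the Euclidean product and is determined by one value. -/
theorem kineticForm_vec_eq_zero (hc : 1 + c ≠ 0) (hg : GenericParameters l c)
    (hH : (waveSystem l c).IsCandidate H)
    (h0 : kineticForm H (vecField (unitVec 0)) (vecField (unitVec 0)) = 0) (s b : Fin 3 → ℝ) :
    kineticForm H (vecField s) (vecField b) = 0 := by
  have e : ∀ s a b : Fin 3 → ℝ, (s ⬝ᵥ b) * kineticForm H (vecField a) (vecField s) =
      (s ⬝ᵥ a) * kineticForm H (vecField s) (vecField b) := fun s a b => by
    have := kineticForm_waveOp hH s (vecField a) (vecField b)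
    simp only [waveOp_vecField, map_add, map_smul, LinearMap.add_apply, LinearMap.smul_apply,
      smul_eq_mul] at this
    apply mul_left_cancel₀ (mul_ne_zero hc (sub_ne_zero.2 hg.ne_one))
    linear_combination 4 * this
  have e0 : ∀ b, kineticForm H (vecField (unitVec 0)) (vecField b) = 0 := fun b => by
    simpa [h0] using (e (unitVec 0) (unitVec 0) b).symm
  have e1 : ∀ s : Fin 3 → ℝ, s 0 = 1 → kineticForm H (vecField s) (vecField b) = 0 :=
    fun s hs => by
      simpa [e0, hs] using (e s (unitVec 0) b).symm
  -- An arbitrary vector is shifted along the first axis to one with first component 1; the shift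
  -- does not change the value, by `e0`.
  have h := e1 (s + (1 - s 0) • unitVec 0) (by simp)
  simpa [vecField_add, vecField_smul, e0] using h

theorem kineticForm_eq_zero (hc : c ≠ 0) (hc' : 1 + c ≠ 0) (hg : GenericParameters l c)
    (hH : (waveSystem l c).IsCandidate H)
    (hblock : ∀ u u', IsFirstBlock u → IsSecondBlock u' → H u u' = 0)
    (h₁ : kineticForm H flatTen scalField = 0) (h₂ : kineticForm H scalField scalField = 0)
    (h₃ : kineticForm H (vecField (unitVec 0)) (vecField (unitVec 0)) = 0) (a b : FieldSpace) :
    kineticForm H a b = 0 := by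
  obtain ⟨hts, htt⟩ := kineticForm_ten_scal_eq_zero hc hg hH h₁
  -- As momenta, a vector lies in the first block and a tensor or scalar in the second, so K does
  -- not couple them.
  have hvb : ∀ β a, vec a = 0 → kineticForm H (vecField β) a = 0 := fun β a ha => by
    refine hblock _ _ ⟨fun i k => rfl, fun kl => ?_, rfl⟩ ⟨fun i kl => rfl, fun i => rfl, ?_⟩
    · exact congrFun (congrFun (ten_vecField β) kl.1) kl.2
    · exact fun k => congrFun ha k
  refine field_functional_eq_zero ((kineticForm H).flip b) (fun i j => ?_) ?_ (fun β => ?_) a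
  · refine field_functional_eq_zero (kineticForm H _) (fun k m => htt _ _ _ _) (hts _ _)
      (fun β => ?_) b
    rw [kineticForm_comm hH]
    exact hvb _ _ rfl
  · refine field_functional_eq_zero (kineticForm H _) (fun k m => ?_) h₂ (fun β => ?_) b
    · rw [kineticForm_comm hH]
      exact hts _ _
    · rw [kineticForm_comm hH]
      exact hvb _ _ rfl
  · exact field_functional_eq_zero (kineticForm H _) (fun k m => hvb _ _ rfl) (hvb _ _ rfl)
      (fun β' => kineticForm_vec_eq_zero hc' hg hH h₃ β β') b

theorem crossForm_vec (hH : (waveSystem l c).IsCandidate H) (s : Fin 3 → ℝ) (a : FieldSpace)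
    (β : Fin 3 → ℝ) : crossForm H s (waveOp l c s a) (vecField β) =
      (1 + c) * (1 + 3 * l) / 4 * (s ⬝ᵥ s) * crossForm H s a (vecField β) +
        (1 + c) * (l - 1) / 4 * (s ⬝ᵥ β) * crossForm H s a (vecField s) := by
  rw [crossForm_waveOp hH, waveOp_vecField]
  simp

/-- The longitudinal part of the coupling of momenta and derivatives of the vector. -/
theorem crossForm_longitudinal_eq_zero (hl : l ≠ 0) (hc : c ≠ 0) (hc' : 1 + c ≠ 0)
    (hg : GenericParameters l c) (hH : (waveSystem l c).IsCandidate H)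
    (h0 : crossForm H (unitVec 0) scalField (vecField (unitVec 0)) = 0) (s β : Fin 3 → ℝ) :
    crossForm H s scalField (vecField β) = 0 ∧ crossForm H s (symTen s s) (vecField β) = 0 ∧
      crossForm H s flatTen (vecField β) = 0 := by
  have hll := sub_ne_zero.2 hg.ne_one
  have hlv := sub_ne_zero.2 hg.ne_vector
  have hpos : ∀ {s : Fin 3 → ℝ}, s ≠ 0 → s ⬝ᵥ s ≠ 0 := fun hs h => hs (dotProduct_self_eq_zero.1 h)
  -- the scalar is a source of the tensor
  have e1 : ∀ s β : Fin 3 → ℝ, 2 * c * crossForm H s (symTen s s) (vecField β) =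
      (l - (1 + c) * (1 + 3 * l) / 4) * (s ⬝ᵥ s) * crossForm H s scalField (vecField β) -
      (1 + c) * (l - 1) / 4 * (s ⬝ᵥ β) * crossForm H s scalField (vecField s) := fun s β => by
    have := crossForm_vec hH s scalField β
    rw [waveOp_scalField] at this
    simp only [map_sub, map_smul, LinearMap.sub_apply, LinearMap.smul_apply, smul_eq_mul] at this
    linear_combination -this
  -- The square of s has speed (1 + c)l and a transverse vector has speed v; these differ by (1 +
  -- c)(l − 1)/4, and eigenvectors with different eigenvalues are orthogonal for the coupling.
  have e2 : ∀ s β : Fin 3 → ℝ, s ⬝ᵥ β = 0 → crossForm H s (symTen s s) (vecField β) = 0 :=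
    fun s β hsβ => by
      rcases eq_or_ne s 0 with rfl | hs
      · simpa using crossForm_smul H 0 0 (symTen 0 0) (vecField β)
      have := crossForm_vec hH s (symTen s s) β
      rw [waveOp_symTen_self, hsβ] at this
      simp only [map_smul, LinearMap.smul_apply, smul_eq_mul] at this
      apply mul_left_cancel₀ (mul_ne_zero (mul_ne_zero hc' hll) (hpos hs))
      linear_combination 4 * this
  have e3 : ∀ s β : Fin 3 → ℝ, s ⬝ᵥ β = 0 → crossForm H s scalField (vecField β) = 0 :=
    fun s β hsβ => by
      rcases eq_or_ne s 0 with rfl | hs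
      · simpa using crossForm_smul H 0 0 scalField (vecField β)
      have := e1 s β
      rw [e2 s β hsβ, hsβ] at this
      apply mul_left_cancel₀ (mul_ne_zero hlv (hpos hs))
      linear_combination -this
  -- A bilinear form in (s, β) that vanishes on orthogonal pairs is a multiple of s · β: the
  -- orthogonal pair e₀ + eᵢ, e₀ − eᵢ makes its diagonal entries equal.
  have e4 : ∀ i, crossForm H (unitVec i) scalField (vecField (unitVec i)) = 0 := fun i => by
    rcases eq_or_ne i 0 with rfl | hi
    · exact h0
    have h := e3 (unitVec 0 + unitVec i) (unitVec 0 + (-1 : ℝ) • unitVec i)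
      (by simp [hi, hi.symm])
    have h₁ := e3 (unitVec 0) (unitVec i) (by simp [hi.symm])
    have h₂ := e3 (unitVec i) (unitVec 0) (by simp [hi])
    simp only [crossForm_add, vecField_add, vecField_smul, map_add, map_smul, h0, h₁, h₂,
      smul_eq_mul] at h
    linarith
  have e5 : ∀ i j, crossForm H (unitVec i) scalField (vecField (unitVec j)) = 0 := fun i j => by
    rcases eq_or_ne i j with rfl | hij
    · exact e4 i
    · exact e3 _ _ (by simp [hij])
  have e6 : ∀ s β : Fin 3 → ℝ, crossForm H s scalField (vecField β) = 0 := fun s β =>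
    crossForm_eq_zero (fun i => by
      rw [vec_eq_sum β]
      simp [Fin.sum_univ_three, vecField_add, vecField_smul, e5]) s
  have e7 : ∀ s β : Fin 3 → ℝ, crossForm H s (symTen s s) (vecField β) = 0 := fun s β => by
    have := e1 s β
    rw [e6, e6] at this
    apply mul_left_cancel₀ hc
    linarith
  refine ⟨e6 s β, e7 s β, ?_⟩
  rcases eq_or_ne s 0 with rfl | hs
  · simpa using crossForm_smul H 0 0 flatTen (vecField β)
  have e8 : ∀ β, (l - (1 + c) * (1 + 3 * l) / 4) * (s ⬝ᵥ s) * crossForm H s flatTen (vecField β) =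
      (1 + c) * (l - 1) / 4 * (s ⬝ᵥ β) * crossForm H s flatTen (vecField s) := fun β => by
    have := crossForm_vec hH s flatTen β
    rw [waveOp_flatTen] at this
    simp only [map_sub, map_smul, LinearMap.sub_apply, LinearMap.smul_apply, smul_eq_mul,
      e7] at this
    linear_combination this
  -- For β = s the two coefficients in `e8` combine to l − (1 + c)l = −lc.
  have e9 : crossForm H s flatTen (vecField s) = 0 := by
    apply mul_left_cancel₀ (mul_ne_zero (mul_ne_zero hl hc) (hpos hs))
    linear_combination - e8 s
  apply mul_left_cancel₀ (mul_ne_zero hlv (hpos hs))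
  rw [e8 β, e9]
  ring

/-- Modulo ss and the flat metric, on which the coupling already vanishes, the square of a
transverse p has speed 1. This differs from both speeds of the vector, (1 + c)l and v, so the two
are orthogonal. -/
theorem crossForm_transverse_eq_zero (hl : l ≠ 0) (hc : c ≠ 0) (hc' : 1 + c ≠ 0)
    (hg : GenericParameters l c) (hH : (waveSystem l c).IsCandidate H)
    (h0 : crossForm H (unitVec 0) scalField (vecField (unitVec 0)) = 0) (s p β : Fin 3 → ℝ)
    (hsp : s ⬝ᵥ p = 0) : crossForm H s (symTen p p) (vecField β) = 0 := by
  rcases eq_or_ne s 0 with rfl | hs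
  · simpa using crossForm_smul H 0 0 (symTen p p) (vecField β)
  have hss : s ⬝ᵥ s ≠ 0 := fun h => hs (dotProduct_self_eq_zero.1 h)
  have e : ∀ β, (1 - (1 + c) * (1 + 3 * l) / 4) * (s ⬝ᵥ s) *
      crossForm H s (symTen p p) (vecField β) =
      (1 + c) * (l - 1) / 4 * (s ⬝ᵥ β) * crossForm H s (symTen p p) (vecField s) := fun β => by
    have := crossForm_vec hH s (symTen p p) β
    rw [waveOp_symTen, hsp] at this
    obtain ⟨-, h₁, h₂⟩ := crossForm_longitudinal_eq_zero hl hc hc' hg hH h0 s β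
    simp only [map_add, map_smul, LinearMap.add_apply, LinearMap.smul_apply, smul_eq_mul,
      h₁, h₂] at this
    linear_combination this
  have e' : crossForm H s (symTen p p) (vecField s) = 0 := by
    apply mul_left_cancel₀ (mul_ne_zero (sub_ne_zero.2 hg.longitudinal_ne_one) hss)
    linear_combination - e s
  apply mul_left_cancel₀ (mul_ne_zero (sub_ne_zero.2 hg.vector_ne_one.symm) hss)
  rw [e β, e']
  ring

/-- For fixed β the coupling is linear in s and in a symmetric tensor. Vanishing on ss for all s,
and on pp for p orthogonal to s, forces all its components to vanish, by polarization along the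
axes. -/
theorem crossForm_ten_vec_eq_zero (hl : l ≠ 0) (hc : c ≠ 0) (hc' : 1 + c ≠ 0)
    (hg : GenericParameters l c) (hH : (waveSystem l c).IsCandidate H)
    (h0 : crossForm H (unitVec 0) scalField (vecField (unitVec 0)) = 0) (s β : Fin 3 → ℝ)
    (i j : Fin 3) : crossForm H s (symTen (unitVec i) (unitVec j)) (vecField β) = 0 := by
  have hself : ∀ s, crossForm H s (symTen s s) (vecField β) = 0 := fun s =>
    (crossForm_longitudinal_eq_zero hl hc hc' hg hH h0 s β).2.1
  have htrans : ∀ s p : Fin 3 → ℝ, s ⬝ᵥ p = 0 → crossForm H s (symTen p p) (vecField β) = 0 :=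
    fun s p => crossForm_transverse_eq_zero hl hc hc' hg hH h0 s p β
  have hdiag : ∀ i k, crossForm H (unitVec k) (symTen (unitVec i) (unitVec i)) (vecField β) = 0 :=
    fun i k => by
      rcases eq_or_ne k i with rfl | hki
      · exact hself _
      · exact htrans _ _ (by simp [hki])
  refine crossForm_eq_zero (fun k => ?_) s
  rcases eq_or_ne i j with rfl | hij
  · exact hdiag i k
  have hmixed : ∀ i j : Fin 3, i ≠ j →
      crossForm H (unitVec i) (symTen (unitVec i) (unitVec j)) (vecField β) = 0 := fun i j hij => by
    -- With the diagonal terms gone, the sum and the difference of the two axes make the two mixed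
    -- components both opposite and equal.
    have h₁ := hself (unitVec i + unitVec j)
    have h₂ := hself (unitVec i - unitVec j)
    simp only [symTen_add_left, symTen_add_right, symTen_sub_left, symTen_sub_right, crossForm_add,
      crossForm_sub, map_add, map_sub, LinearMap.add_apply, LinearMap.sub_apply, hdiag,
      symTen_comm (unitVec j) (unitVec i)] at h₁ h₂
    linarith
  rcases eq_or_ne k i with rfl | hki
  · exact hmixed k j hij
  rcases eq_or_ne k j with rfl | hkj
  · rw [symTen_comm]
    exact hmixed k i hij.symm
  have h := htrans (unitVec k) (unitVec i + unitVec j)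
    (by simp [hki, hkj])
  simp only [symTen_add_left, symTen_add_right, map_add, LinearMap.add_apply, hdiag,
    symTen_comm (unitVec j) (unitVec i)] at h
  linarith

theorem crossForm_eq_zero_of_generic (hl : l ≠ 0) (hc : c ≠ 0) (hc' : 1 + c ≠ 0)
    (hg : GenericParameters l c) (hH : (waveSystem l c).IsCandidate H)
    (hblock : ∀ u u', IsFirstBlock u → IsSecondBlock u' → H u u' = 0)
    (h0 : crossForm H (unitVec 0) scalField (vecField (unitVec 0)) = 0) (s : Fin 3 → ℝ)
    (a b : FieldSpace) : crossForm H s a b = 0 := by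
  have htv := crossForm_ten_vec_eq_zero hl hc hc' hg hH h0 s
  have hsv := fun β => (crossForm_longitudinal_eq_zero hl hc hc' hg hH h0 s β).1
  -- The block structure pairs the momentum of the vector with derivatives of the tensor and scalar,
  -- and conversely; the couplings of a field type to its own derivatives vanish.
  have hvv : ∀ β β', crossForm H s (vecField β) (vecField β') = 0 := fun β β' => by
    refine hblock _ _ ⟨fun i k => rfl, fun kl => ?_, rfl⟩ ⟨fun i kl => ?_, fun i => ?_, fun k => rfl⟩
    · exact congrFun (congrFun (ten_vecField β) kl.1) kl.2
    · have := congrFun (congrFun (ten_vecField β') kl.1) kl.2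
      change s i * ten (vecField β') kl.1 kl.2 = 0
      rw [this]
      simp
    · change s i * scal (vecField β') = 0
      simp [scal_vecField]
  have htt : ∀ a b, vec a = 0 → vec b = 0 → crossForm H s a b = 0 := fun a b ha hb => by
    rw [crossForm_apply, hH.1]
    refine hblock _ _ ⟨fun i k => ?_, fun kl => rfl, rfl⟩ ⟨fun i kl => rfl, fun i => rfl, fun k => ?_⟩
    · change s i * vec b k = 0
      simp [hb]
    · exact congrFun ha k
  refine field_functional_eq_zero ((crossForm H s).flip b) (fun i j => ?_) ?_ (fun β => ?_) a
  · exact field_functional_eq_zero (crossForm H s _) (fun k m => htt _ _ rfl rfl) (htt _ _ rfl rfl)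
      (fun β => htv β i j) b
  · exact field_functional_eq_zero (crossForm H s _) (fun k m => htt _ _ rfl rfl) (htt _ _ rfl rfl)
      hsv b
  · refine field_functional_eq_zero (crossForm H s _) (fun k m => ?_) ?_ (hvv β) b
    · rw [crossForm_comm hH]
      exact htv β k m
    · rw [crossForm_comm hH]
      exact hsv β

end uniqueness

/-! ### The dimension of the space of candidate symmetrizers of the wave system -/

/-- Independent components of a field value. -/
def coordIdx : Fin 10 → FieldIdx :=
  ![.inl (0, 0), .inl (0, 1), .inl (0, 2), .inl (1, 1), .inl (1, 2), .inl (2, 2), .inr (.inl ()),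
    .inr (.inr 0), .inr (.inr 1), .inr (.inr 2)]

/-- Independent components of a field value, as functionals. -/
def coord (a : Fin 10) : FieldSpace →ₗ[ℝ] ℝ :=
  LinearMap.proj (coordIdx a) ∘ₗ FieldSpace.subtype

/-- The basis dual to the independent components. -/
def basisField : Fin 10 → FieldSpace :=
  ![symTen (unitVec 0) (unitVec 0), (2 : ℝ) • symTen (unitVec 0) (unitVec 1),
    (2 : ℝ) • symTen (unitVec 0) (unitVec 2), symTen (unitVec 1) (unitVec 1),
    (2 : ℝ) • symTen (unitVec 1) (unitVec 2), symTen (unitVec 2) (unitVec 2), scalField,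
    vecField (unitVec 0), vecField (unitVec 1), vecField (unitVec 2)]

theorem coord_cases (q : FieldSpace) : (fun a => coord a q) =
    ![ten q 0 0, ten q 0 1, ten q 0 2, ten q 1 1, ten q 1 2, ten q 2 2, scal q,
      vec q 0, vec q 1, vec q 2] := by
  funext a
  fin_cases a <;> rfl

/-- The factor 2 in the off-diagonal elements of `basisField` undoes the factor 1/2 of
symmetrization. -/
theorem coord_basisField (a b : Fin 10) : coord a (basisField b) = if a = b then 1 else 0 := by
  rw [congrFun (coord_cases (basisField b)) a]
  fin_cases b <;> fin_cases a <;>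
    simp [basisField, ten_symTen, ten_scalField, ten_vecField, scal_symTen, scal_scalField,
      scal_vecField, vec_symTen, vec_scalField, vec_vecField]

theorem field_eq_sum_coord (q : FieldSpace) : q = ∑ a, coord a q • basisField a := by
  have h := coord_cases q
  have h' : ∀ a, coord a q = (![ten q 0 0, ten q 0 1, ten q 0 2, ten q 1 1, ten q 1 2, ten q 2 2,
      scal q, vec q 0, vec q 1, vec q 2] : Fin 10 → ℝ) a := fun a => congrFun h a
  simp only [h', Fin.sum_univ_succ, Fin.sum_univ_zero, basisField]
  refine field_ext ?_ ?_ ?_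
  · ext i j
    fin_cases i <;> fin_cases j <;>
      simp [ten_symTen, ten_scalField, ten_vecField, ten_symm q 1 0, ten_symm q 2 0,
        ten_symm q 2 1]
  · simp [scal_symTen, scal_scalField, scal_vecField]
  · funext i
    fin_cases i <;> simp [vec_symTen, vec_scalField, vec_vecField]

theorem vec_basisField {a : Fin 10} (h : a < 7) : vec (basisField a) = 0 := by
  revert h
  fin_cases a <;> intro h <;>
    first
    | exact absurd h (by decide)
    | simp [basisField, vec_symTen, vec_scalField]

theorem ten_scal_basisField {a : Fin 10} (h : ¬ a < 7) :
    ten (basisField a) = 0 ∧ scal (basisField a) = 0 := by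
  revert h
  fin_cases a <;> intro h <;>
    first
    | exact absurd (by decide) h
    | simp [basisField, ten_vecField, scal_vecField]

/-- Pairs of derivatives and pairs of components that index the freely specifiable part of candidate
symmetrizers. -/
abbrev SkewIdx : Type :=
  {x : Fin 3 × Fin 3 // x.1 < x.2} × {y : Fin 10 × Fin 10 // y.1 < y.2 ∧ (y.1 < 7 ↔ y.2 < 7)}

/-- There are 3 pairs of derivatives. The components below 7 are those of the tensor and the scalar
and form 21 pairs; the other three are those of the vector and form 3 pairs. -/
theorem card_skewIdx : Fintype.card SkewIdx = 72 := by
  rw [Fintype.card_prod]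
  decide

/-- The extension by zero. -/
def skewExt (S : SkewIdx → ℝ) (i j : Fin 3) (a b : Fin 10) : ℝ :=
  if h : i < j ∧ a < b ∧ (a < 7 ↔ b < 7) then S (⟨(i, j), h.1⟩, ⟨(a, b), h.2⟩) else 0

/-- The extension to coefficients that are antisymmetric in the derivatives and the components. -/
def skewCoeff (S : SkewIdx → ℝ) (i j : Fin 3) (a b : Fin 10) : ℝ :=
  skewExt S i j a b - skewExt S j i a b - skewExt S i j b a + skewExt S j i b a

/-- The form with given coefficients. -/
def skewForm (S : SkewIdx → ℝ) : LinearMap.BilinForm ℝ ((Fin 3 → FieldSpace) × FieldSpace) :=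
  LinearMap.mk₂ ℝ
    (fun u u' => ∑ i, ∑ j, ∑ a, ∑ b, skewCoeff S i j a b * (coord a (u.1 i) * coord b (u'.1 j)))
    (fun u u' w => by simp [add_mul, mul_add, Finset.sum_add_distrib])
    (fun t u w => by
      simp only [Prod.smul_fst, Pi.smul_apply, map_smul, smul_eq_mul, Finset.mul_sum]
      simp only [mul_left_comm, mul_assoc])
    (fun u u' w => by simp [mul_add, Finset.sum_add_distrib])
    (fun t u w => by
      simp only [Prod.smul_fst, Pi.smul_apply, map_smul, smul_eq_mul, Finset.mul_sum]
      simp only [mul_left_comm])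

theorem skewForm_apply (S : SkewIdx → ℝ) (u u' : (Fin 3 → FieldSpace) × FieldSpace) :
    skewForm S u u' = ∑ i, ∑ j, ∑ a, ∑ b,
      skewCoeff S i j a b * (coord a (u.1 i) * coord b (u'.1 j)) := rfl

theorem skewCoeff_swap (S : SkewIdx → ℝ) (i j : Fin 3) (a b : Fin 10) :
    skewCoeff S i j a b = skewCoeff S j i b a := by
  simp only [skewCoeff]
  ring

theorem skewCoeff_swap_left (S : SkewIdx → ℝ) (i j : Fin 3) (a b : Fin 10) :
    skewCoeff S i j a b = - skewCoeff S j i a b := by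
  simp only [skewCoeff]
  ring

theorem skewCoeff_of_block_ne (S : SkewIdx → ℝ) (i j : Fin 3) {a b : Fin 10}
    (h : ¬ (a < 7 ↔ b < 7)) : skewCoeff S i j a b = 0 := by
  have h' : ¬ (b < 7 ↔ a < 7) := fun e => h e.symm
  simp [skewCoeff, skewExt, h, h']

theorem skewCoeff_of_lt (S : SkewIdx → ℝ) (x : SkewIdx) :
    skewCoeff S x.1.1.1 x.1.1.2 x.2.1.1 x.2.1.2 = S x := by
  obtain ⟨⟨⟨i, j⟩, hij⟩, ⟨⟨a, b⟩, hab⟩⟩ := x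
  simp only at hij hab
  simp [skewCoeff, skewExt, hij, hab, hij.not_gt, hab.1.not_gt]

theorem skewForm_symm (S : SkewIdx → ℝ) (u u' : (Fin 3 → FieldSpace) × FieldSpace) :
    skewForm S u u' = skewForm S u' u := by
  simp only [skewForm_apply]
  rw [Finset.sum_comm]
  refine Finset.sum_congr rfl fun i _ => Finset.sum_congr rfl fun j _ => ?_
  rw [Finset.sum_comm]
  refine Finset.sum_congr rfl fun a _ => Finset.sum_congr rfl fun b _ => ?_
  rw [skewCoeff_swap]
  ring

/-- On a plane wave the derivatives give the symmetric product of the components of s, while the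
coefficients are antisymmetric in the derivatives. These forms are therefore candidates for any
system and do not contribute to the minors. -/
theorem skewForm_contraction (S : SkewIdx → ℝ) (s : Fin 3 → ℝ) (x y : FieldSpace × FieldSpace) :
    skewForm S (contraction s x) (contraction s y) = 0 := by
  have h : skewForm S (contraction s x) (contraction s y) =
      - skewForm S (contraction s x) (contraction s y) := by
    conv_lhs => rw [skewForm_apply, Finset.sum_comm]
    rw [skewForm_apply, ← Finset.sum_neg_distrib]
    refine Finset.sum_congr rfl fun i _ => ?_
    rw [← Finset.sum_neg_distrib]
    refine Finset.sum_congr rfl fun j _ => ?_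
    rw [← Finset.sum_neg_distrib]
    refine Finset.sum_congr rfl fun a _ => ?_
    rw [← Finset.sum_neg_distrib]
    refine Finset.sum_congr rfl fun b _ => ?_
    rw [skewCoeff_swap_left]
    simp only [contraction_fst, map_smul, smul_eq_mul]
    ring
  linarith

theorem coord_of_vec {a : Fin 10} (ha : ¬ a < 7) {q : FieldSpace} (hq : vec q = 0) :
    coord a q = 0 := by
  have h := congrFun (coord_cases q) a
  simp only [hq] at h
  rw [h]
  revert ha
  clear h
  fin_cases a <;> intro h <;>
    first
    | exact absurd (by decide) h
    | rfl

theorem coord_of_ten_scal {a : Fin 10} (ha : a < 7) {q : FieldSpace} (hq : ten q = 0)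
    (hq' : scal q = 0) : coord a q = 0 := by
  have h := congrFun (coord_cases q) a
  simp only [hq, hq'] at h
  rw [h]
  revert ha
  clear h
  fin_cases a <;> intro h <;>
    first
    | exact absurd h (by decide)
    | rfl

theorem IsFirstBlock.vec_eq {u : (Fin 3 → FieldSpace) × FieldSpace} (h : IsFirstBlock u)
    (i : Fin 3) : vec (u.1 i) = 0 := funext fun k => h.1 i k

theorem IsFirstBlock.ten_eq {u : (Fin 3 → FieldSpace) × FieldSpace} (h : IsFirstBlock u) :
    ten u.2 = 0 := by
  ext k m
  exact h.2.1 (k, m)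

theorem IsFirstBlock.scal_eq {u : (Fin 3 → FieldSpace) × FieldSpace} (h : IsFirstBlock u) :
    scal u.2 = 0 := h.2.2

theorem IsSecondBlock.ten_eq {u : (Fin 3 → FieldSpace) × FieldSpace} (h : IsSecondBlock u)
    (i : Fin 3) : ten (u.1 i) = 0 := by
  ext k m
  exact h.1 i (k, m)

theorem IsSecondBlock.scal_eq {u : (Fin 3 → FieldSpace) × FieldSpace} (h : IsSecondBlock u)
    (i : Fin 3) : scal (u.1 i) = 0 := h.2.1 i

theorem IsSecondBlock.vec_eq {u : (Fin 3 → FieldSpace) × FieldSpace} (h : IsSecondBlock u) :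
    vec u.2 = 0 := funext fun k => h.2.2 k

theorem skewForm_mem (l c : ℝ) (S : SkewIdx → ℝ) :
    skewForm S ∈ blockCandidates (waveSystem l c) := by
  refine ⟨(isCandidate_iff _ _).2 ⟨skewForm_symm S, fun s x y => ?_⟩, fun u u' hu hu' => ?_⟩
  · rw [skewForm_contraction, skewForm_contraction]
  · rw [skewForm_apply]
    refine Finset.sum_eq_zero fun i _ => Finset.sum_eq_zero fun j _ =>
      Finset.sum_eq_zero fun a _ => Finset.sum_eq_zero fun b _ => ?_
    by_cases ha : a < 7
    · by_cases hb : b < 7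
      · rw [coord_of_ten_scal hb (hu'.ten_eq j) (hu'.scal_eq j)]
        ring
      · rw [skewCoeff_of_block_ne S i j (by tauto)]
        ring
    · rw [coord_of_vec ha (hu.vec_eq i)]
      ring

/-- An invariant form on field values. -/
def invariantForm (l : ℝ) (r : Fin 4 → ℝ) : LinearMap.BilinForm ℝ FieldSpace :=
  LinearMap.mk₂ ℝ
    (fun a b => r 2 * ((1 + 3 * l) * (ten a * ten b).trace - (1 + l) * (ten a).trace * (ten b).trace -
      4 * ((ten a).trace * scal b + scal a * (ten b).trace)) + r 0 * (scal a * scal b) +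
      r 1 * (vec a ⬝ᵥ vec b))
    (fun u u' w => by simp [add_mul]; ring)
    (fun t u w => by simp; ring)
    (fun u u' w => by simp [mul_add]; ring)
    (fun t u w => by simp; ring)

theorem invariantForm_apply (l : ℝ) (r : Fin 4 → ℝ) (a b : FieldSpace) :
    invariantForm l r a b = r 2 * ((1 + 3 * l) * (ten a * ten b).trace -
      (1 + l) * (ten a).trace * (ten b).trace -
      4 * ((ten a).trace * scal b + scal a * (ten b).trace)) + r 0 * (scal a * scal b) +
      r 1 * (vec a ⬝ᵥ vec b) := rfl

/-- An invariant coupling of a tensor and a scalar with a vector. -/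
def invariantCoupling (l : ℝ) (m : ℝ) (i : Fin 3) : LinearMap.BilinForm ℝ FieldSpace :=
  LinearMap.mk₂ ℝ
    (fun a b => m * (-(1 + 3 * l) / 4 * (ten a).mulVec (vec b) i +
      ((1 + l) / 4 * (ten a).trace + scal a) * vec b i))
    (fun u u' w => by simp [Matrix.add_mulVec]; ring)
    (fun t u w => by simp [Matrix.smul_mulVec]; ring)
    (fun u u' w => by simp [Matrix.mulVec_add]; ring)
    (fun t u w => by simp [Matrix.mulVec_smul]; ring)

theorem invariantCoupling_apply (l : ℝ) (m : ℝ) (i : Fin 3) (a b : FieldSpace) :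
    invariantCoupling l m i a b = m * (-(1 + 3 * l) / 4 * (ten a).mulVec (vec b) i +
      ((1 + l) / 4 * (ten a).trace + scal a) * vec b i) := rfl

theorem invariantForm_symm (l : ℝ) (r : Fin 4 → ℝ) (a b : FieldSpace) :
    invariantForm l r a b = invariantForm l r b a := by
  rw [invariantForm_apply, invariantForm_apply, Matrix.trace_mul_comm, dotProduct_comm]
  ring

/-- The tensor part with coefficient `r 2` realizes the obstruction: for unit s it takes the value
2l on (ss, ss) and −2 on (ss, flat metric), so that l K(ss, δ) = −K(ss, ss). -/
theorem invariantForm_waveOp (l c : ℝ) (r : Fin 4 → ℝ) (s : Fin 3 → ℝ) (a b : FieldSpace) :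
    invariantForm l r a (waveOp l c s b) = invariantForm l r (waveOp l c s a) b := by
  simp only [invariantForm_apply, Matrix.trace, Matrix.diag_apply, Matrix.mul_apply,
    Fin.sum_univ_three, dotProduct, ten_waveOp, scal_waveOp, vec_waveOp, Matrix.mulVec,
    ten_symm _ 1 0, ten_symm _ 2 0, ten_symm _ 2 1, Matrix.one_apply]
  simp
  ring

/-- Contracted with s, the coupling is for c ≠ −1 a multiple of the product of the vector part of b
with that of F a, where F is the flat coupling `flatMixed` of positions to their derivatives. F
commutes with `waveOp`, because the potential annihilates pure gauge tensors, and the vector part of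
`waveOp` is symmetric. -/
theorem invariantCoupling_waveOp (l c m : ℝ) (s : Fin 3 → ℝ) (a b : FieldSpace) :
    ∑ i, s i * (invariantCoupling l m i (waveOp l c s a) b +
      invariantCoupling l m i b (waveOp l c s a)) =
    ∑ i, s i * (invariantCoupling l m i (waveOp l c s b) a +
      invariantCoupling l m i a (waveOp l c s b)) := by
  simp only [invariantCoupling_apply, Matrix.trace, Matrix.diag_apply,
    Fin.sum_univ_three, dotProduct, ten_waveOp, scal_waveOp, vec_waveOp, Matrix.mulVec,
    ten_symm _ 1 0, ten_symm _ 2 0, ten_symm _ 2 1, Matrix.one_apply]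
  simp
  ring

theorem waveSystem_B₁_comm (l c : ℝ) (i j : Fin 3) :
    (waveSystem l c).B₁ i j = (waveSystem l c).B₁ j i := by
  simp only [waveSystem, add_comm (unitVec i)]
  congr 1
  abel

/-- The energy with an invariant kinetic part. -/
def invariantEnergy (l c : ℝ) (r : Fin 4 → ℝ) :
    LinearMap.BilinForm ℝ ((Fin 3 → FieldSpace) × FieldSpace) :=
  LinearMap.mk₂ ℝ
    (fun u u' => invariantForm l r u.2 u'.2 +
      ∑ i, (invariantCoupling l (r 3) i u.2 (u'.1 i) + invariantCoupling l (r 3) i (u'.1 i) u.2) +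
      ∑ i, (invariantCoupling l (r 3) i u'.2 (u.1 i) + invariantCoupling l (r 3) i (u.1 i) u'.2) +
      ∑ i, ∑ j, invariantForm l r (u.1 i) ((waveSystem l c).B₁ i j (u'.1 j)))
    (fun u u' w => by simp [Finset.sum_add_distrib]; ring)
    (fun t u w => by simp [Finset.mul_sum, mul_add])
    (fun u u' w => by simp [Finset.sum_add_distrib]; ring)
    (fun t u w => by simp [Finset.mul_sum, mul_add])

theorem invariantEnergy_apply (l c : ℝ) (r : Fin 4 → ℝ)
    (u u' : (Fin 3 → FieldSpace) × FieldSpace) :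
    invariantEnergy l c r u u' = invariantForm l r u.2 u'.2 +
      ∑ i, (invariantCoupling l (r 3) i u.2 (u'.1 i) + invariantCoupling l (r 3) i (u'.1 i) u.2) +
      ∑ i, (invariantCoupling l (r 3) i u'.2 (u.1 i) + invariantCoupling l (r 3) i (u.1 i) u'.2) +
      ∑ i, ∑ j, invariantForm l r (u.1 i) ((waveSystem l c).B₁ i j (u'.1 j)) := rfl

theorem invariantEnergy_mem (l c : ℝ) (r : Fin 4 → ℝ) :
    invariantEnergy l c r ∈ blockCandidates (waveSystem l c) := by
  have hB : ∀ i j a b, invariantForm l r a ((waveSystem l c).B₁ i j b) =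
      invariantForm l r b ((waveSystem l c).B₁ j i a) := fun i j a b => by
    rw [waveSystem_B₁_comm l c j i, invariantForm_symm l r b]
    simp only [waveSystem, LinearMap.smul_apply, LinearMap.sub_apply, map_smul, map_sub,
      invariantForm_waveOp]
  refine ⟨(isCandidate_waveSystem_iff _ _ _).2 ⟨fun u u' => ?_, fun s => ⟨fun a b => ?_,
    fun a b => ?_, fun a b => ?_⟩⟩, fun u u' hu hu' => ?_⟩
  · simp only [invariantEnergy_apply]
    rw [invariantForm_symm, Finset.sum_comm (f := fun i j => invariantForm l r (u.1 i) _)]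
    simp only [hB _ _ (u.1 _) (u'.1 _)]
    ring
  · simp only [invariantEnergy_apply]
    rw [← sum_waveSystem_B₁]
    simp [mul_left_comm, mul_assoc]
  · simp only [invariantEnergy_apply]
    simp [add_comm]
  · have := invariantCoupling_waveOp l c (r 3) s a b
    simp only [invariantEnergy_apply]
    simpa [mul_add] using this
  · rw [invariantEnergy_apply, invariantForm_apply, hu.ten_eq, hu.scal_eq, hu'.vec_eq]
    have h₁ : ∀ i, invariantCoupling l (r 3) i u.2 (u'.1 i) = 0 := fun i => by
      simp [invariantCoupling_apply, hu.ten_eq, hu.scal_eq]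
    have h₂ : ∀ i, invariantCoupling l (r 3) i (u'.1 i) u.2 = 0 := fun i => by
      simp [invariantCoupling_apply, hu'.ten_eq, hu'.scal_eq]
    have h₃ : ∀ i, invariantCoupling l (r 3) i u'.2 (u.1 i) = 0 := fun i => by
      simp [invariantCoupling_apply, hu.vec_eq]
    have h₄ : ∀ i, invariantCoupling l (r 3) i (u.1 i) u'.2 = 0 := fun i => by
      simp [invariantCoupling_apply, hu'.vec_eq]
    have h₅ : ∀ i j, invariantForm l r (u.1 i) ((waveSystem l c).B₁ i j (u'.1 j)) = 0 :=
      fun i j => by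
        have ht : ∀ s, ten (waveOp l c s (u'.1 j)) = 0 := fun s => by
          ext k m
          simp [ten_waveOp, hu'.ten_eq, hu'.scal_eq]
        have hs : ∀ s, scal (waveOp l c s (u'.1 j)) = 0 := fun s => by
          simp [scal_waveOp, hu'.scal_eq]
        simp [waveSystem, invariantForm_apply, ht, hs, hu.vec_eq]
    simp [h₁, h₂, h₃, h₄, h₅]

theorem isFirstBlock_single {q : FieldSpace} (h : vec q = 0) (i : Fin 3) :
    IsFirstBlock (Pi.single i q, 0) := by
  refine ⟨fun j k => ?_, fun kl => rfl, rfl⟩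
  change vec ((Pi.single i q : Fin 3 → FieldSpace) j) k = 0
  rcases eq_or_ne j i with rfl | hji
  · rw [Pi.single_eq_same, h]
    rfl
  · rw [Pi.single_eq_of_ne hji]
    rfl

theorem isSecondBlock_single {q : FieldSpace} (h : ten q = 0) (h' : scal q = 0) (i : Fin 3) :
    IsSecondBlock (Pi.single i q, 0) := by
  refine ⟨fun j kl => ?_, fun j => ?_, fun k => rfl⟩
  · change ten ((Pi.single i q : Fin 3 → FieldSpace) j) kl.1 kl.2 = 0
    rcases eq_or_ne j i with rfl | hji
    · rw [Pi.single_eq_same, h]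
      rfl
    · rw [Pi.single_eq_of_ne hji]
      rfl
  · change scal ((Pi.single i q : Fin 3 → FieldSpace) j) = 0
    rcases eq_or_ne j i with rfl | hji
    · rw [Pi.single_eq_same, h']
    · rw [Pi.single_eq_of_ne hji, map_zero]

/-- The freely specifiable components of candidate symmetrizers, together with four components of
the kinetic part and the coupling. -/
def candidateCoord (l c : ℝ) :
    blockCandidates (waveSystem l c) →ₗ[ℝ] (SkewIdx → ℝ) × (Fin 4 → ℝ) where
  toFun H := (fun x => H.1 (Pi.single x.1.1.1 (basisField x.2.1.1), 0)
      (Pi.single x.1.1.2 (basisField x.2.1.2), 0),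
    ![kineticForm H.1 scalField scalField,
      kineticForm H.1 (vecField (unitVec 0)) (vecField (unitVec 0)),
      kineticForm H.1 flatTen scalField,
      crossForm H.1 (unitVec 0) scalField (vecField (unitVec 0))])
  map_add' H K := by
    refine Prod.ext rfl ?_
    funext i
    fin_cases i <;> rfl
  map_smul' t H := by
    refine Prod.ext rfl ?_
    funext i
    fin_cases i <;> rfl

theorem bilin_derivative_eq_zero {H : LinearMap.BilinForm ℝ ((Fin 3 → FieldSpace) × FieldSpace)}
    (h : ∀ i j a b, H (Pi.single i (basisField a), 0) (Pi.single j (basisField b), 0) = 0)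
    (d d' : Fin 3 → FieldSpace) : H (d, 0) (d', 0) = 0 := by
  have hd : ∀ d : Fin 3 → FieldSpace, (d, (0 : FieldSpace)) =
      ∑ i, ∑ a, coord a (d i) • (Pi.single i (basisField a), (0 : FieldSpace)) := fun d => by
    refine Prod.ext ?_ ?_
    · simp only [Prod.fst_sum, Prod.smul_fst]
      conv_lhs => rw [← Finset.univ_sum_single d]
      refine Finset.sum_congr rfl fun i _ => ?_
      conv_lhs => rw [field_eq_sum_coord (d i)]
      funext j
      simp only [Finset.sum_apply, Pi.smul_apply]
      rcases eq_or_ne j i with rfl | hji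
      · simp
      · simp [hji]
    · simp [Prod.snd_sum]
  rw [hd d, hd d']
  simp only [map_sum, map_smul, LinearMap.sum_apply, LinearMap.smul_apply, h, smul_zero,
    Finset.sum_const_zero]

/-- When the four constants vanish, so do K and L, and hence the derivative part on all plane waves.
It is then antisymmetric in the two derivatives and, by symmetry of the form, in the two components.
The block condition removes pairs of mixed type, and the first group of coordinates contains exactly
the rest. -/
theorem eq_zero_of_candidateCoord_eq_zero {l c : ℝ} (hl : l ≠ 0) (hc : c ≠ 0) (hc' : 1 + c ≠ 0)
    (hg : GenericParameters l c) (X : blockCandidates (waveSystem l c))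
    (h0 : candidateCoord l c X = 0) : X.1 = 0 := by
  obtain ⟨H, hH, hblock⟩ := X
  have h1 := congrArg Prod.fst h0
  have h2 := congrArg Prod.snd h0
  have hK : ∀ a b, kineticForm H a b = 0 := kineticForm_eq_zero hc hc' hg hH hblock
    (congrFun h2 2) (congrFun h2 0) (congrFun h2 1)
  have hL : ∀ s a b, crossForm H s a b = 0 := fun s a b =>
    crossForm_eq_zero_of_generic hl hc hc' hg hH hblock (congrFun h2 3) s a b
  have hcontr : ∀ (i : Fin 3) (a : FieldSpace),
      contraction (unitVec i) (a, (0 : FieldSpace)) = ((Pi.single i a : Fin 3 → FieldSpace), 0) :=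
    fun i a => by
      refine Prod.ext ?_ rfl
      funext j
      rcases eq_or_ne j i with rfl | hji
      · simp
      · simp [hji]
  have hcross : ∀ i a b, H (0, a) (Pi.single i b, 0) = 0 := fun i a b => by
    rw [← hcontr]
    exact hL _ _ _
  have hN : ∀ s a b, H (contraction s (a, 0)) (contraction s (b, 0)) = 0 := fun s a b => by
    rw [(((isCandidate_waveSystem_iff l c H).1 hH).2 s).1]
    exact hK _ _
  have hskew : ∀ i j a b, H (Pi.single i a, 0) (Pi.single j b, 0) =
      - H (Pi.single j a, 0) (Pi.single i b, 0) := fun i j a b => by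
    have h := hN (unitVec i + unitVec j) a b
    have he : ∀ a : FieldSpace, contraction (unitVec i + unitVec j) (a, (0 : FieldSpace)) =
        ((Pi.single i a : Fin 3 → FieldSpace), 0) + ((Pi.single j a : Fin 3 → FieldSpace), 0) :=
        fun a => by
      rw [← hcontr, ← hcontr]
      refine Prod.ext ?_ (by simp)
      funext k
      simp [add_smul]
    have hi := hN (unitVec i) a b
    have hj := hN (unitVec j) a b
    rw [hcontr, hcontr] at hi hj
    simp only [he, map_add, LinearMap.add_apply] at h
    linarith
  have hsymm : ∀ i j a b, H (Pi.single i a, 0) (Pi.single j b, 0) =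
      H (Pi.single j b, 0) (Pi.single i a, 0) := fun i j a b => hH.1 _ _
  have hlt : ∀ i j a b, i < j → a < b →
      H (Pi.single i (basisField a), 0) (Pi.single j (basisField b), 0) = 0 := by
    intro i j a b hij hab
    by_cases hb : b < 7
    · exact congrFun h1 (⟨(i, j), hij⟩, ⟨(a, b), hab, by simp [hb, hab.trans hb]⟩)
    · by_cases ha : a < 7
      · exact hblock _ _ (isFirstBlock_single (vec_basisField ha) i)
          (isSecondBlock_single (ten_scal_basisField hb).1 (ten_scal_basisField hb).2 j)
      · exact congrFun h1 (⟨(i, j), hij⟩, ⟨(a, b), hab, by simp [hb, ha]⟩)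
  have hlt' : ∀ i j a b, i < j →
      H (Pi.single i (basisField a), 0) (Pi.single j (basisField b), 0) = 0 := by
    intro i j a b hij
    rcases lt_trichotomy a b with hab | rfl | hab
    · exact hlt i j a b hij hab
    · have := hskew i j (basisField a) (basisField a)
      rw [hsymm j i] at this
      linarith
    · rw [hskew, hsymm, hlt i j b a hij hab, neg_zero]
  have hall : ∀ i j a b,
      H (Pi.single i (basisField a), 0) (Pi.single j (basisField b), 0) = 0 := by
    intro i j a b
    rcases lt_trichotomy i j with hij | rfl | hij
    · exact hlt' i j a b hij
    · have := hskew i i (basisField a) (basisField b)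
      linarith
    · rw [hsymm]
      exact hlt' j i b a hij
  have hdd := bilin_derivative_eq_zero hall
  have hwd : ∀ w d, H (0, w) (d, 0) = 0 := fun w d => by
    have : (d, (0 : FieldSpace)) = ∑ i, (Pi.single i (d i), (0 : FieldSpace)) := by
      refine Prod.ext ?_ (by simp [Prod.snd_sum])
      rw [Prod.fst_sum]
      exact (Finset.univ_sum_single d).symm
    rw [this, map_sum]
    simp [hcross]
  refine LinearMap.ext₂ fun u u' => ?_
  have hu : ∀ u : (Fin 3 → FieldSpace) × FieldSpace, u = (u.1, 0) + (0, u.2) := fun u => by simp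
  rw [hu u, hu u']
  simp only [map_add, LinearMap.add_apply]
  rw [hdd, hwd, hH.1 (u.1, 0) (0, u'.2), hwd]
  have := hK u.2 u'.2
  rw [kineticForm_apply] at this
  rw [this]
  simp

theorem candidateCoord_injective {l c : ℝ} (hl : l ≠ 0) (hc : c ≠ 0) (hc' : 1 + c ≠ 0)
    (hg : GenericParameters l c) : Function.Injective (candidateCoord l c) := by
  intro X Y hXY
  have h := eq_zero_of_candidateCoord_eq_zero hl hc hc' hg (X + (-1 : ℝ) • Y) (by
    rw [map_add, map_smul, hXY]
    simp)
  apply Subtype.ext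
  refine LinearMap.ext₂ fun u u' => ?_
  have h' := LinearMap.congr_fun₂ h u u'
  simp only [Submodule.coe_add, Submodule.coe_smul, LinearMap.add_apply, LinearMap.smul_apply,
    LinearMap.zero_apply, smul_eq_mul] at h'
  linarith

theorem candidateCoord_skewForm (l c : ℝ) (S : SkewIdx → ℝ) :
    candidateCoord l c ⟨skewForm S, skewForm_mem l c S⟩ = (S, 0) := by
  refine Prod.ext ?_ ?_
  · funext x
    refine Eq.trans ?_ (skewCoeff_of_lt S x)
    simp only [candidateCoord, LinearMap.coe_mk, AddHom.coe_mk, skewForm_apply, Pi.single_apply]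
    rw [Finset.sum_eq_single x.1.1.1, Finset.sum_eq_single x.1.1.2,
      Finset.sum_eq_single x.2.1.1, Finset.sum_eq_single x.2.1.2]
    · simp [coord_basisField]
    all_goals simp +contextual [coord_basisField]
  · funext i
    fin_cases i <;>
      simp [candidateCoord, kineticForm_apply, crossForm_apply, skewForm_apply]

theorem candidateCoord_invariantEnergy (l c : ℝ) (r : Fin 4 → ℝ) :
    (candidateCoord l c ⟨invariantEnergy l c r, invariantEnergy_mem l c r⟩).2 =
      ![r 0, r 1, -12 * r 2, r 3] := by
  funext i
  fin_cases i
  · simp [candidateCoord, kineticForm_apply, invariantEnergy_apply, invariantForm_apply,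
      ten_scalField, scal_scalField, vec_scalField]
  · simp [candidateCoord, kineticForm_apply, invariantEnergy_apply, invariantForm_apply,
      ten_vecField, scal_vecField, vec_vecField]
  · simp [candidateCoord, kineticForm_apply, invariantEnergy_apply, invariantForm_apply,
      ten_scalField, scal_scalField, vec_scalField, ten_flatTen, scal_flatTen, vec_flatTen]
    ring
  · simp [candidateCoord, crossForm_apply, invariantEnergy_apply, invariantForm_apply,
      invariantCoupling_apply, ten_scalField, scal_scalField, vec_scalField, ten_vecField,
      scal_vecField, vec_vecField, Fin.sum_univ_three]

theorem candidateCoord_surjective (l c : ℝ) : Function.Surjective (candidateCoord l c) := by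
  rintro ⟨S, r⟩
  -- The invariant energy produces the four constants; the antisymmetric forms do not affect these
  -- and correct the remaining coordinates. The factor −1/12 inverts K(flat metric, scalar) = −4 · 3
  -- · r₂, where 3 is the trace of the flat metric.
  let E : blockCandidates (waveSystem l c) :=
    ⟨invariantEnergy l c ![r 0, r 1, -(1 / 12) * r 2, r 3], invariantEnergy_mem l c _⟩
  refine ⟨E + ⟨skewForm (S - (candidateCoord l c E).1), skewForm_mem l c _⟩, ?_⟩
  rw [map_add, candidateCoord_skewForm]
  refine Prod.ext (by simp) ?_
  simp only [Prod.snd_add, add_zero]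
  rw [candidateCoord_invariantEnergy]
  funext i
  fin_cases i <;> simp

theorem finrank_blockCandidates_waveSystem {l c : ℝ} (hl : l ≠ 0) (hc : c ≠ 0) (hc' : 1 + c ≠ 0)
    (hg : GenericParameters l c) :
    Module.finrank ℝ (blockCandidates (waveSystem l c)) = 76 := by
  rw [(LinearEquiv.ofBijective (candidateCoord l c) ⟨candidateCoord_injective hl hc hc' hg,
    candidateCoord_surjective l c⟩).finrank_eq, Module.finrank_prod, Module.finrank_fintype_fun_eq_card,
    Module.finrank_fintype_fun_eq_card, card_skewIdx, Fintype.card_fin]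

/-! ### The parameters of the family -/

/-- The member of the family with `λ₋² = l` and `C₅ = c`. -/
def familyParameters (l c : ℝ) : FormulationParameters where
  C₁ := (l - 1) / 2
  C₂ := (1 + c) * (1 + 3 * l) / 4 - 1
  C₃ := (1 + c) * l - (1 + c) * (1 + 3 * l) / 4
  C₄ := (l - 1) / 8
  C₅ := c
  C₆ := (c * (3 * l + 1) + 3 * (l - 1)) / 8
  C₇ := 0

/-- With C₇ = 0 one has λ₋² = 2C₁ + 1 and λ₊² = C₂ + C₃ + 1, so the defining conditions can be
solved for all parameters. -/
theorem FormulationParameters.InNonSymFamily.eq_familyParameters {C : FormulationParameters}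
    (h : C.InNonSymFamily) : C = familyParameters C.lamMinusSq C.C₅ := by
  have h₁ := h.lamV
  have h₂ := h.lamPlus
  have h₄ := h.c4
  have h₆ := h.c6
  have h₇ := h.c7
  have hm : C.lamMinusSq = 2 * C.C₁ + 1 := by
    simp only [FormulationParameters.lamMinusSq, h₇]
    ring
  have hp : C.lamPlusSq = C.C₂ + C.C₃ + 1 := by
    simp only [FormulationParameters.lamPlusSq, h₇]
    ring
  have hv : C.lamVSq = 1 + C.C₂ := rfl
  have e₁ : C.C₁ = (C.lamMinusSq - 1) / 2 := by linarith
  have e₂ : C.C₂ = (1 + C.C₅) * (1 + 3 * C.lamMinusSq) / 4 - 1 := by linarith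
  have e₃ : C.C₃ = (1 + C.C₅) * C.lamMinusSq - (1 + C.C₅) * (1 + 3 * C.lamMinusSq) / 4 := by
    linarith
  generalize C.lamMinusSq = l at *
  obtain ⟨C₁, C₂, C₃, C₄, C₅, C₆, C₇⟩ := C
  simp only [familyParameters, FormulationParameters.mk.injEq] at *
  exact ⟨e₁, e₂, e₃, h₄, trivial, h₆, h₇⟩

theorem familyParameters_lamMinusSq (l c : ℝ) : (familyParameters l c).lamMinusSq = l := by
  simp only [FormulationParameters.lamMinusSq, familyParameters]
  ring

theorem familyParameters_mem {l c : ℝ} (hl : 0 < l) (hc : -1 < c) (hc' : c ≠ 0) :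
    (familyParameters l c).InNonSymFamily := by
  have hm := familyParameters_lamMinusSq l c
  constructor <;> try rw [hm]
  · simp only [FormulationParameters.lamVSq, familyParameters]
    ring
  · simp only [FormulationParameters.lamPlusSq, familyParameters]
    ring
  · rfl
  · rfl
  · rfl
  · exact hl
  · exact hc
  · exact hc'

/-! ### The principal part in matrix notation -/

theorem fieldSpace_sum_coe {ι : Type*} (t : Finset ι) (f : ι → FieldSpace) (r : FieldIdx) :
    (∑ i ∈ t, f i).1 r = ∑ i ∈ t, (f i).1 r :=
  map_sum (LinearMap.proj r ∘ₗ FieldSpace.subtype : FieldSpace →ₗ[ℝ] ℝ) f t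

/-- The component `r` of the matrix `M` applied to `q`. -/
def matrixApply (M : Matrix FieldIdx FieldIdx ℝ) (q : FieldSpace) (r : FieldIdx) : ℝ :=
  (∑ m, ∑ n, M r (.inl (m, n)) * ten q m n) +
    (M r (.inr (.inl ())) * scal q + ∑ m, M r (.inr (.inr m)) * vec q m)

theorem A₂_coe (C : FormulationParameters) (b : Background) (q : FieldSpace) (r : FieldIdx) :
    ((grSystem C b).A₂ q).1 r = matrixApply (b.massInv C) q r :=
  fieldOperator_apply _ (b.massInv_symm C) q r

theorem A₁_coe (C : FormulationParameters) (b : Background) (s : Fin 3 → ℝ) (q : FieldSpace)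
    (r : FieldIdx) : (∑ j, s j • (grSystem C b).A₁ j q).1 r =
      ∑ j, s j * matrixApply (b.mixed C j) q r := by
  rw [fieldSpace_sum_coe]
  exact Finset.sum_congr rfl fun j _ =>
    congrArg (s j * ·) (fieldOperator_apply _ (b.mixed_symm C j) q r)

theorem B₂_coe (C : FormulationParameters) (b : Background) (s : Fin 3 → ℝ) (q : FieldSpace)
    (r : FieldIdx) : (∑ j, s j • (grSystem C b).B₂ j q).1 r =
      ∑ j, s j * matrixApply (b.mixed C j).transpose q r := by
  rw [fieldSpace_sum_coe]
  exact Finset.sum_congr rfl fun j _ =>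
    congrArg (s j * ·) (fieldOperator_apply _ (b.mixed_transpose_symm C j) q r)

theorem B₁_coe (C : FormulationParameters) (b : Background) (s : Fin 3 → ℝ) (q : FieldSpace)
    (r : FieldIdx) : (∑ i, ∑ j, (s i * s j) • (grSystem C b).B₁ i j q).1 r =
      ∑ i, ∑ j, s i * s j * matrixApply (b.potential i j) q r := by
  rw [fieldSpace_sum_coe]
  refine Finset.sum_congr rfl fun i _ => ?_
  rw [fieldSpace_sum_coe]
  exact Finset.sum_congr rfl fun j _ =>
    congrArg (s i * s j * ·) (fieldOperator_apply _ (b.potential_symm i j) q r)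

section matrixForm

variable (l c : ℝ) (b : Background) (s : Fin 3 → ℝ) (q : FieldSpace)

/-- Within the family the coefficients collapse: 1/2 + C₁ = l/2, 1/4 + 2C₄ = l/4, 1 + 2C₆ = 1 + C₂ =
(1 + c)(1 + 3l)/4 and (C₂ − C₃ + 1)/2 = (1 + c)(1 + l)/4. These values are used throughout this
group of formulas. -/
theorem ten_A₂ : ten ((grSystem (familyParameters l c) b).A₂ q) =
    (b.lapse / b.vol) • ((2 : ℝ) • (b.metric * ten q * b.metric) -
      ((b.metric * ten q).trace + l / 2 * b.lapse * scal q) • b.metric) := by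
  ext i j
  rw [← coe_inl, A₂_coe]
  simp only [matrixApply, Background.massInv, familyParameters, Matrix.smul_apply,
    Matrix.of_apply, smul_eq_mul,
    Fin.sum_univ_three, Matrix.sub_apply, Matrix.mul_apply, Matrix.trace, Matrix.diag_apply,
    ten_symm q 1 0, ten_symm q 2 0, ten_symm q 2 1, b.metric_symm 1 0, b.metric_symm 2 0,
    b.metric_symm 2 1]
  ring

theorem scal_A₂ : scal ((grSystem (familyParameters l c) b).A₂ q) =
    (b.lapse / b.vol) * (-(l / 2) * b.lapse * (b.metric * ten q).trace +
      l / 4 * b.lapse ^ 2 * scal q) := by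
  rw [← coe_scal _ (), A₂_coe]
  simp only [matrixApply, Background.massInv, familyParameters, Matrix.smul_apply,
    Matrix.of_apply, smul_eq_mul,
    Fin.sum_univ_three, Matrix.mul_apply, Matrix.trace, Matrix.diag_apply,
    ten_symm q 1 0, ten_symm q 2 0, ten_symm q 2 1, b.metric_symm 1 0, b.metric_symm 2 0,
    b.metric_symm 2 1]
  ring

theorem vec_A₂ : vec ((grSystem (familyParameters l c) b).A₂ q) =
    (-(b.lapse / b.vol) * ((1 + c) * (1 + 3 * l) / 4) * b.lapse ^ 2) • b.inv.mulVec (vec q) := by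
  ext i
  rw [← coe_vec, A₂_coe]
  simp only [matrixApply, Background.massInv, familyParameters, Matrix.smul_apply,
    Matrix.of_apply, smul_eq_mul,
    Fin.sum_univ_three, Pi.smul_apply, Matrix.mulVec, dotProduct]
  ring

theorem ten_A₁ : ten (∑ j, s j • (grSystem (familyParameters l c) b).A₁ j q) =
    (s ⬝ᵥ b.shift) • ten q + Matrix.vecMulVec s (b.metric.mulVec (vec q)) +
      Matrix.vecMulVec (b.metric.mulVec (vec q)) s := by
  ext i j
  rw [← coe_inl, A₁_coe]
  simp only [matrixApply, Background.mixed, Matrix.of_apply, smul_eq_mul,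
    Fin.sum_univ_three, Matrix.add_apply, Matrix.vecMulVec_apply, Matrix.mulVec, dotProduct,
    Matrix.smul_apply, kron]
  fin_cases i <;> fin_cases j <;>
    simp [ten_symm q 1 0, ten_symm q 2 0, ten_symm q 2 1] <;> ring

theorem scal_A₁ : scal (∑ j, s j • (grSystem (familyParameters l c) b).A₁ j q) =
    (s ⬝ᵥ b.shift) * scal q := by
  rw [← coe_scal _ (), A₁_coe]
  simp only [matrixApply, Background.mixed, Matrix.of_apply, familyParameters,
    Fin.sum_univ_three, dotProduct]
  ring

theorem vec_A₁ : vec (∑ j, s j • (grSystem (familyParameters l c) b).A₁ j q) =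
    (s ⬝ᵥ b.shift) • vec q + (b.lapse ^ 2 * ((1 + c) * (1 + 3 * l) / 4)) •
      (b.inv * ten q * b.inv).mulVec s - (b.lapse ^ 2 * ((1 + c) * (1 + l) / 4) *
      (b.inv * ten q).trace + (1 + c) * b.lapse * scal q) • b.inv.mulVec s := by
  ext i
  rw [← coe_vec, A₁_coe]
  simp only [matrixApply, Background.mixed, Matrix.of_apply, familyParameters,
    Fin.sum_univ_three, dotProduct, Pi.add_apply, Pi.sub_apply, Pi.smul_apply, smul_eq_mul,
    Matrix.mulVec, Matrix.mul_apply, Matrix.trace, Matrix.diag_apply, Background.inv2, kron]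
  fin_cases i <;>
    simp [ten_symm q 1 0, ten_symm q 2 0, ten_symm q 2 1, b.inv_symm 1 0, b.inv_symm 2 0,
      b.inv_symm 2 1] <;> ring

theorem ten_B₂ : ten (∑ j, s j • (grSystem (familyParameters l c) b).B₂ j q) =
    (s ⬝ᵥ b.shift) • ten q + (b.lapse ^ 2 * ((1 + c) * (1 + 3 * l) / 8)) •
      (Matrix.vecMulVec (b.inv.mulVec s) (b.inv.mulVec (vec q)) +
        Matrix.vecMulVec (b.inv.mulVec (vec q)) (b.inv.mulVec s)) -
      (b.lapse ^ 2 * ((1 + c) * (1 + l) / 4) * (s ⬝ᵥ b.inv.mulVec (vec q))) • b.inv := by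
  ext i j
  rw [← coe_inl, B₂_coe]
  simp only [matrixApply, Background.mixed, Matrix.of_apply, smul_eq_mul,
    Matrix.transpose_apply, familyParameters, Matrix.sub_apply,
    Fin.sum_univ_three, Matrix.add_apply, Matrix.vecMulVec_apply, Matrix.mulVec, dotProduct,
    Matrix.smul_apply, kron, Background.inv2]
  fin_cases i <;> fin_cases j <;>
    simp [ten_symm q 1 0, ten_symm q 2 0, ten_symm q 2 1, b.inv_symm 1 0, b.inv_symm 2 0,
      b.inv_symm 2 1] <;> ring

theorem scal_B₂ : scal (∑ j, s j • (grSystem (familyParameters l c) b).B₂ j q) =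
    (s ⬝ᵥ b.shift) * scal q - (1 + c) * b.lapse * (s ⬝ᵥ b.inv.mulVec (vec q)) := by
  rw [← coe_scal _ (), B₂_coe]
  simp only [matrixApply, Background.mixed, Matrix.of_apply, Matrix.transpose_apply,
    familyParameters, Fin.sum_univ_three, dotProduct, Matrix.mulVec]
  ring

theorem vec_B₂ : vec (∑ j, s j • (grSystem (familyParameters l c) b).B₂ j q) =
    (s ⬝ᵥ b.shift) • vec q + (2 : ℝ) • (b.metric * ten q).mulVec s := by
  ext i
  rw [← coe_vec, B₂_coe]
  simp only [matrixApply, Background.mixed, Matrix.of_apply, Matrix.transpose_apply,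
    familyParameters, Fin.sum_univ_three, dotProduct, Pi.add_apply, Pi.smul_apply, smul_eq_mul,
    Matrix.mulVec, Matrix.mul_apply, kron]
  fin_cases i <;>
    simp [ten_symm q 1 0, ten_symm q 2 0, ten_symm q 2 1, b.metric_symm 1 0, b.metric_symm 2 0,
      b.metric_symm 2 1] <;> ring

theorem ten_B₁ : ten (∑ i, ∑ j, (s i * s j) • (grSystem (familyParameters l c) b).B₁ i j q) =
    b.vol • ((-b.lapse / 2) • (((s ⬝ᵥ b.inv.mulVec s) * (b.inv * ten q).trace -
        s ⬝ᵥ (b.inv * ten q * b.inv).mulVec s) • b.inv +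
        Matrix.vecMulVec (b.inv.mulVec s) ((b.inv * ten q * b.inv).mulVec s) +
        Matrix.vecMulVec ((b.inv * ten q * b.inv).mulVec s) (b.inv.mulVec s) -
        (s ⬝ᵥ b.inv.mulVec s) • (b.inv * ten q * b.inv) -
        (b.inv * ten q).trace • Matrix.vecMulVec (b.inv.mulVec s) (b.inv.mulVec s)) +
      scal q • (Matrix.vecMulVec (b.inv.mulVec s) (b.inv.mulVec s) -
        (s ⬝ᵥ b.inv.mulVec s) • b.inv)) := by
  ext k m
  rw [← coe_inl, B₁_coe]
  simp only [matrixApply, Background.potential, Matrix.of_apply, smul_eq_mul,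
    Matrix.sub_apply, Fin.sum_univ_three, Matrix.add_apply, Matrix.vecMulVec_apply, Matrix.mulVec,
    dotProduct, Matrix.smul_apply, Background.inv2, Background.inv3, Matrix.mul_apply, Matrix.trace,
    Matrix.diag_apply, ten_symm q 1 0, ten_symm q 2 0, ten_symm q 2 1, b.inv_symm 1 0,
    b.inv_symm 2 0, b.inv_symm 2 1, b.inv_symm 0 k, b.inv_symm 1 k, b.inv_symm 2 k, b.inv_symm 0 m,
    b.inv_symm 1 m, b.inv_symm 2 m]
  ring

theorem scal_B₁ : scal (∑ i, ∑ j, (s i * s j) • (grSystem (familyParameters l c) b).B₁ i j q) =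
    b.vol * (s ⬝ᵥ (b.inv * ten q * b.inv).mulVec s -
      (s ⬝ᵥ b.inv.mulVec s) * (b.inv * ten q).trace) := by
  rw [← coe_scal _ (), B₁_coe]
  simp only [matrixApply, Background.potential, Matrix.of_apply, smul_eq_mul,
    Fin.sum_univ_three, Matrix.mulVec, dotProduct, Matrix.smul_apply, Background.inv2,
    Matrix.mul_apply, Matrix.trace, Matrix.diag_apply, ten_symm q 1 0, ten_symm q 2 0,
    ten_symm q 2 1, b.inv_symm 1 0, b.inv_symm 2 0, b.inv_symm 2 1]
  ring

theorem vec_B₁ :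
    vec (∑ i, ∑ j, (s i * s j) • (grSystem (familyParameters l c) b).B₁ i j q) = 0 := by
  ext k
  rw [← coe_vec, B₁_coe]
  simp [matrixApply, Background.potential]

end matrixForm

/-! ### Change of frame -/

theorem ten_mkField_eq (x : Matrix (Fin 3) (Fin 3) ℝ × ℝ × (Fin 3 → ℝ)) :
    ten (mkField x) = (1 / 2 : ℝ) • (x.1 + x.1.transpose) := by
  ext k l
  simp only [ten_mkField, Matrix.smul_apply, Matrix.add_apply, Matrix.transpose_apply, smul_eq_mul]
  ring

/-- The change of frame that acts by `M` on both indices of the tensor and by `N` on the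
vector, with additional weights for the scalar and the vector. -/
def frameMap (M N : Matrix (Fin 3) (Fin 3) ℝ) (k m : ℝ) : FieldSpace →ₗ[ℝ] FieldSpace where
  toFun q := mkField (M * ten q * M.transpose, k * scal q, m • N.mulVec (vec q))
  map_add' q r := by
    rw [← map_add]
    congr 1
    refine Prod.ext ?_ (Prod.ext ?_ ?_)
    · simp [mul_add, add_mul]
    · simp [mul_add]
    · simp [Matrix.mulVec_add]
  map_smul' t q := by
    refine Eq.trans ?_ (map_smul mkField t _)
    congr 1
    refine Prod.ext ?_ (Prod.ext ?_ ?_)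
    · simp
    · simp [mul_left_comm]
    · simp [Matrix.mulVec_smul, smul_comm m t]

section frameMap

variable (M N : Matrix (Fin 3) (Fin 3) ℝ) (k m : ℝ) (q : FieldSpace)

theorem ten_frameMap : ten (frameMap M N k m q) = M * ten q * M.transpose := by
  refine (ten_mkField_eq _).trans ?_
  simp only [Matrix.transpose_mul, Matrix.transpose_transpose, ten_transpose, Matrix.mul_assoc]
  module

theorem scal_frameMap : scal (frameMap M N k m q) = k * scal q := rfl

theorem vec_frameMap : vec (frameMap M N k m q) = m • N.mulVec (vec q) := rfl

theorem frameMap_frameMap (M' N' : Matrix (Fin 3) (Fin 3) ℝ) (k' m' : ℝ) :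
    frameMap M N k m (frameMap M' N' k' m' q) =
      frameMap (M * M') (N * N') (k * k') (m * m') q := by
  refine field_ext ?_ ?_ ?_
  · simp only [ten_frameMap, Matrix.transpose_mul, Matrix.mul_assoc]
  · simp only [scal_frameMap, mul_assoc]
  · simp only [vec_frameMap, Matrix.mulVec_smul, Matrix.mulVec_mulVec, smul_smul]

theorem frameMap_one : frameMap 1 1 1 1 q = q := by
  refine field_ext ?_ ?_ ?_
  · simp [ten_frameMap]
  · simp [scal_frameMap]
  · simp [vec_frameMap]

end frameMap

/-! ### The operators in a flat background and their wave equation -/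

/-- The coupling of positions to derivatives of positions, in a flat background without shift. -/
def flatMixed (l c : ℝ) (s : Fin 3 → ℝ) : FieldSpace →ₗ[ℝ] FieldSpace where
  toFun q := mkField (Matrix.vecMulVec s (vec q) + Matrix.vecMulVec (vec q) s, 0,
    ((1 + c) * (1 + 3 * l) / 4) • (ten q).mulVec s -
      ((1 + c) * (1 + l) / 4 * (ten q).trace + (1 + c) * scal q) • s)
  map_add' q r := by
    rw [← map_add]
    congr 1
    refine Prod.ext ?_ (Prod.ext ?_ ?_)
    · ext i j
      simp [Matrix.vecMulVec_apply]
      ring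
    · simp
    · ext i; simp [Matrix.add_mulVec]; ring
  map_smul' t q := by
    refine Eq.trans ?_ (map_smul mkField t _)
    congr 1
    refine Prod.ext ?_ (Prod.ext ?_ ?_)
    · ext i j
      simp [Matrix.vecMulVec_apply]
    · simp
    · ext i; simp [Matrix.smul_mulVec]; ring

/-- The transpose of `flatMixed`. -/
def flatMixedTranspose (l c : ℝ) (s : Fin 3 → ℝ) (q : FieldSpace) : FieldSpace :=
  mkField (((1 + c) * (1 + 3 * l) / 8) • (Matrix.vecMulVec s (vec q) + Matrix.vecMulVec (vec q) s) -
    ((1 + c) * (1 + l) / 4 * (s ⬝ᵥ vec q)) • (1 : Matrix (Fin 3) (Fin 3) ℝ),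
    -(1 + c) * (s ⬝ᵥ vec q), (2 : ℝ) • (ten q).mulVec s)

/-- The inverse mass matrix in a flat background. -/
def flatMass (l c : ℝ) : FieldSpace →ₗ[ℝ] FieldSpace where
  toFun q := mkField ((2 : ℝ) • ten q - ((ten q).trace + l / 2 * scal q) • 1,
    -(l / 2) * (ten q).trace + l / 4 * scal q, (-((1 + c) * (1 + 3 * l) / 4)) • vec q)
  map_add' q r := by
    rw [← map_add]
    congr 1
    refine Prod.ext ?_ (Prod.ext ?_ ?_)
    · ext i j
      simp
      ring
    · simp; ring
    · ext i; simp; ring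
  map_smul' t q := by
    refine Eq.trans ?_ (map_smul mkField t _)
    congr 1
    refine Prod.ext ?_ (Prod.ext ?_ ?_)
    · ext i j
      simp
      ring
    · simp; ring
    · ext i; simp; ring

/-- The potential in a flat background. -/
def flatPotential (s : Fin 3 → ℝ) (q : FieldSpace) : FieldSpace :=
  mkField ((-1 / 2 : ℝ) • (((s ⬝ᵥ s) * (ten q).trace - s ⬝ᵥ (ten q).mulVec s) •
      (1 : Matrix (Fin 3) (Fin 3) ℝ) + Matrix.vecMulVec s ((ten q).mulVec s) +
      Matrix.vecMulVec ((ten q).mulVec s) s - (s ⬝ᵥ s) • ten q -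
      (ten q).trace • Matrix.vecMulVec s s) +
      scal q • (Matrix.vecMulVec s s - (s ⬝ᵥ s) • (1 : Matrix (Fin 3) (Fin 3) ℝ)),
    s ⬝ᵥ (ten q).mulVec s - (s ⬝ᵥ s) * (ten q).trace, 0)

section flat

variable (l c : ℝ) (s : Fin 3 → ℝ) (q : FieldSpace) (i j : Fin 3)

theorem ten_flatMixed : ten (flatMixed l c s q) =
    Matrix.vecMulVec s (vec q) + Matrix.vecMulVec (vec q) s := by
  refine (ten_mkField_eq _).trans ?_
  simp only [Matrix.transpose_add, Matrix.transpose_vecMulVec]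
  module

theorem scal_flatMixed : scal (flatMixed l c s q) = 0 := rfl

theorem vec_flatMixed : vec (flatMixed l c s q) = ((1 + c) * (1 + 3 * l) / 4) • (ten q).mulVec s -
    ((1 + c) * (1 + l) / 4 * (ten q).trace + (1 + c) * scal q) • s := rfl

theorem ten_flatMixedTranspose : ten (flatMixedTranspose l c s q) =
    ((1 + c) * (1 + 3 * l) / 8) • (Matrix.vecMulVec s (vec q) + Matrix.vecMulVec (vec q) s) -
      ((1 + c) * (1 + l) / 4 * (s ⬝ᵥ vec q)) • (1 : Matrix (Fin 3) (Fin 3) ℝ) := by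
  refine (ten_mkField_eq _).trans ?_
  simp only [Matrix.transpose_add, Matrix.transpose_sub, Matrix.transpose_smul,
    Matrix.transpose_vecMulVec, Matrix.transpose_one]
  module

theorem scal_flatMixedTranspose :
    scal (flatMixedTranspose l c s q) = -(1 + c) * (s ⬝ᵥ vec q) := rfl

theorem vec_flatMixedTranspose :
    vec (flatMixedTranspose l c s q) = (2 : ℝ) • (ten q).mulVec s := rfl

theorem ten_flatMass : ten (flatMass l c q) =
    (2 : ℝ) • ten q - ((ten q).trace + l / 2 * scal q) • (1 : Matrix (Fin 3) (Fin 3) ℝ) := by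
  refine (ten_mkField_eq _).trans ?_
  simp only [Matrix.transpose_sub, Matrix.transpose_smul, ten_transpose, Matrix.transpose_one]
  module

theorem scal_flatMass :
    scal (flatMass l c q) = -(l / 2) * (ten q).trace + l / 4 * scal q := rfl

theorem vec_flatMass :
    vec (flatMass l c q) = (-((1 + c) * (1 + 3 * l) / 4)) • vec q := rfl

theorem ten_flatPotential : ten (flatPotential s q) =
    (-1 / 2 : ℝ) • (((s ⬝ᵥ s) * (ten q).trace - s ⬝ᵥ (ten q).mulVec s) •
      (1 : Matrix (Fin 3) (Fin 3) ℝ) + Matrix.vecMulVec s ((ten q).mulVec s) +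
      Matrix.vecMulVec ((ten q).mulVec s) s - (s ⬝ᵥ s) • ten q -
      (ten q).trace • Matrix.vecMulVec s s) +
      scal q • (Matrix.vecMulVec s s - (s ⬝ᵥ s) • (1 : Matrix (Fin 3) (Fin 3) ℝ)) := by
  refine (ten_mkField_eq _).trans ?_
  simp only [Matrix.transpose_add, Matrix.transpose_sub, Matrix.transpose_smul,
    Matrix.transpose_vecMulVec, Matrix.transpose_one, ten_transpose]
  module

theorem scal_flatPotential : scal (flatPotential s q) =
    s ⬝ᵥ (ten q).mulVec s - (s ⬝ᵥ s) * (ten q).trace := rfl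

theorem vec_flatPotential : vec (flatPotential s q) = 0 := rfl

/-- Time derivatives of first order drop out of the second order equations. -/
theorem flatMass_flatMixedTranspose :
    flatMass l c (flatMixedTranspose l c s q) + flatMixed l c s (flatMass l c q) = 0 := by
  refine field_ext ?_ ?_ ?_
  · ext i j
    simp [ten_flatMass, ten_flatMixedTranspose, ten_flatMixed, scal_flatMixedTranspose,
      vec_flatMass, Matrix.vecMulVec_apply, Matrix.trace, Fin.sum_univ_three, dotProduct]
    ring
  · simp [scal_flatMass, scal_flatMixed, scal_flatMixedTranspose, ten_flatMixedTranspose,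
      Matrix.vecMulVec_apply, Matrix.trace, Fin.sum_univ_three, dotProduct]
    ring
  · ext i
    simp [vec_flatMass, vec_flatMixed, vec_flatMixedTranspose, ten_flatMass, scal_flatMass,
      Matrix.sub_mulVec, Matrix.smul_mulVec]
    ring

/-- The second order equations are decoupled wave equations. -/
theorem flatMixed_flatMixed_add :
    flatMixed l c s (flatMixed l c s q) + flatMass l c (flatPotential s q) = waveOp l c s q := by
  refine field_ext ?_ ?_ ?_
  · ext i j
    rw [ten_waveOp]
    simp [ten_flatMass, ten_flatPotential, ten_flatMixed, scal_flatPotential,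
      vec_flatMixed, Matrix.vecMulVec_apply, Matrix.trace, Fin.sum_univ_three, dotProduct,
      Matrix.mulVec, ten_symm q 1 0, ten_symm q 2 0, ten_symm q 2 1]
    ring
  · rw [scal_waveOp]
    simp [scal_flatMass, scal_flatMixed, scal_flatPotential, ten_flatPotential,
      Matrix.vecMulVec_apply, Matrix.trace, Fin.sum_univ_three, dotProduct, Matrix.mulVec]
    ring
  · ext i
    rw [vec_waveOp]
    simp [vec_flatMass, vec_flatMixed, vec_flatPotential, ten_flatMixed, scal_flatMixed,
      Matrix.vecMulVec_apply, Matrix.trace, Fin.sum_univ_three, dotProduct, Matrix.mulVec]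
    ring

/-- On the kernel the scalar equation makes the scalar twice the trace; the trace of the tensor
equation then reads −(1 + 3l) times the trace equals zero. -/
theorem flatMass_injective {l c : ℝ} (hl : 0 < l) (hc : 1 + c ≠ 0) :
    Function.Injective (flatMass l c) := by
  rw [injective_iff_map_eq_zero]
  intro q hq
  have h₁ := congrArg ten hq
  have h₂ := congrArg scal hq
  have h₃ := congrArg vec hq
  rw [ten_flatMass, map_zero] at h₁
  rw [scal_flatMass, map_zero] at h₂
  rw [vec_flatMass, map_zero] at h₃
  have h2 : scal q = 2 * (ten q).trace := by
    apply mul_left_cancel₀ hl.ne'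
    linear_combination 4 * h₂
  have htr : (ten q).trace = 0 := by
    have := congrArg Matrix.trace h₁
    simp only [Matrix.trace_sub, Matrix.trace_smul, Matrix.trace_one, Matrix.trace_zero,
      smul_eq_mul, Fintype.card_fin, h2] at this
    push_cast at this
    apply mul_left_cancel₀ (show 1 + 3 * l ≠ 0 by positivity)
    linear_combination -this
  have h0 : scal q = 0 := by rw [h2, htr, mul_zero]
  refine field_ext ?_ ?_ ?_
  · rw [htr, h0] at h₁
    simpa using h₁
  · rw [h0, map_zero]
  · have hv : -((1 + c) * (1 + 3 * l) / 4) ≠ 0 := by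
      have : 1 + 3 * l ≠ 0 := by positivity
      simp [hc, this]
    simpa using (smul_eq_zero.1 h₃).resolve_left hv

end flat

/-! ### Reduction of a general background to the flat one -/

/-- A background with a linear frame that is orthonormal for its metric; `F` is the inverse
of `G`. -/
structure FramedBackground extends Background where
  G : Matrix (Fin 3) (Fin 3) ℝ
  F : Matrix (Fin 3) (Fin 3) ℝ
  metric_eq : metric = G.transpose * G
  F_mul_G : F * G = 1

namespace FramedBackground

variable (b : FramedBackground)

theorem G_mul_F : b.G * b.F = 1 := mul_eq_one_comm.1 b.F_mul_G

theorem GT_mul_FT : b.G.transpose * b.F.transpose = 1 := by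
  rw [← Matrix.transpose_mul, b.F_mul_G, Matrix.transpose_one]

theorem FT_mul_GT : b.F.transpose * b.G.transpose = 1 := by
  rw [← Matrix.transpose_mul, b.G_mul_F, Matrix.transpose_one]

theorem inv_eq : b.inv = b.F * b.F.transpose := by
  refine Matrix.inv_eq_left_inv ?_
  rw [b.metric_eq, Matrix.mul_assoc, ← Matrix.mul_assoc b.F.transpose, b.FT_mul_GT, Matrix.one_mul,
    b.F_mul_G]

theorem vol_pos : 0 < b.vol := Real.sqrt_pos.2 b.metric_posDef.det_pos

theorem metric_mul (A : Matrix (Fin 3) (Fin 3) ℝ) :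
    b.metric * (b.F * A * b.F.transpose) = b.G.transpose * A * b.F.transpose := by
  rw [b.metric_eq, Matrix.mul_assoc, ← Matrix.mul_assoc b.G, ← Matrix.mul_assoc b.G, b.G_mul_F,
    Matrix.one_mul, Matrix.mul_assoc]

theorem metric_mul_mul (A : Matrix (Fin 3) (Fin 3) ℝ) :
    b.metric * (b.F * A * b.F.transpose) * b.metric = b.G.transpose * A * b.G := by
  rw [metric_mul, b.metric_eq, Matrix.mul_assoc, ← Matrix.mul_assoc b.F.transpose, b.FT_mul_GT,
    Matrix.one_mul]

theorem trace_metric_mul (A : Matrix (Fin 3) (Fin 3) ℝ) :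
    (b.metric * (b.F * A * b.F.transpose)).trace = A.trace := by
  rw [metric_mul, Matrix.trace_mul_comm, ← Matrix.mul_assoc, b.FT_mul_GT, Matrix.one_mul]

theorem inv_mul (A : Matrix (Fin 3) (Fin 3) ℝ) :
    b.inv * (b.G.transpose * A * b.G) = b.F * A * b.G := by
  rw [b.inv_eq, Matrix.mul_assoc, ← Matrix.mul_assoc b.F.transpose,
    ← Matrix.mul_assoc b.F.transpose,
    b.FT_mul_GT, Matrix.one_mul, Matrix.mul_assoc]

theorem trace_inv_mul (A : Matrix (Fin 3) (Fin 3) ℝ) :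
    (b.inv * (b.G.transpose * A * b.G)).trace = A.trace := by
  rw [inv_mul, Matrix.trace_mul_comm, ← Matrix.mul_assoc, b.G_mul_F, Matrix.one_mul]

theorem inv_mul_mul (A : Matrix (Fin 3) (Fin 3) ℝ) :
    b.inv * (b.G.transpose * A * b.G) * b.inv = b.F * A * b.F.transpose := by
  rw [inv_mul, b.inv_eq, Matrix.mul_assoc, ← Matrix.mul_assoc b.G, b.G_mul_F,
    Matrix.one_mul]

theorem metric_mulVec (v : Fin 3 → ℝ) :
    b.metric.mulVec (b.F.mulVec v) = b.G.transpose.mulVec v := by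
  rw [b.metric_eq, Matrix.mulVec_mulVec, Matrix.mul_assoc, b.G_mul_F, Matrix.mul_one]

theorem inv_mulVec (v : Fin 3 → ℝ) :
    b.inv.mulVec (b.G.transpose.mulVec v) = b.F.mulVec v := by
  rw [b.inv_eq, Matrix.mulVec_mulVec, Matrix.mul_assoc, b.FT_mul_GT, Matrix.mul_one]

theorem FT_mulVec (v : Fin 3 → ℝ) :
    b.F.transpose.mulVec (b.G.transpose.mulVec v) = v := by
  rw [Matrix.mulVec_mulVec, b.FT_mul_GT, Matrix.one_mulVec]

theorem GT_dotProduct (v w : Fin 3 → ℝ) :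
    b.G.transpose.mulVec v ⬝ᵥ b.F.mulVec w = v ⬝ᵥ w := by
  rw [Matrix.dotProduct_mulVec, ← Matrix.mulVec_transpose, b.FT_mulVec]

theorem mul_mulVec (A : Matrix (Fin 3) (Fin 3) ℝ) (v : Fin 3 → ℝ) :
    (b.F * A * b.F.transpose).mulVec (b.G.transpose.mulVec v) = b.F.mulVec (A.mulVec v) := by
  rw [← Matrix.mulVec_mulVec, b.FT_mulVec, Matrix.mulVec_mulVec]

/-- The field values with given components in the orthonormal frame. -/
def position : FieldSpace →ₗ[ℝ] FieldSpace := frameMap b.G.transpose b.F b.lapse b.lapse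

/-- The components of field values in the orthonormal frame. -/
def positionInv : FieldSpace →ₗ[ℝ] FieldSpace := frameMap b.F.transpose b.G b.lapse⁻¹ b.lapse⁻¹

/-- The momenta with given components in the orthonormal frame. -/
def momentum : FieldSpace →ₗ[ℝ] FieldSpace := frameMap b.F b.G.transpose b.lapse⁻¹ b.lapse⁻¹

/-- The components of momenta in the orthonormal frame. -/
def momentumInv : FieldSpace →ₗ[ℝ] FieldSpace := frameMap b.G b.F.transpose b.lapse b.lapse

theorem position_positionInv (q : FieldSpace) : b.position (b.positionInv q) = q := by
  rw [position, positionInv, frameMap_frameMap, b.GT_mul_FT, b.F_mul_G,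
    mul_inv_cancel₀ b.lapse_pos.ne', frameMap_one]

theorem positionInv_position (q : FieldSpace) : b.positionInv (b.position q) = q := by
  rw [position, positionInv, frameMap_frameMap, b.FT_mul_GT, b.G_mul_F,
    inv_mul_cancel₀ b.lapse_pos.ne', frameMap_one]

theorem momentum_momentumInv (q : FieldSpace) : b.momentum (b.momentumInv q) = q := by
  rw [momentum, momentumInv, frameMap_frameMap, b.F_mul_G, b.GT_mul_FT,
    inv_mul_cancel₀ b.lapse_pos.ne', frameMap_one]

theorem vecMulVec_mulVec (M : Matrix (Fin 3) (Fin 3) ℝ) (v w : Fin 3 → ℝ) :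
    Matrix.vecMulVec (M.mulVec v) (M.mulVec w) = M * Matrix.vecMulVec v w * M.transpose := by
  rw [Matrix.mul_vecMulVec, Matrix.vecMulVec_mul, Matrix.vecMul_transpose]

variable (l c : ℝ) (s : Fin 3 → ℝ) (q : FieldSpace)

/-- Momenta transform contragrediently to positions. Scaling scalar and vector by α, and their
momenta by 1/α, makes all lapse and volume factors of an operator common to its blocks; the same
holds for the following three operators. -/
theorem A₂_momentum : (grSystem (familyParameters l c) b.toBackground).A₂ (b.momentum q) =
    (b.lapse / b.vol) • b.position (flatMass l c q) := by
  have hα := b.lapse_pos.ne'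
  refine field_ext ?_ ?_ ?_
  · rw [ten_A₂, map_smul, momentum, position, ten_frameMap, ten_frameMap, scal_frameMap,
      ten_flatMass, b.metric_mul_mul, b.trace_metric_mul, Matrix.transpose_transpose]
    simp only [mul_sub, sub_mul, Matrix.mul_smul, Matrix.smul_mul, Matrix.mul_one, ← b.metric_eq]
    congr 3
    field_simp
  · rw [scal_A₂, map_smul, momentum, position, ten_frameMap, scal_frameMap, scal_frameMap,
      scal_flatMass, b.trace_metric_mul, smul_eq_mul]
    field_simp
  · rw [vec_A₂, map_smul, momentum, position, vec_frameMap, vec_frameMap, vec_flatMass,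
      Matrix.mulVec_smul, Matrix.mulVec_smul, b.inv_mulVec]
    simp only [smul_smul]
    congr 1
    field_simp

theorem A₁_position : ∑ j, b.G.transpose.mulVec s j •
    (grSystem (familyParameters l c) b.toBackground).A₁ j (b.position q) =
    (b.G.transpose.mulVec s ⬝ᵥ b.shift) • b.position q +
      b.lapse • b.position (flatMixed l c s q) := by
  refine field_ext ?_ ?_ ?_
  · rw [ten_A₁, map_add, map_smul, map_smul, position, ten_frameMap, ten_frameMap, vec_frameMap,
      ten_flatMixed, Matrix.mulVec_smul, b.metric_mulVec]
    simp only [mul_add, add_mul, Matrix.vecMulVec_smul, Matrix.smul_vecMulVec, vecMulVec_mulVec]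
    module
  · rw [scal_A₁, map_add, map_smul, map_smul, position, scal_frameMap, scal_frameMap,
      scal_flatMixed]
    simp
  · rw [vec_A₁, map_add, map_smul, map_smul, position, vec_frameMap, vec_frameMap, ten_frameMap,
      scal_frameMap, vec_flatMixed, Matrix.transpose_transpose, b.inv_mul_mul, b.trace_inv_mul,
      b.mul_mulVec, b.inv_mulVec]
    simp only [Matrix.mulVec_sub, Matrix.mulVec_smul]
    module

theorem B₂_momentum : ∑ j, b.G.transpose.mulVec s j •
    (grSystem (familyParameters l c) b.toBackground).B₂ j (b.momentum q) =
    (b.G.transpose.mulVec s ⬝ᵥ b.shift) • b.momentum q +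
      b.lapse • b.momentum (flatMixedTranspose l c s q) := by
  have hα := b.lapse_pos.ne'
  refine field_ext ?_ ?_ ?_
  · rw [ten_B₂, map_add, map_smul, map_smul, momentum, ten_frameMap, ten_frameMap, vec_frameMap,
      ten_flatMixedTranspose, Matrix.mulVec_smul, b.inv_mulVec, b.inv_mulVec, dotProduct_smul,
      b.GT_dotProduct]
    simp only [Matrix.mul_add, Matrix.add_mul, Matrix.mul_sub,
      Matrix.sub_mul, Matrix.mul_smul, Matrix.smul_mul,
      Matrix.vecMulVec_smul, Matrix.smul_vecMulVec, vecMulVec_mulVec, Matrix.mul_one, ← b.inv_eq,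
      smul_smul, smul_eq_mul, smul_add, smul_sub]
    rw [show b.lapse ^ 2 * ((1 + c) * (1 + 3 * l) / 8) * b.lapse⁻¹ =
      b.lapse * ((1 + c) * (1 + 3 * l) / 8) by field_simp,
      show b.lapse ^ 2 * ((1 + c) * (1 + l) / 4) * (b.lapse⁻¹ * s ⬝ᵥ vec q) =
      b.lapse * ((1 + c) * (1 + l) / 4 * s ⬝ᵥ vec q) by field_simp]
    module
  · rw [scal_B₂, map_add, map_smul, map_smul, momentum, scal_frameMap, scal_frameMap, vec_frameMap,
      scal_flatMixedTranspose, Matrix.mulVec_smul, b.inv_mulVec, dotProduct_smul, b.GT_dotProduct]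
    simp only [smul_eq_mul]
    field_simp
    ring
  · rw [vec_B₂, map_add, map_smul, map_smul, momentum, vec_frameMap, vec_frameMap, ten_frameMap,
      vec_flatMixedTranspose, ← Matrix.mulVec_mulVec, b.mul_mulVec, b.metric_mulVec,
      Matrix.mulVec_smul, smul_smul b.lapse, mul_inv_cancel₀ hα, one_smul]

theorem B₁_position : ∑ i, ∑ j, (b.G.transpose.mulVec s i * b.G.transpose.mulVec s j) •
    (grSystem (familyParameters l c) b.toBackground).B₁ i j (b.position q) =
    (b.vol * b.lapse) • b.momentum (flatPotential s q) := by
  refine field_ext ?_ ?_ ?_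
  · rw [ten_B₁, map_smul, momentum, position, ten_frameMap, ten_frameMap, scal_frameMap,
      ten_flatPotential, Matrix.transpose_transpose, b.inv_mul_mul, b.trace_inv_mul, b.mul_mulVec,
      b.inv_mulVec, b.GT_dotProduct, b.GT_dotProduct]
    simp only [Matrix.mul_add, Matrix.add_mul, Matrix.mul_sub,
      Matrix.sub_mul, Matrix.mul_smul, Matrix.smul_mul,
      vecMulVec_mulVec, Matrix.mul_one, ← b.inv_eq]
    module
  · rw [scal_B₁, map_smul, momentum, position, scal_frameMap, ten_frameMap, scal_flatPotential,
      Matrix.transpose_transpose, b.inv_mul_mul, b.trace_inv_mul, b.mul_mulVec, b.inv_mulVec,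
      b.GT_dotProduct, b.GT_dotProduct]
    have hα := b.lapse_pos.ne'
    simp only [smul_eq_mul]
    field_simp
  · rw [vec_B₁, map_smul, momentum, vec_frameMap, vec_flatPotential]
    simp

end FramedBackground

/-! ### Equivalence with the system of wave equations -/

theorem exists_framedBackground (b : Background) :
    ∃ b' : FramedBackground, b'.toBackground = b := by
  obtain ⟨G, hG⟩ : ∃ G : Matrix (Fin 3) (Fin 3) ℝ, b.metric = G.transpose * G := by
    open scoped MatrixOrder ComplexOrder in
    obtain ⟨G, hG⟩ := CStarAlgebra.nonneg_iff_eq_star_mul_self.1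
      (Matrix.nonneg_iff_posSemidef.2 b.metric_posDef.posSemidef)
    refine ⟨G, hG.trans ?_⟩
    rw [Matrix.star_eq_conjTranspose, Matrix.conjTranspose_eq_transpose_of_trivial]
  have hdet : IsUnit G.det := by
    have h := b.metric_posDef.det_pos.ne'
    rw [hG, Matrix.det_mul] at h
    exact isUnit_iff_ne_zero.2 (right_ne_zero_of_mul h)
  exact ⟨{ b with G := G, F := G⁻¹, metric_eq := hG, F_mul_G := G.nonsing_inv_mul hdet }, rfl⟩

namespace FramedBackground

variable (b : FramedBackground) (l c : ℝ)

theorem A₂_injective {l c : ℝ} (hl : 0 < l) (hc : 1 + c ≠ 0) :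
    Function.Injective (grSystem (familyParameters l c) b.toBackground).A₂ := by
  rw [injective_iff_map_eq_zero]
  intro p hp
  rw [← b.momentum_momentumInv p, b.A₂_momentum] at hp
  have h := (smul_eq_zero.1 hp).resolve_left (div_pos b.lapse_pos b.vol_pos).ne'
  have h' := congrArg b.positionInv h
  rw [b.positionInv_position, map_zero] at h'
  rw [← b.momentum_momentumInv p,
    (injective_iff_map_eq_zero _).1 (flatMass_injective hl hc) _ h', map_zero]

theorem A₂_bijective {l c : ℝ} (hl : 0 < l) (hc : 1 + c ≠ 0) :
    Function.Bijective (grSystem (familyParameters l c) b.toBackground).A₂ :=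
  ⟨b.A₂_injective hl hc, LinearMap.surjective_of_injective (b.A₂_injective hl hc)⟩

/-- The variables of the system of wave equations. -/
def waveMap : ((Fin 3 → FieldSpace) × FieldSpace) →ₗ[ℝ] ((Fin 3 → FieldSpace) × FieldSpace) :=
  (LinearMap.pi fun i => ∑ k, b.F k i • b.positionInv ∘ₗ LinearMap.proj k ∘ₗ
    LinearMap.fst ℝ (Fin 3 → FieldSpace) FieldSpace).prod
  (b.lapse⁻¹ • b.positionInv ∘ₗ
    (∑ j, ((grSystem (familyParameters l c) b.toBackground).A₁ j - b.shift j • LinearMap.id) ∘ₗ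
      LinearMap.proj j ∘ₗ LinearMap.fst ℝ (Fin 3 → FieldSpace) FieldSpace +
      (grSystem (familyParameters l c) b.toBackground).A₂ ∘ₗ
        LinearMap.snd ℝ (Fin 3 → FieldSpace) FieldSpace))

theorem waveMap_fst (u : (Fin 3 → FieldSpace) × FieldSpace) (i : Fin 3) :
    (b.waveMap l c u).1 i = ∑ k, b.F k i • b.positionInv (u.1 k) := by
  simp [waveMap]

theorem waveMap_snd (u : (Fin 3 → FieldSpace) × FieldSpace) :
    (b.waveMap l c u).2 = b.lapse⁻¹ • b.positionInv
      ((∑ j, ((grSystem (familyParameters l c) b.toBackground).A₁ j (u.1 j) -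
        b.shift j • u.1 j)) + (grSystem (familyParameters l c) b.toBackground).A₂ u.2) := by
  simp [waveMap]

/-- The map of amplitudes of plane waves. -/
def waveAmplitude (s : Fin 3 → ℝ) (x : FieldSpace × FieldSpace) : FieldSpace × FieldSpace :=
  (b.positionInv x.1, b.lapse⁻¹ • b.positionInv
    (∑ j, s j • (grSystem (familyParameters l c) b.toBackground).A₁ j x.1 -
      (s ⬝ᵥ b.shift) • x.1 + (grSystem (familyParameters l c) b.toBackground).A₂ x.2))

/-- The change of variables is defined on all derivatives and momenta; this shows that it takes
plane waves to plane waves, with the covector expressed in the frame. -/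
theorem waveMap_contraction (s : Fin 3 → ℝ) (x : FieldSpace × FieldSpace) :
    b.waveMap l c (contraction s x) =
      contraction (b.F.transpose.mulVec s) (b.waveAmplitude l c s x) := by
  refine Prod.ext ?_ ?_
  · funext i
    rw [waveMap_fst]
    simp only [contraction_fst, map_smul, smul_smul, ← Finset.sum_smul, waveAmplitude,
      Matrix.mulVec, dotProduct, Matrix.transpose_apply]
  · rw [waveMap_snd, contraction_snd]
    simp only [contraction_fst, contraction_snd, map_smul, waveAmplitude, Finset.sum_sub_distrib,
      dotProduct, Finset.sum_smul, smul_smul, mul_comm]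

theorem waveAmplitude_position_momentum (s : Fin 3 → ℝ) (q p : FieldSpace) :
    b.waveAmplitude l c (b.G.transpose.mulVec s) (b.position q, b.momentum p) =
      (q, flatMixed l c s q + b.vol⁻¹ • flatMass l c p) := by
  have hα := b.lapse_pos.ne'
  refine Prod.ext (b.positionInv_position q) ?_
  simp only [waveAmplitude]
  rw [b.A₁_position, b.A₂_momentum, add_sub_cancel_left]
  simp only [map_add, map_smul, b.positionInv_position, smul_add, smul_smul]
  rw [inv_mul_cancel₀ hα, one_smul]
  congr 2
  field_simp

/-- This is the equivalence with the wave system. In frame components the new momentum is F q + M⁻¹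
p; applying the symbol once more, the terms in p cancel and those in q combine to `waveOp`. Lapse
and shift remain as a factor and a multiple of the identity. -/
theorem waveAmplitude_symbol (s : Fin 3 → ℝ) (x : FieldSpace × FieldSpace) :
    b.waveAmplitude l c (b.G.transpose.mulVec s)
      ((grSystem (familyParameters l c) b.toBackground).symbol (b.G.transpose.mulVec s) x) =
    b.lapse • (waveSystem l c).symbol s (b.waveAmplitude l c (b.G.transpose.mulVec s) x) +
      (b.G.transpose.mulVec s ⬝ᵥ b.shift) • b.waveAmplitude l c (b.G.transpose.mulVec s) x := by
  obtain ⟨q, p⟩ := x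
  rw [← b.position_positionInv q, ← b.momentum_momentumInv p]
  generalize b.positionInv q = q'
  generalize b.momentumInv p = p'
  have hv := b.vol_pos.ne'
  have hsym : (grSystem (familyParameters l c) b.toBackground).symbol (b.G.transpose.mulVec s)
      (b.position q', b.momentum p') =
      (b.position ((b.G.transpose.mulVec s ⬝ᵥ b.shift) • q' +
        b.lapse • (flatMixed l c s q' + b.vol⁻¹ • flatMass l c p')),
      b.momentum ((b.G.transpose.mulVec s ⬝ᵥ b.shift) • p' +
        b.lapse • (flatMixedTranspose l c s p' + b.vol • flatPotential s q'))) := by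
    refine Prod.ext ?_ ?_
    · simp only [symbol]
      rw [b.A₁_position, b.A₂_momentum]
      simp only [map_add, map_smul, smul_add, smul_smul, div_eq_mul_inv, add_assoc]
    · simp only [symbol]
      rw [b.B₁_position, b.B₂_momentum]
      simp only [map_add, map_smul]
      module
  rw [hsym, waveAmplitude_position_momentum, waveAmplitude_position_momentum, symbol_waveSystem]
  refine Prod.ext ?_ ?_
  · simp only [Prod.fst_add, Prod.smul_fst]
    exact add_comm _ _
  · simp only [Prod.snd_add, Prod.smul_snd]
    rw [← flatMixed_flatMixed_add]
    have h := eq_neg_of_add_eq_zero_left (flatMass_flatMixedTranspose l c s p')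
    simp only [map_add, map_smul, h, smul_add, smul_smul, smul_neg]
    rw [show b.vol⁻¹ * (b.lapse * b.vol) = b.lapse by field_simp]
    module

theorem waveAmplitude_surjective {l c : ℝ} (hl : 0 < l) (hc : 1 + c ≠ 0) (s : Fin 3 → ℝ) :
    Function.Surjective (b.waveAmplitude l c s) := by
  rintro ⟨q, w⟩
  obtain ⟨p, hp⟩ := (b.A₂_bijective hl hc).2 (b.lapse • b.position w -
    (∑ j, s j • (grSystem (familyParameters l c) b.toBackground).A₁ j (b.position q) -
      (s ⬝ᵥ b.shift) • b.position q))
  refine ⟨(b.position q, p), Prod.ext (b.positionInv_position q) ?_⟩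
  simp only [waveAmplitude]
  rw [hp, add_sub_cancel, map_smul, b.positionInv_position, smul_smul,
    inv_mul_cancel₀ b.lapse_pos.ne', one_smul]

theorem waveMap_injective {l c : ℝ} (hl : 0 < l) (hc : 1 + c ≠ 0) :
    Function.Injective (b.waveMap l c) := by
  rw [injective_iff_map_eq_zero]
  intro u hu
  have h₁ : ∀ m, u.1 m = 0 := fun m => by
    have h : ∀ i, ∑ k, b.F k i • b.positionInv (u.1 k) = 0 := fun i => by
      rw [← waveMap_fst, hu]
      rfl
    have h' : ∑ i, b.G i m • ∑ k, b.F k i • b.positionInv (u.1 k) = b.positionInv (u.1 m) := by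
      simp only [Finset.smul_sum, smul_smul]
      rw [Finset.sum_comm]
      simp only [← Finset.sum_smul]
      have e : ∀ k, ∑ i, b.G i m * b.F k i = if k = m then 1 else 0 := fun k => by
        have := congrFun (congrFun b.F_mul_G k) m
        rw [Matrix.mul_apply, Matrix.one_apply] at this
        rw [← this]
        exact Finset.sum_congr rfl fun i _ => mul_comm _ _
      simp [e]
    rw [← b.position_positionInv (u.1 m), ← h']
    simp [h]
  have h₂ := congrArg Prod.snd hu
  rw [waveMap_snd] at h₂
  simp only [h₁, map_zero, smul_zero, sub_zero, Finset.sum_const_zero, zero_add] at h₂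
  have h₃ := (smul_eq_zero.1 h₂).resolve_left (inv_ne_zero b.lapse_pos.ne')
  have h₄ := congrArg b.position h₃
  rw [b.position_positionInv, map_zero] at h₄
  refine Prod.ext (funext h₁) ?_
  exact (injective_iff_map_eq_zero _).1 (b.A₂_injective hl hc) _ h₄

/-- The change to the variables of the system of wave equations. -/
def waveEquiv {l c : ℝ} (hl : 0 < l) (hc : 1 + c ≠ 0) :
    ((Fin 3 → FieldSpace) × FieldSpace) ≃ₗ[ℝ] ((Fin 3 → FieldSpace) × FieldSpace) :=
  LinearEquiv.ofInjectiveEndo (b.waveMap l c) (b.waveMap_injective hl hc)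

theorem waveEquiv_apply {l c : ℝ} (hl : 0 < l) (hc : 1 + c ≠ 0)
    (u : (Fin 3 → FieldSpace) × FieldSpace) : b.waveEquiv hl hc u = b.waveMap l c u := rfl

theorem A₁_eq_sum (C : FormulationParameters) (b : Background) (j : Fin 3) (q : FieldSpace) :
    (grSystem C b).A₁ j q = ∑ i, unitVec j i • (grSystem C b).A₁ i q := by
  simp [Pi.single_apply]

theorem waveMap_isFirstBlock {u : (Fin 3 → FieldSpace) × FieldSpace} (hu : IsFirstBlock u) :
    IsFirstBlock (b.waveMap l c u) := by
  have h₁ : ∀ i, vec ((b.waveMap l c u).1 i) = 0 := fun i => by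
    rw [waveMap_fst]
    simp [positionInv, vec_frameMap, hu.vec_eq]
  have h₂ : ten (b.waveMap l c u).2 = 0 := by
    have h : ∀ j, ten ((grSystem (familyParameters l c) b.toBackground).A₁ j (u.1 j) -
        b.shift j • u.1 j) = 0 := fun j => by
      rw [map_sub, A₁_eq_sum, ten_A₁, hu.vec_eq]
      simp
    rw [waveMap_snd, map_smul, positionInv, ten_frameMap, map_add, map_sum,
      Finset.sum_eq_zero fun j _ => h j, ten_A₂, hu.ten_eq, hu.scal_eq]
    simp
  have h₃ : scal (b.waveMap l c u).2 = 0 := by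
    have h : ∀ j, scal ((grSystem (familyParameters l c) b.toBackground).A₁ j (u.1 j) -
        b.shift j • u.1 j) = 0 := fun j => by
      rw [map_sub, A₁_eq_sum, scal_A₁]
      simp
    rw [waveMap_snd, map_smul, positionInv, scal_frameMap, map_add, map_sum,
      Finset.sum_eq_zero fun j _ => h j, scal_A₂, hu.ten_eq, hu.scal_eq]
    simp
  exact ⟨fun i k => congrFun (h₁ i) k, fun kl => congrFun (congrFun h₂ kl.1) kl.2, h₃⟩

theorem waveMap_isSecondBlock {u : (Fin 3 → FieldSpace) × FieldSpace} (hu : IsSecondBlock u) :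
    IsSecondBlock (b.waveMap l c u) := by
  have h₁ : ∀ i, ten ((b.waveMap l c u).1 i) = 0 := fun i => by
    rw [waveMap_fst]
    simp [positionInv, ten_frameMap, hu.ten_eq]
  have h₂ : ∀ i, scal ((b.waveMap l c u).1 i) = 0 := fun i => by
    rw [waveMap_fst]
    simp [positionInv, scal_frameMap, hu.scal_eq]
  have h₃ : vec (b.waveMap l c u).2 = 0 := by
    have h : ∀ j, vec ((grSystem (familyParameters l c) b.toBackground).A₁ j (u.1 j) -
        b.shift j • u.1 j) = 0 := fun j => by
      rw [map_sub, A₁_eq_sum, vec_A₁, hu.ten_eq, hu.scal_eq, Matrix.mul_zero, Matrix.zero_mul,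
        Matrix.zero_mulVec, Matrix.trace_zero]
      simp
    rw [waveMap_snd, map_smul, positionInv, vec_frameMap, map_add, map_sum,
      Finset.sum_eq_zero fun j _ => h j, vec_A₂, hu.vec_eq]
    simp
  exact ⟨fun i kl => congrFun (congrFun (h₁ i) kl.1) kl.2, h₂, fun k => congrFun h₃ k⟩

/-- Transporting the form along the change of variables multiplies the conservation condition by α ≠
0 and adds (s · β)H on both sides, which cancels because H is symmetric. -/
theorem isCandidate_congr_iff {l c : ℝ} (hl : 0 < l) (hc : 1 + c ≠ 0)
    (H : LinearMap.BilinForm ℝ ((Fin 3 → FieldSpace) × FieldSpace)) :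
    (waveSystem l c).IsCandidate (LinearMap.BilinForm.congr (b.waveEquiv hl hc) H) ↔
      (grSystem (familyParameters l c) b.toBackground).IsCandidate H := by
  have hα := b.lapse_pos.ne'
  set K := LinearMap.BilinForm.congr (b.waveEquiv hl hc) H with hK
  have hKH : ∀ u u', K (b.waveMap l c u) (b.waveMap l c u') = H u u' := fun u u' => by
    rw [← waveEquiv_apply b hl hc, ← waveEquiv_apply b hl hc]
    simp [hK]
  have hsymm : (∀ u u', K u u' = K u' u) ↔ ∀ u u', H u u' = H u' u := by
    refine ⟨fun h u u' => by rw [← hKH, h, hKH], fun h u u' => ?_⟩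
    obtain ⟨v, rfl⟩ := (b.waveEquiv hl hc).surjective u
    obtain ⟨v', rfl⟩ := (b.waveEquiv hl hc).surjective u'
    simp only [waveEquiv_apply, hKH]
    exact h v v'
  have key : ∀ (s : Fin 3 → ℝ) (x y : FieldSpace × FieldSpace),
      H (contraction (b.G.transpose.mulVec s) x) (contraction (b.G.transpose.mulVec s)
        ((grSystem (familyParameters l c) b.toBackground).symbol (b.G.transpose.mulVec s) y)) =
      b.lapse * K (contraction s (b.waveAmplitude l c (b.G.transpose.mulVec s) x)) (contraction s
        ((waveSystem l c).symbol s (b.waveAmplitude l c (b.G.transpose.mulVec s) y))) +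
      (b.G.transpose.mulVec s ⬝ᵥ b.shift) *
        H (contraction (b.G.transpose.mulVec s) x) (contraction (b.G.transpose.mulVec s) y) :=
    fun s x y => by
      rw [← hKH, ← hKH, waveMap_contraction, waveMap_contraction, waveMap_contraction,
        waveAmplitude_symbol, b.FT_mulVec]
      simp
  rw [isCandidate_iff, isCandidate_iff, hsymm]
  refine and_congr_right fun hs => ⟨fun h s x y => ?_, fun h s x y => ?_⟩
  · have es : s = b.G.transpose.mulVec (b.F.transpose.mulVec s) := by
      rw [Matrix.mulVec_mulVec, b.GT_mul_FT, Matrix.one_mulVec]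
    have hs' := hsymm.2 hs
    rw [es, key, hs (contraction _ (symbol _ _ x)), key, h, hs' (contraction _ (symbol _ _ _)),
      hs (contraction _ x)]
  · obtain ⟨x, rfl⟩ := b.waveAmplitude_surjective hl hc (b.G.transpose.mulVec s) x
    obtain ⟨y, rfl⟩ := b.waveAmplitude_surjective hl hc (b.G.transpose.mulVec s) y
    have hs' := hsymm.2 hs
    have h' := h (b.G.transpose.mulVec s) x y
    rw [key, hs (contraction _ (symbol _ _ x)), key, hs (contraction _ y)] at h'
    rw [hs' (contraction _ (symbol _ _ _))]
    exact mul_left_cancel₀ hα (add_right_cancel h')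

end FramedBackground

theorem block_inter {u : (Fin 3 → FieldSpace) × FieldSpace} (h : IsFirstBlock u)
    (h' : IsSecondBlock u) : u = 0 :=
  Prod.ext (funext fun i => field_ext (h'.ten_eq i) (h'.scal_eq i) (h.vec_eq i))
    (field_ext h.ten_eq h.scal_eq h'.vec_eq)

theorem IsFirstBlock.sub {u v : (Fin 3 → FieldSpace) × FieldSpace} (hu : IsFirstBlock u)
    (hv : IsFirstBlock v) : IsFirstBlock (u - v) :=
  ⟨fun i k => by simp [hu.1 i k, hv.1 i k], fun kl => by simp [hu.2.1 kl, hv.2.1 kl],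
    by simp [hu.2.2, hv.2.2]⟩

theorem IsSecondBlock.sub {u v : (Fin 3 → FieldSpace) × FieldSpace} (hu : IsSecondBlock u)
    (hv : IsSecondBlock v) : IsSecondBlock (u - v) :=
  ⟨fun i kl => by simp [hu.1 i kl, hv.1 i kl], fun i => by simp [hu.2.1 i, hv.2.1 i],
    fun k => by simp [hu.2.2 k, hv.2.2 k]⟩

theorem exists_block_add (u : (Fin 3 → FieldSpace) × FieldSpace) :
    ∃ v w, IsFirstBlock v ∧ IsSecondBlock w ∧ u = v + w := by
  refine ⟨(fun i => mkField (ten (u.1 i), scal (u.1 i), 0), mkField (0, 0, vec u.2)),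
    (fun i => mkField (0, 0, vec (u.1 i)), mkField (ten u.2, scal u.2, 0)),
    ⟨fun i k => rfl, fun kl => ?_, rfl⟩, ⟨fun i kl => ?_, fun i => rfl, fun k => rfl⟩, ?_⟩
  · change ((0 : ℝ) + 0) / 2 = 0
    simp
  · change ((0 : ℝ) + 0) / 2 = 0
    simp
  · refine Prod.ext (funext fun i => ?_) ?_
    · conv_lhs => rw [← mkField_eta (u.1 i)]
      simp [← map_add]
    · conv_lhs => rw [← mkField_eta u.2]
      simp [← map_add]

theorem finrank_blockCandidates {l c : ℝ} (hl : 0 < l) (hc : c ≠ 0) (hc' : 1 + c ≠ 0)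
    (hg : GenericParameters l c) (b : Background) :
    Module.finrank ℝ (blockCandidates (grSystem (familyParameters l c) b)) = 76 := by
  obtain ⟨b, rfl⟩ := exists_framedBackground b
  -- The change of variables preserves both blocks. As these are complementary, its inverse does so
  -- as well, which is needed to transport the block condition in both directions.
  have hfirst : ∀ u, IsFirstBlock (b.waveEquiv hl hc' u) → IsFirstBlock u := fun u hu => by
    obtain ⟨v, w, hv, hw, rfl⟩ := exists_block_add u
    have h : b.waveEquiv hl hc' w = b.waveEquiv hl hc' (v + w) - b.waveEquiv hl hc' v := by
      rw [map_add, add_sub_cancel_left]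
    have h0 := block_inter (h ▸ hu.sub (b.waveMap_isFirstBlock l c hv))
      (b.waveMap_isSecondBlock l c hw)
    have h1 := (b.waveEquiv hl hc').map_eq_zero_iff.1 h0
    simpa [h1] using hv
  have hsecond : ∀ u, IsSecondBlock (b.waveEquiv hl hc' u) → IsSecondBlock u := fun u hu => by
    obtain ⟨v, w, hv, hw, rfl⟩ := exists_block_add u
    have h : b.waveEquiv hl hc' v = b.waveEquiv hl hc' (v + w) - b.waveEquiv hl hc' w := by
      rw [map_add, add_sub_cancel_right]
    have h0 := block_inter (b.waveMap_isFirstBlock l c hv)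
      (h ▸ hu.sub (b.waveMap_isSecondBlock l c hw))
    have h1 := (b.waveEquiv hl hc').map_eq_zero_iff.1 h0
    simpa [h1] using hw
  have hmap : (blockCandidates (grSystem (familyParameters l c) b.toBackground)).map
      (LinearMap.BilinForm.congr (b.waveEquiv hl hc')).toLinearMap =
        blockCandidates (waveSystem l c) := by
    ext K
    constructor
    · rintro ⟨H, ⟨hH, hb⟩, rfl⟩
      exact ⟨(b.isCandidate_congr_iff hl hc' H).2 hH, fun u u' hu hu' =>
        hb _ _ (hfirst _ (by simpa using hu)) (hsecond _ (by simpa using hu'))⟩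
    · rintro ⟨hK, hb⟩
      refine ⟨(LinearMap.BilinForm.congr (b.waveEquiv hl hc')).symm K,
        ⟨(b.isCandidate_congr_iff hl hc' _).1
          (by rwa [LinearEquiv.apply_symm_apply]), fun u u' hu hu' => ?_⟩,
        LinearEquiv.apply_symm_apply _ _⟩
      exact hb _ _ (b.waveMap_isFirstBlock l c hu) (b.waveMap_isSecondBlock l c hu')
  rw [← finrank_blockCandidates_waveSystem hl.ne' hc hc' hg, ← hmap]
  exact (LinearEquiv.finrank_map_eq _ _).symm

/-- Every minor contains the amplitudes (0, w), whatever s is, and by invertibility of M⁻¹ they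
correspond to all (0, a) of the wave system. So positivity of one minor would make the kinetic part
positive definite. -/
theorem not_isPosDefForm_minor {l c : ℝ} (hl : 0 < l) (hc : c ≠ 0) (hc' : 1 + c ≠ 0)
    (b : Background) {H : LinearMap.BilinForm ℝ ((Fin 3 → FieldSpace) × FieldSpace)}
    (hH : (grSystem (familyParameters l c) b).IsCandidate H) (s : Fin 3 → ℝ) :
    ¬ IsPosDefForm (minor H s) := by
  obtain ⟨b, rfl⟩ := exists_framedBackground b
  intro hpos
  refine candidate_waveSystem_not_pos hl hc ((b.isCandidate_congr_iff hl hc' H).2 hH) fun a ha => ?_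
  obtain ⟨w, hw⟩ := (b.A₂_bijective hl hc').2 (b.lapse • b.position a)
  have hwa : b.waveEquiv hl hc' (0, w) = (0, a) := by
    refine Prod.ext (funext fun i => ?_) ?_
    · rw [b.waveEquiv_apply, b.waveMap_fst]
      simp
    · rw [b.waveEquiv_apply, b.waveMap_snd, hw]
      simp [b.positionInv_position, smul_smul, b.lapse_pos.ne']
  have hne : ((0, w) : FieldSpace × FieldSpace) ≠ 0 := fun h => ha (by
    have h' : w = 0 := congrArg Prod.snd h
    rw [h', Prod.mk_zero_zero, map_zero] at hwa
    exact (congrArg Prod.snd hwa).symm)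
  have h := hpos _ hne
  have hcontr : contraction s ((0 : FieldSpace), w) = (0, w) :=
    Prod.ext (funext fun i => by simp) rfl
  rw [← hwa]
  simpa [minor, hcontr] using h

/-! ### Eigenvectors of the first order system of wave equations -/

/-- If the eigenvectors with nonzero eigenvalue span the range of an endomorphism, then
all eigenvectors together span the whole space. -/
theorem span_eigenvectors_eq_top {U : Type*} [AddCommGroup U] [Module ℝ U] (T : U →ₗ[ℝ] U)
    (h : ∀ u, T u ∈ Submodule.span ℝ {x | ∃ μ : ℝ, μ ≠ 0 ∧ T x = μ • x}) :
    Submodule.span ℝ {x | ∃ μ : ℝ, T x = μ • x} = ⊤ := by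
  have hsurj : ∀ m ∈ Submodule.span ℝ {x | ∃ μ : ℝ, μ ≠ 0 ∧ T x = μ • x},
      ∃ m' ∈ Submodule.span ℝ {x | ∃ μ : ℝ, μ ≠ 0 ∧ T x = μ • x}, T m' = m := by
    intro m hm
    induction hm using Submodule.span_induction with
    | mem x hx =>
      obtain ⟨μ, hμ, hx'⟩ := hx
      refine ⟨μ⁻¹ • x, Submodule.smul_mem _ _ (Submodule.subset_span ⟨μ, hμ, hx'⟩), ?_⟩
      rw [map_smul, hx', smul_smul, inv_mul_cancel₀ hμ, one_smul]
    | zero => exact ⟨0, Submodule.zero_mem _, map_zero T⟩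
    | add x y _ _ hx hy =>
      obtain ⟨x', hx', rfl⟩ := hx
      obtain ⟨y', hy', rfl⟩ := hy
      exact ⟨x' + y', Submodule.add_mem _ hx' hy', map_add T _ _⟩
    | smul t x _ hx =>
      obtain ⟨x', hx', rfl⟩ := hx
      exact ⟨t • x', Submodule.smul_mem _ _ hx', map_smul T _ _⟩
  refine Submodule.eq_top_iff'.2 fun u => ?_
  obtain ⟨m, hm, hmu⟩ := hsurj _ (h u)
  rw [← sub_add_cancel u m]
  refine Submodule.add_mem _ (Submodule.subset_span ⟨0, ?_⟩) (Submodule.span_mono ?_ hm)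
  · rw [map_sub, hmu, sub_self, zero_smul]
  · rintro x ⟨μ, -, hx⟩
    exact ⟨μ, hx⟩

theorem waveOp_symTen_of_orthogonal (l c : ℝ) {s p : Fin 3 → ℝ} (h : s ⬝ᵥ p = 0) :
    waveOp l c s (symTen s p) = ((1 + c) * (1 + 3 * l) / 4 * (s ⬝ᵥ s)) • symTen s p := by
  have e : waveOp l c s (symTen (s + p) (s + p)) - waveOp l c s (symTen s s) -
      waveOp l c s (symTen p p) = (2 : ℝ) • waveOp l c s (symTen s p) := by
    rw [symTen_add_left, symTen_add_right, symTen_add_right, symTen_comm p s]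
    simp only [map_add]
    module
  have e' : waveOp l c s (symTen s p) = (1 / 2 : ℝ) • (waveOp l c s (symTen (s + p) (s + p)) -
      waveOp l c s (symTen s s) - waveOp l c s (symTen p p)) := by
    rw [e]
    module
  rw [e', waveOp_symTen, waveOp_symTen_self, waveOp_symTen, h]
  simp only [symTen_add_left, symTen_add_right, symTen_comm p s, dotProduct_add, add_dotProduct,
    h, dotProduct_comm p s]
  module

/-- For s = e₀ the eigenvectors are: ss and the longitudinal vector with eigenvalue (1 + c)l, the
products of s with transverse axes and the transverse vectors with v, the transverse traceless
tensors with 1, and the flat metric and the scalar, corrected by multiples of ss, with l. -/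
theorem span_eigenvectors_waveOp {l c : ℝ} (hl : 0 < l) (hc : -1 < c) :
    Submodule.span ℝ {a | ∃ κ : ℝ, 0 < κ ∧ waveOp l c (unitVec 0) a = κ • a} = ⊤ := by
  set S := Submodule.span ℝ {a | ∃ κ : ℝ, 0 < κ ∧ waveOp l c (unitVec 0) a = κ • a} with hS
  have hc1 : 0 < 1 + c := by linarith
  have hv : 0 < (1 + c) * (1 + 3 * l) / 4 := by positivity
  have mem : ∀ {a} (κ : ℝ), 0 < κ → waveOp l c (unitVec 0) a = κ • a → a ∈ S :=
    fun κ hκ h => Submodule.subset_span ⟨κ, hκ, h⟩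
  have h00 : symTen (unitVec 0) (unitVec 0) ∈ S := by
    refine mem ((1 + c) * l) (by positivity) ?_
    rw [waveOp_symTen_self]
    simp
  have h0 : ∀ j, j ≠ 0 → symTen (unitVec 0) (unitVec j) ∈ S := fun j hj => by
    refine mem _ hv ?_
    rw [waveOp_symTen_of_orthogonal l c (by simp [hj.symm])]
    simp
  have hflat : flatTen ∈ S := by
    have : flatTen + (1 / l) • symTen (unitVec 0) (unitVec 0) ∈ S := by
      refine mem l hl ?_
      rw [map_add, map_smul, waveOp_flatTen, waveOp_symTen_self]
      simp only [single_dotProduct, Pi.single_eq_same, mul_one, smul_add, smul_smul]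
      rw [mul_one_div_cancel hl.ne', show 1 / l * ((1 + c) * l) = 1 + c by field_simp]
      module
    exact (Submodule.add_mem_iff_left _ (Submodule.smul_mem _ _ h00)).1 this
  have hscal : scalField ∈ S := by
    have : scalField + (2 / l) • symTen (unitVec 0) (unitVec 0) ∈ S := by
      refine mem l hl ?_
      rw [map_add, map_smul, waveOp_scalField, waveOp_symTen_self]
      simp only [single_dotProduct, Pi.single_eq_same, mul_one, smul_add, smul_smul]
      rw [mul_div_cancel₀ _ hl.ne', show 2 / l * ((1 + c) * l) = 2 * (1 + c) by field_simp]
      module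
    exact (Submodule.add_mem_iff_left _ (Submodule.smul_mem _ _ h00)).1 this
  -- For transverse vectors of equal length the terms with ss and with the flat metric cancel in the
  -- difference, leaving eigenvalue 1.
  have hdiff : ∀ p q : Fin 3 → ℝ, unitVec 0 ⬝ᵥ p = 0 → unitVec 0 ⬝ᵥ q = 0 → p ⬝ᵥ p = q ⬝ᵥ q →
      symTen p p - symTen q q ∈ S := fun p q hp hq hpq => by
    refine mem 1 one_pos ?_
    rw [map_sub, waveOp_symTen, waveOp_symTen, hp, hq, hpq]
    simp only [single_dotProduct, Pi.single_eq_same, mul_one]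
    module
  have h12 : symTen (unitVec 1) (unitVec 2) ∈ S := by
    have h := hdiff (unitVec 1 + unitVec 2) (unitVec 1 - unitVec 2) (by simp) (by simp) (by simp)
    have e : symTen (unitVec 1) (unitVec 2) = (1 / 4 : ℝ) •
        (symTen (unitVec 1 + unitVec 2) (unitVec 1 + unitVec 2) -
          symTen (unitVec 1 - unitVec 2) (unitVec 1 - unitVec 2)) := by
      simp only [symTen_add_left, symTen_add_right, symTen_sub_left, symTen_sub_right,
        symTen_comm (unitVec 2) (unitVec 1)]
      module
    rw [e]
    exact Submodule.smul_mem _ _ h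
  have hd := hdiff (unitVec 1) (unitVec 2) (by simp) (by simp) (by simp)
  have h11 : symTen (unitVec 1) (unitVec 1) ∈ S := by
    have e : symTen (unitVec 1) (unitVec 1) = (1 / 2 : ℝ) • (flatTen -
        symTen (unitVec 0) (unitVec 0) +
        (symTen (unitVec 1) (unitVec 1) - symTen (unitVec 2) (unitVec 2))) := by
      rw [flatTen_eq_sum, Fin.sum_univ_three]
      module
    rw [e]
    exact Submodule.smul_mem _ _ (Submodule.add_mem _ (Submodule.sub_mem _ hflat h00) hd)
  have h22 : symTen (unitVec 2) (unitVec 2) ∈ S := by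
    rw [← sub_sub_cancel (symTen (unitVec 1) (unitVec 1)) (symTen (unitVec 2) (unitVec 2))]
    exact Submodule.sub_mem _ h11 hd
  have hvec : ∀ j, vecField (unitVec j) ∈ S := fun j => by
    rcases eq_or_ne j 0 with rfl | hj
    · refine mem ((1 + c) * l) (by positivity) ?_
      rw [waveOp_vecField]
      simp only [single_dotProduct, Pi.single_eq_same, mul_one]
      module
    · refine mem _ hv ?_
      rw [waveOp_vecField]
      simp [hj.symm]
  refine Submodule.eq_top_iff'.2 fun q => ?_
  rw [field_eq_sum_coord q]
  refine Submodule.sum_mem _ fun a _ => Submodule.smul_mem _ _ ?_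
  fin_cases a
  · exact h00
  · exact Submodule.smul_mem _ _ (h0 1 (by decide))
  · exact Submodule.smul_mem _ _ (h0 2 (by decide))
  · exact h11
  · exact Submodule.smul_mem _ _ h12
  · exact h22
  · exact hscal
  · exact hvec 0
  · exact hvec 1
  · exact hvec 2

/-- The symbol of the first order system of wave equations. -/
def waveSymbol (l c : ℝ) (s : Fin 3 → ℝ) :
    ((Fin 3 → FieldSpace) × FieldSpace) →ₗ[ℝ] ((Fin 3 → FieldSpace) × FieldSpace) :=
  firstOrderSymbol (waveSystem l c).principalPart s

theorem waveSymbol_contraction (l c : ℝ) (s : Fin 3 → ℝ) (x : FieldSpace × FieldSpace) :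
    waveSymbol l c s (contraction s x) = contraction s (x.2, waveOp l c s x.1) := by
  rw [waveSymbol, firstOrderSymbol_contraction, symbol_waveSystem]

theorem waveSymbol_apply (l c : ℝ) (s : Fin 3 → ℝ) (u : (Fin 3 → FieldSpace) × FieldSpace) :
    waveSymbol l c s u =
      (fun i => s i • u.2, ∑ j, ∑ p, s p • (waveSystem l c).B₁ p j (u.1 j)) := by
  refine Prod.ext ?_ ?_
  · funext i
    simp [waveSymbol, firstOrderSymbol, principalPart, rhsV, waveSystem, Prod.fst_sum,
      Pi.single_apply]
  · rw [Finset.sum_comm]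
    simp [waveSymbol, firstOrderSymbol, principalPart, rhsW, waveSystem, Prod.snd_sum,
      Finset.smul_sum]

/-- An eigenvector a of `waveOp` with eigenvalue κ > 0 gives the plane wave eigenvectors (a, ±√κ a),
whose combinations are (a, 0) and (0, a). These exhaust the plane waves, which contain the range of
the symbol. -/
theorem span_eigenvectors_waveSymbol {l c : ℝ} (hl : 0 < l) (hc : -1 < c) :
    Submodule.span ℝ {u | ∃ μ : ℝ, waveSymbol l c (unitVec 0) u = μ • u} = ⊤ := by
  refine span_eigenvectors_eq_top _ fun u => ?_
  set S := Submodule.span ℝ {x | ∃ μ : ℝ, μ ≠ 0 ∧ waveSymbol l c (unitVec 0) x = μ • x} with hS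
  have hpm : ∀ a ∈ {a | ∃ κ : ℝ, 0 < κ ∧ waveOp l c (unitVec 0) a = κ • a},
      contraction (unitVec 0) (a, (0 : FieldSpace)) ∈ S ∧
        contraction (unitVec 0) ((0 : FieldSpace), a) ∈ S := by
    rintro a ⟨κ, hκ, ha⟩
    have hsq := Real.mul_self_sqrt hκ.le
    have hpos := Real.sqrt_pos.2 hκ
    have key : ∀ r : ℝ, r ≠ 0 → r * r = κ → contraction (unitVec 0) (a, r • a) ∈ S := by
      intro r hr hrκ
      refine Submodule.subset_span ⟨r, hr, ?_⟩
      rw [waveSymbol_contraction, ← map_smul, ha, ← hrκ]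
      simp [smul_smul]
    have h₁ := key _ hpos.ne' hsq
    have h₂ := key _ (neg_ne_zero.2 hpos.ne') (by rw [neg_mul_neg, hsq])
    constructor
    · have e : (a, (0 : FieldSpace)) = (1 / 2 : ℝ) • ((a, Real.sqrt κ • a) +
          (a, -Real.sqrt κ • a)) := by
        refine Prod.ext ?_ ?_ <;> simp only [Prod.smul_fst, Prod.smul_snd, Prod.fst_add,
          Prod.snd_add] <;> module
      rw [e, map_smul, map_add]
      exact Submodule.smul_mem _ _ (Submodule.add_mem _ h₁ h₂)
    · have e : ((0 : FieldSpace), a) = (1 / (2 * Real.sqrt κ)) • ((a, Real.sqrt κ • a) -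
          (a, -Real.sqrt κ • a)) := by
        refine Prod.ext ?_ ?_
        · simp
        · simp only [Prod.smul_snd, Prod.snd_sub]
          have e : Real.sqrt κ • a - -Real.sqrt κ • a = (2 * Real.sqrt κ) • a := by module
          refine Eq.trans ?_ (congrArg ((1 / (2 * Real.sqrt κ)) • ·) e).symm
          rw [smul_smul, one_div_mul_cancel (by positivity), one_smul]
      rw [e, map_smul, map_sub]
      exact Submodule.smul_mem _ _ (Submodule.sub_mem _ h₁ h₂)
  have hmem : ∀ a, contraction (unitVec 0) (a, (0 : FieldSpace)) ∈ S ∧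
      contraction (unitVec 0) ((0 : FieldSpace), a) ∈ S := by
    intro a
    have ha : a ∈ Submodule.span ℝ
        {a | ∃ κ : ℝ, 0 < κ ∧ waveOp l c (unitVec 0) a = κ • a} := by
      rw [span_eigenvectors_waveOp hl hc]
      exact Submodule.mem_top
    constructor
    · have hle : Submodule.span ℝ {a | ∃ κ : ℝ, 0 < κ ∧ waveOp l c (unitVec 0) a = κ • a} ≤
          S.comap (contraction (unitVec 0) ∘ₗ LinearMap.inl ℝ FieldSpace FieldSpace) :=
        Submodule.span_le.2 fun a ha => (hpm a ha).1
      exact hle ha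
    · have hle : Submodule.span ℝ {a | ∃ κ : ℝ, 0 < κ ∧ waveOp l c (unitVec 0) a = κ • a} ≤
          S.comap (contraction (unitVec 0) ∘ₗ LinearMap.inr ℝ FieldSpace FieldSpace) :=
        Submodule.span_le.2 fun a ha => (hpm a ha).2
      exact hle ha
  -- The image has only longitudinal derivatives, so it is the contraction of an amplitude.
  have e : waveSymbol l c (unitVec 0) u = contraction (unitVec 0) (u.2, (0 : FieldSpace)) +
      contraction (unitVec 0) ((0 : FieldSpace), (waveSymbol l c (unitVec 0) u).2) := by
    rw [← map_add]
    refine Prod.ext (funext fun i => ?_) (by simp)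
    rw [waveSymbol_apply]
    simp
  rw [e]
  exact Submodule.add_mem _ (hmem _).1 (hmem _).2

/-! ### Rotations -/

theorem ten_waveOp_eq (l c : ℝ) (s : Fin 3 → ℝ) (q : FieldSpace) :
    ten (waveOp l c s q) = (s ⬝ᵥ s) • ten q +
      ((1 + c) * (1 + 3 * l) / 4 - 1) • (Matrix.vecMulVec s ((ten q).mulVec s) +
        Matrix.vecMulVec ((ten q).mulVec s) s) +
      ((1 - (1 + c) * (1 + l) / 2) * (ten q).trace - 2 * c * scal q) • Matrix.vecMulVec s s +
      ((1 - l) / 2 * (s ⬝ᵥ (ten q).mulVec s - s ⬝ᵥ s * (ten q).trace)) •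
        (1 : Matrix (Fin 3) (Fin 3) ℝ) := by
  ext i j
  rw [ten_waveOp]
  simp only [Matrix.add_apply, Matrix.smul_apply, Matrix.vecMulVec_apply, smul_eq_mul]
  ring

theorem vec_waveOp_eq (l c : ℝ) (s : Fin 3 → ℝ) (q : FieldSpace) :
    vec (waveOp l c s q) = ((1 + c) * (1 + 3 * l) / 4 * (s ⬝ᵥ s)) • vec q +
      ((1 + c) * (l - 1) / 4 * (s ⬝ᵥ vec q)) • s := rfl

section rotation

variable {O : Matrix (Fin 3) (Fin 3) ℝ}

theorem orthogonal_dotProduct (hO : O.transpose * O = 1) (v w : Fin 3 → ℝ) :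
    O.mulVec v ⬝ᵥ O.mulVec w = v ⬝ᵥ w := by
  rw [Matrix.dotProduct_mulVec, ← Matrix.mulVec_transpose, Matrix.mulVec_mulVec, hO,
    Matrix.one_mulVec]

/-- The operator is built from Euclidean products, traces and tensor products only. -/
theorem waveOp_rotation (hO : O.transpose * O = 1) (l c : ℝ) (s : Fin 3 → ℝ) (q : FieldSpace) :
    waveOp l c (O.mulVec s) (frameMap O O 1 1 q) = frameMap O O 1 1 (waveOp l c s q) := by
  have hO' : O * O.transpose = 1 := mul_eq_one_comm.1 hO
  have htr : (O * ten q * O.transpose).trace = (ten q).trace := by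
    rw [Matrix.trace_mul_comm, ← Matrix.mul_assoc, hO, Matrix.one_mul]
  have hmv : (O * ten q * O.transpose).mulVec (O.mulVec s) = O.mulVec ((ten q).mulVec s) := by
    rw [Matrix.mulVec_mulVec, Matrix.mul_assoc, hO, Matrix.mul_one, Matrix.mulVec_mulVec]
  refine field_ext ?_ ?_ ?_
  · rw [ten_waveOp_eq, ten_frameMap, ten_frameMap, scal_frameMap, ten_waveOp_eq, htr, hmv,
      orthogonal_dotProduct hO, orthogonal_dotProduct hO]
    simp only [FramedBackground.vecMulVec_mulVec, Matrix.mul_add, Matrix.add_mul, Matrix.mul_smul,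
      Matrix.smul_mul, Matrix.mul_one, hO', one_mul]
  · rw [scal_waveOp, scal_frameMap, scal_frameMap, scal_waveOp, orthogonal_dotProduct hO]
    ring
  · rw [vec_waveOp_eq, vec_frameMap, vec_frameMap, vec_waveOp_eq, one_smul, one_smul,
      orthogonal_dotProduct hO, orthogonal_dotProduct hO, Matrix.mulVec_add, Matrix.mulVec_smul,
      Matrix.mulVec_smul]

end rotation

/-- The action of a matrix on derivatives and momenta. -/
def rotationMap (O : Matrix (Fin 3) (Fin 3) ℝ) :
    ((Fin 3 → FieldSpace) × FieldSpace) →ₗ[ℝ] ((Fin 3 → FieldSpace) × FieldSpace) :=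
  ((LinearMap.pi fun i => ∑ k, O i k • frameMap O O 1 1 ∘ₗ LinearMap.proj k) ∘ₗ
    LinearMap.fst ℝ (Fin 3 → FieldSpace) FieldSpace).prod
  (frameMap O O 1 1 ∘ₗ LinearMap.snd ℝ (Fin 3 → FieldSpace) FieldSpace)

theorem rotationMap_apply (O : Matrix (Fin 3) (Fin 3) ℝ)
    (u : (Fin 3 → FieldSpace) × FieldSpace) :
    rotationMap O u = (fun i => ∑ k, O i k • frameMap O O 1 1 (u.1 k), frameMap O O 1 1 u.2) := by
  refine Prod.ext (funext fun i => ?_) rfl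
  simp [rotationMap]

theorem rotationMap_rotationMap {O O' : Matrix (Fin 3) (Fin 3) ℝ} (h : O * O' = 1)
    (u : (Fin 3 → FieldSpace) × FieldSpace) : rotationMap O (rotationMap O' u) = u := by
  have hf : ∀ q, frameMap O O 1 1 (frameMap O' O' 1 1 q) = q := fun q => by
    rw [frameMap_frameMap, h, mul_one, frameMap_one]
  rw [rotationMap_apply, rotationMap_apply]
  refine Prod.ext (funext fun i => ?_) (hf _)
  simp only [map_sum, map_smul, hf, Finset.smul_sum, smul_smul]
  rw [Finset.sum_comm]
  simp only [← Finset.sum_smul]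
  have e : ∀ k, ∑ j, O i j * O' j k = if i = k then 1 else 0 := fun k => by
    rw [← Matrix.mul_apply, h, Matrix.one_apply]
  simp [e]

theorem polar_waveSystem_B₁ (l c : ℝ) (s t : Fin 3 → ℝ) (q : FieldSpace) :
    ∑ j, ∑ p, (t j * s p) • (waveSystem l c).B₁ p j q = (1 / 2 : ℝ) •
      (waveOp l c (s + t) q - waveOp l c s q - waveOp l c t q) := by
  have hc : ∀ (s t : Fin 3 → ℝ), ∑ i, ∑ j, (s i * t j) • (waveSystem l c).B₁ i j q =
      ∑ i, ∑ j, (t i * s j) • (waveSystem l c).B₁ i j q := fun s t => by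
    rw [Finset.sum_comm]
    refine Finset.sum_congr rfl fun i _ => Finset.sum_congr rfl fun j _ => ?_
    rw [waveSystem_B₁_comm, mul_comm]
  simp only [← sum_waveSystem_B₁, Pi.add_apply, mul_add, add_mul, add_smul,
    Finset.sum_add_distrib]
  rw [hc t s]
  have e : ∑ j, ∑ p, (t j * s p) • (waveSystem l c).B₁ p j q =
      ∑ i, ∑ j, (s i * t j) • (waveSystem l c).B₁ i j q := by
    rw [Finset.sum_comm]
    simp only [mul_comm]
  rw [e]
  module

/-- Off plane waves the symbol involves the single coefficients `B₁`, contracted with s in one index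
only. Covariance of `waveOp` passes to them by polarization. -/
theorem waveSymbol_rotation {O : Matrix (Fin 3) (Fin 3) ℝ} (hO : O.transpose * O = 1) (l c : ℝ)
    (s : Fin 3 → ℝ) (u : (Fin 3 → FieldSpace) × FieldSpace) :
    waveSymbol l c (O.mulVec s) (rotationMap O u) = rotationMap O (waveSymbol l c s u) := by
  rw [waveSymbol_apply, waveSymbol_apply, rotationMap_apply, rotationMap_apply]
  refine Prod.ext (funext fun i => ?_) ?_
  · simp only [map_smul, smul_smul, ← Finset.sum_smul, Matrix.mulVec, dotProduct]
  · have hpol : ∀ (t : Fin 3 → ℝ) (q : FieldSpace),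
        ∑ j, ∑ p, (O.mulVec t j * O.mulVec s p) • (waveSystem l c).B₁ p j (frameMap O O 1 1 q) =
        frameMap O O 1 1 (∑ j, ∑ p, (t j * s p) • (waveSystem l c).B₁ p j q) := fun t q => by
      rw [polar_waveSystem_B₁, polar_waveSystem_B₁, ← Matrix.mulVec_add, waveOp_rotation hO,
        waveOp_rotation hO, waveOp_rotation hO]
      simp only [map_smul, map_sub]
    have hk : ∀ k, ∑ j, ∑ p, (O j k * O.mulVec s p) •
        (waveSystem l c).B₁ p j (frameMap O O 1 1 (u.1 k)) =
        frameMap O O 1 1 (∑ p, s p • (waveSystem l c).B₁ p k (u.1 k)) := fun k => by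
      have := hpol (unitVec k) (u.1 k)
      simp only [Matrix.mulVec_single_one, Matrix.col_apply] at this
      rw [this]
      congr 1
      rw [Finset.sum_eq_single k]
      · simp
      · intro j _ hjk
        simp [hjk]
      · simp
    rw [map_sum]
    simp only [← hk]
    conv_rhs => rw [Finset.sum_comm]
    refine Finset.sum_congr rfl fun j _ => ?_
    conv_rhs => rw [Finset.sum_comm]
    simp only [map_sum, map_smul, Finset.smul_sum, smul_smul, mul_comm]

/-! ### Strong hyperbolicity -/

/-- The reflection at the plane orthogonal to `u`. -/
def householder (u : Fin 3 → ℝ) : Matrix (Fin 3) (Fin 3) ℝ :=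
  1 - (2 / (u ⬝ᵥ u)) • Matrix.vecMulVec u u

theorem householder_transpose (u : Fin 3 → ℝ) : (householder u).transpose = householder u := by
  simp [householder, Matrix.transpose_vecMulVec]

theorem householder_mul_self (u : Fin 3 → ℝ) : householder u * householder u = 1 := by
  have h : 2 / (u ⬝ᵥ u) * (2 / (u ⬝ᵥ u)) * (u ⬝ᵥ u) = 2 * (2 / (u ⬝ᵥ u)) := by
    rcases eq_or_ne (u ⬝ᵥ u) 0 with h | h
    · simp [h]
    · field_simp
  have e : Matrix.vecMulVec u u * Matrix.vecMulVec u u = (u ⬝ᵥ u) • Matrix.vecMulVec u u := by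
    rw [Matrix.vecMulVec_mul_vecMulVec, Matrix.vecMulVec_smul]
  have e' : (2 / (u ⬝ᵥ u)) • Matrix.vecMulVec u u * (2 / (u ⬝ᵥ u)) • Matrix.vecMulVec u u =
      (2 * (2 / (u ⬝ᵥ u))) • Matrix.vecMulVec u u := by
    rw [Matrix.smul_mul, Matrix.mul_smul, e, smul_smul, smul_smul, h]
  rw [householder, mul_sub, sub_mul, sub_mul, mul_one, mul_one, one_mul, e']
  module

/-- The vectors s and −ρe₀ have the same length, and the mirror is orthogonal to their difference,
so the reflection exchanges them. -/
theorem householder_mulVec (s : Fin 3 → ℝ) {ρ : ℝ} (hρ : ρ * ρ = s ⬝ᵥ s)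
    (hu : (s + ρ • unitVec 0) ⬝ᵥ (s + ρ • unitVec 0) ≠ 0) :
    (householder (s + ρ • unitVec 0)).mulVec (-ρ • unitVec 0) = s := by
  have h : (s + ρ • unitVec 0) ⬝ᵥ (s + ρ • unitVec 0) = 2 * ρ * (s 0 + ρ) := by
    simp only [add_dotProduct, dotProduct_add, ← hρ, smul_dotProduct, dotProduct_smul,
      single_dotProduct, dotProduct_single, Pi.add_apply, Pi.smul_apply, Pi.single_eq_same,
      smul_eq_mul]
    ring
  have h' : (s + ρ • unitVec 0) ⬝ᵥ (-ρ • unitVec 0) = -ρ * (s 0 + ρ) := by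
    simp
  have e : ∀ v w : Fin 3 → ℝ, (Matrix.vecMulVec v v).mulVec w = (v ⬝ᵥ w) • v := fun v w => by
    rw [Matrix.vecMulVec_mulVec]
    exact op_smul_eq_smul _ _
  rw [householder, Matrix.sub_mulVec, Matrix.one_mulVec, Matrix.smul_mulVec, e, h', smul_smul, h]
  rw [h] at hu
  have hρ0 : ρ ≠ 0 := fun h0 => hu (by rw [h0]; ring)
  have hs0 : s 0 + ρ ≠ 0 := right_ne_zero_of_mul hu
  rw [show 2 / (2 * ρ * (s 0 + ρ)) * (-ρ * (s 0 + ρ)) = -1 by field_simp]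
  module

theorem firstOrderSymbol_apply {U : Type*} [AddCommGroup U] [Module ℝ U]
    (A : Fin 3 → U →ₗ[ℝ] U) (s : Fin 3 → ℝ) (u : U) :
    firstOrderSymbol A s u = ∑ p, s p • A p u := by
  simp [firstOrderSymbol]

/-- A first order system is strongly hyperbolic if its symbols are, up to locally continuous
changes of variables, multiples of a fixed diagonalizable endomorphism, shifted by scalars. -/
theorem isStronglyHyperbolicFirstOrder_of_conj {U : Type*} [AddCommGroup U] [Module ℝ U]
    [FiniteDimensional ℝ U] [TopologicalSpace U] {A : Fin 3 → U →ₗ[ℝ] U} (T : U →ₗ[ℝ] U)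
    (hT : Submodule.span ℝ {x | ∃ μ : ℝ, T x = μ • x} = ⊤)
    (h : ∀ s₀ : Fin 3 → ℝ, s₀ ≠ 0 → ∃ N ∈ 𝓝 s₀, ∃ (R : (Fin 3 → ℝ) → U ≃ₗ[ℝ] U)
      (ρ τ : (Fin 3 → ℝ) → ℝ), (∀ u, ContinuousOn (fun s => R s u) N) ∧
        ∀ s ∈ N, ∀ u, firstOrderSymbol A s (R s u) = ρ s • R s (T u) + τ s • R s u) :
    IsStronglyHyperbolicFirstOrder A := by
  obtain ⟨e, he⟩ : ∃ e : Module.Basis (Fin (Module.finrank ℝ U)) ℝ U,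
      ∀ k, ∃ μ : ℝ, T (e k) = μ • e k := by
    let e₀ := Module.Basis.ofSpan hT.ge
    have : Fintype _ := FiniteDimensional.fintypeBasisIndex e₀
    refine ⟨e₀.reindex (Fintype.equivFinOfCardEq (Module.finrank_eq_card_basis e₀).symm),
      fun k => ?_⟩
    rw [Module.Basis.reindex_apply]
    exact Module.Basis.ofSpan_subset hT.ge ⟨_, rfl⟩
  choose μ hμ using he
  intro s₀ hs₀
  obtain ⟨N, hN, R, ρ, τ, hR, hA⟩ := h s₀ hs₀
  refine ⟨N, hN, fun s => e.map (R s), fun s k => ρ s * μ k + τ s, fun k => ?_, fun s hs k => ?_⟩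
  · simpa using hR (e k)
  · rw [Module.Basis.map_apply, hA s hs, hμ, map_smul, smul_smul, ← add_smul]

/-- The action of a reflection on derivatives and momenta. -/
def reflectionEquiv (u : Fin 3 → ℝ) :
    ((Fin 3 → FieldSpace) × FieldSpace) ≃ₗ[ℝ] ((Fin 3 → FieldSpace) × FieldSpace) :=
  LinearEquiv.ofInvolutive (rotationMap (householder u))
    (rotationMap_rotationMap (householder_mul_self u))

theorem waveSymbol_reflection (l c : ℝ) (s : Fin 3 → ℝ) {ρ : ℝ} (hρ : ρ * ρ = s ⬝ᵥ s)
    (hu : (s + ρ • unitVec 0) ⬝ᵥ (s + ρ • unitVec 0) ≠ 0)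
    (x : (Fin 3 → FieldSpace) × FieldSpace) :
    waveSymbol l c s (reflectionEquiv (s + ρ • unitVec 0) x) =
      -ρ • reflectionEquiv (s + ρ • unitVec 0) (waveSymbol l c (unitVec 0) x) := by
  have hO : (householder (s + ρ • unitVec 0)).transpose * householder (s + ρ • unitVec 0) = 1 := by
    rw [householder_transpose, householder_mul_self]
  have h := waveSymbol_rotation hO l c (-ρ • unitVec 0) x
  rw [householder_mulVec s hρ hu] at h
  refine h.trans ?_
  have e : waveSymbol l c (-ρ • unitVec 0) x = -ρ • waveSymbol l c (unitVec 0) x := by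
    simp only [waveSymbol, firstOrderSymbol_apply, Finset.smul_sum, Pi.smul_apply, smul_smul,
      smul_eq_mul]
  rw [e, map_smul]
  rfl

theorem continuous_mkField : Continuous mkField :=
  LinearMap.continuous_of_finiteDimensional _

theorem continuous_rotationMap (x : (Fin 3 → FieldSpace) × FieldSpace) :
    Continuous fun O => rotationMap O x := by
  have h : ∀ q, Continuous fun O => frameMap O O 1 1 q := fun q => by
    refine continuous_mkField.comp ?_
    fun_prop
  simp only [rotationMap_apply]
  refine Continuous.prodMk (continuous_pi fun i => continuous_finsetSum _ fun k _ => ?_) (h _)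
  exact (continuous_id.matrix_elem i k).smul (h _)

theorem continuousOn_reflectionEquiv (x : (Fin 3 → FieldSpace) × FieldSpace) :
    ContinuousOn (fun u => reflectionEquiv u x) {u | u ⬝ᵥ u ≠ 0} := by
  refine (continuous_rotationMap x).comp_continuousOn ?_
  refine continuousOn_const.sub (ContinuousOn.smul (continuousOn_const.div ?_ fun u hu => hu) ?_)
  · exact Continuous.continuousOn (by fun_prop)
  · exact Continuous.continuousOn (by fun_prop)

namespace FramedBackground

variable (b : FramedBackground) {l c : ℝ} (hl : 0 < l) (hc : 1 + c ≠ 0)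

/-- A reduction to first order. -/
def reduction (p : Fin 3) : (FieldSpace × (Fin 3 → FieldSpace) × FieldSpace) →ₗ[ℝ]
    (FieldSpace × (Fin 3 → FieldSpace) × FieldSpace) :=
  b.shift p • LinearMap.id + LinearMap.prodMap 0
    ((b.waveEquiv hl hc).symm.toLinearMap ∘ₗ
      (b.lapse • ∑ q, b.F p q • (waveSystem l c).principalPart q) ∘ₗ
        (b.waveEquiv hl hc).toLinearMap)

theorem firstOrderSymbol_reduction (s : Fin 3 → ℝ)
    (u : FieldSpace × (Fin 3 → FieldSpace) × FieldSpace) :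
    firstOrderSymbol (b.reduction hl hc) s u = (0, b.lapse • (b.waveEquiv hl hc).symm
      (waveSymbol l c (b.F.transpose.mulVec s) (b.waveEquiv hl hc u.2))) + (s ⬝ᵥ b.shift) • u := by
  have e : ∀ x, waveSymbol l c (b.F.transpose.mulVec s) x =
      ∑ p, s p • ∑ q, b.F p q • (waveSystem l c).principalPart q x := fun x => by
    simp only [waveSymbol, firstOrderSymbol_apply, Matrix.mulVec, dotProduct,
      Matrix.transpose_apply, Finset.sum_smul, Finset.smul_sum, smul_smul]
    rw [Finset.sum_comm]
    simp only [mul_comm]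
  rw [firstOrderSymbol_apply, e, add_comm, dotProduct, Finset.sum_smul]
  simp only [reduction, LinearMap.add_apply, smul_add, Finset.sum_add_distrib]
  congr 1
  · simp [smul_smul]
  · refine Prod.ext (by simp [Prod.fst_sum]) ?_
    simp only [Prod.snd_sum, Prod.smul_snd, LinearMap.prodMap_apply, LinearMap.comp_apply,
      LinearMap.smul_apply, LinearEquiv.coe_coe, map_smul, map_sum, LinearMap.sum_apply,
      Finset.smul_sum, smul_smul]
    refine Finset.sum_congr rfl fun p _ => Finset.sum_congr rfl fun q _ => ?_
    congr 1
    ring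

/-- On plane waves the conjugated wave symbol agrees with the symbol of the system by
`waveAmplitude_symbol`; off them the reduction is defined by the wave system, which is the freedom
to add auxiliary constraints. -/
theorem isFirstOrderReduction_reduction :
    (grSystem (familyParameters l c) b.toBackground).IsFirstOrderReduction
      (b.reduction hl hc) := by
  intro s x
  have es : s = b.G.transpose.mulVec (b.F.transpose.mulVec s) := by
    rw [Matrix.mulVec_mulVec, b.GT_mul_FT, Matrix.one_mulVec]
  rw [firstOrderSymbol_reduction]
  refine Prod.ext (by simp) ?_
  apply (b.waveEquiv hl hc).injective
  simp only [Prod.snd_add, Prod.smul_snd, map_add, map_smul, LinearEquiv.apply_symm_apply]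
  simp only [waveEquiv_apply, waveMap_contraction, waveSymbol, firstOrderSymbol_contraction]
  have h := b.waveAmplitude_symbol l c (b.F.transpose.mulVec s) x
  rw [← es] at h
  rw [h, map_add, map_smul, map_smul]

/-- In frame components each symbol is, up to a reflection and the shift, a multiple of the symbol
for e₀. An eigenbasis for e₀ is carried to nearby covectors by reflections that depend continuously
on them. -/
theorem isStronglyHyperbolicFirstOrder_reduction (hc' : -1 < c) :
    IsStronglyHyperbolicFirstOrder (b.reduction hl hc) := by
  have hT : Submodule.span ℝ {x : FieldSpace × (Fin 3 → FieldSpace) × FieldSpace |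
      ∃ μ : ℝ, LinearMap.prodMap (0 : FieldSpace →ₗ[ℝ] FieldSpace)
        (waveSymbol l c (unitVec 0)) x = μ • x} = ⊤ := by
    refine Submodule.eq_top_iff'.2 fun x => ?_
    rw [show x = (x.1, 0) + (0, x.2) by simp]
    refine Submodule.add_mem _ (Submodule.subset_span ⟨0, by simp⟩) ?_
    have hx : x.2 ∈ Submodule.span ℝ {u | ∃ μ : ℝ, waveSymbol l c (unitVec 0) u = μ • u} := by
      rw [span_eigenvectors_waveSymbol hl hc']
      exact Submodule.mem_top
    have hle : Submodule.span ℝ {u | ∃ μ : ℝ, waveSymbol l c (unitVec 0) u = μ • u} ≤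
        (Submodule.span ℝ {x : FieldSpace × (Fin 3 → FieldSpace) × FieldSpace |
          ∃ μ : ℝ, LinearMap.prodMap (0 : FieldSpace →ₗ[ℝ] FieldSpace)
            (waveSymbol l c (unitVec 0)) x = μ • x}).comap
          (LinearMap.inr ℝ FieldSpace ((Fin 3 → FieldSpace) × FieldSpace)) := by
      refine Submodule.span_le.2 ?_
      rintro u ⟨μ, hu⟩
      exact Submodule.subset_span ⟨μ, by simp [hu]⟩
    exact hle hx
  refine isStronglyHyperbolicFirstOrder_of_conj _ hT fun s₀ hs₀ => ?_
  set t : (Fin 3 → ℝ) → Fin 3 → ℝ := fun s => b.F.transpose.mulVec s with ht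
  have ht0 : t s₀ ≠ 0 := fun h => hs₀ (by
    rw [← Matrix.one_mulVec s₀, ← b.GT_mul_FT, ← Matrix.mulVec_mulVec]
    exact (congrArg _ h).trans (Matrix.mulVec_zero _))
  have hpos : 0 < t s₀ ⬝ᵥ t s₀ :=
    lt_of_le_of_ne (Finset.sum_nonneg fun i _ => mul_self_nonneg _)
      fun h => ht0 (dotProduct_self_eq_zero.1 h.symm)
  have htc : Continuous t := by fun_prop
  -- The sign is chosen so that no cancellation occurs in t + σ|t|e₀ at the base point; the
  -- reflection vector is then nonzero there, hence nearby.
  obtain ⟨σ, hσ, hσs⟩ : ∃ σ : ℝ, σ * σ = 1 ∧ 0 ≤ σ * t s₀ 0 := by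
    rcases le_total 0 (t s₀ 0) with h | h
    · exact ⟨1, by norm_num, by simpa using h⟩
    · exact ⟨-1, by norm_num, by simpa using h⟩
  set ρ : (Fin 3 → ℝ) → ℝ := fun s => σ * Real.sqrt (t s ⬝ᵥ t s) with hρ
  have hρc : Continuous ρ := by fun_prop
  have hρs : ∀ s, ρ s * ρ s = t s ⬝ᵥ t s := fun s => by
    rw [hρ, mul_mul_mul_comm, hσ, one_mul, Real.mul_self_sqrt]
    exact Finset.sum_nonneg fun i _ => mul_self_nonneg _
  set u : (Fin 3 → ℝ) → Fin 3 → ℝ := fun s => t s + ρ s • unitVec 0 with hu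
  have huc : Continuous u := by fun_prop
  have hu0 : u s₀ ⬝ᵥ u s₀ ≠ 0 := by
    have e : u s₀ ⬝ᵥ u s₀ = 2 * (t s₀ ⬝ᵥ t s₀) +
        2 * (Real.sqrt (t s₀ ⬝ᵥ t s₀) * (σ * t s₀ 0)) := by
      have h := hρs s₀
      simp only [hu, add_dotProduct, dotProduct_add, smul_dotProduct, dotProduct_smul,
        single_dotProduct, dotProduct_single, Pi.add_apply, Pi.smul_apply, Pi.single_eq_same,
        smul_eq_mul, mul_one, one_mul]
      linear_combination h
    rw [e]
    positivity
  refine ⟨{s | u s ⬝ᵥ u s ≠ 0}, (isOpen_ne_fun (by fun_prop) continuous_const).mem_nhds hu0,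
    fun s => (LinearEquiv.refl ℝ FieldSpace).prodCongr
      ((reflectionEquiv (u s)).trans (b.waveEquiv hl hc).symm),
    fun s => b.lapse * -ρ s, fun s => s ⬝ᵥ b.shift, fun x => ?_, fun s hs x => ?_⟩
  · refine continuousOn_const.prodMk ?_
    refine (LinearMap.continuous_of_finiteDimensional
      (b.waveEquiv hl hc).symm.toLinearMap).comp_continuousOn ?_
    exact (continuousOn_reflectionEquiv x.2).comp huc.continuousOn fun s hs => hs
  · rw [firstOrderSymbol_reduction]
    congr 1
    refine Prod.ext (by simp) ?_
    simp only [LinearEquiv.prodCongr_apply, LinearEquiv.trans_apply, LinearEquiv.apply_symm_apply,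
      Prod.smul_snd, LinearMap.prodMap_apply]
    rw [waveSymbol_reflection l c (t s) (hρs s) hs, map_smul, smul_smul]

end FramedBackground

theorem isStronglyHyperbolic_grSystem {l c : ℝ} (hl : 0 < l) (hc : -1 < c) (b : Background) :
    (grSystem (familyParameters l c) b).IsStronglyHyperbolic := by
  obtain ⟨b, rfl⟩ := exists_framedBackground b
  have hc' : 1 + c ≠ 0 := by linarith
  exact ⟨b.reduction hl hc', b.isFirstOrderReduction_reduction hl hc',
    b.isStronglyHyperbolicFirstOrder_reduction hl hc' hc⟩

/-! ### From symmetric hyperbolicity to candidates, and the main theorem -/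

/-- The restriction of a symmetrizer of a reduction to first order is a candidate. -/
theorem SecondOrderSystem.exists_candidate_of_isSymmetricHyperbolic {V W : Type*}
    [AddCommGroup V] [Module ℝ V] [AddCommGroup W] [Module ℝ W] {S : SecondOrderSystem V W}
    (h : S.IsSymmetricHyperbolic) :
    ∃ H, S.IsCandidate H ∧ ∀ s : Fin 3 → ℝ, s ≠ 0 → IsPosDefForm (minor H s) := by
  obtain ⟨A, hA, H, hsymm, hpos, hH⟩ := h
  refine ⟨H.compl₁₂ (LinearMap.inr ℝ V _) (LinearMap.inr ℝ V _), ⟨fun u u' => hsymm _ _, ?_⟩, ?_⟩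
  · intro s x y
    have hs : ∀ u u', H u (firstOrderSymbol A s u') = H (firstOrderSymbol A s u) u' :=
      fun u u' => by
        simp only [firstOrderSymbol, LinearMap.sum_apply, LinearMap.smul_apply, map_sum, map_smul,
          hH]
    have h := hs (0, contraction s x) (0, contraction s y)
    rw [hA, hA] at h
    simpa [firstOrderSymbol_contraction] using h
  · intro s hs x hx
    -- A nonzero component of s makes the contraction injective, so positivity passes to the minor.
    obtain ⟨i, hi⟩ := Function.ne_iff.1 hs
    refine hpos (0, contraction s x) fun h => hx ?_
    have h' : contraction s x = 0 := congrArg Prod.snd h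
    have h₁ : s i • x.1 = 0 := congrFun (congrArg Prod.fst h') i
    have h₂ : x.2 = 0 := congrArg Prod.snd h'
    exact Prod.ext ((smul_eq_zero.1 h₁).resolve_left hi) h₂

theorem exists_generic_polynomial : ∃ P : MvPolynomial (Fin 2) ℝ, P ≠ 0 ∧
    ∀ l c : ℝ, MvPolynomial.eval ![l, c] P ≠ 0 → GenericParameters l c := by
  let L : MvPolynomial (Fin 2) ℝ := MvPolynomial.X 0
  let K : MvPolynomial (Fin 2) ℝ := MvPolynomial.X 1
  let P := (L - 1) * (4 * L - (1 + K) * (1 + 3 * L)) * ((1 + K) * (1 + 3 * L) - 4) *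
    ((1 + K) * L - 1) * (L - 1 - K * (1 + L))
  have hP : ∀ l c : ℝ, MvPolynomial.eval ![l, c] P =
      (l - 1) * (4 * l - (1 + c) * (1 + 3 * l)) * ((1 + c) * (1 + 3 * l) - 4) *
        ((1 + c) * l - 1) * (l - 1 - c * (1 + l)) := fun l c => by
    simp [P, L, K]
  refine ⟨P, fun h => ?_, fun l c h => ?_⟩
  -- The product of the five genericity conditions is not the zero polynomial, since no factor
  -- vanishes at l = 2, c = 1.
  · have h' := hP 2 1
    rw [h, map_zero] at h'
    norm_num at h'
  · rw [hP] at h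
    simp only [mul_ne_zero_iff] at h
    obtain ⟨⟨⟨⟨h₁, h₂⟩, h₃⟩, h₄⟩, h₅⟩ := h
    exact ⟨fun e => h₁ (by linarith), fun e => h₂ (by linarith), fun e => h₃ (by linarith),
      fun e => h₄ (by linarith), h₅⟩

theorem mainTheorem8 :
    -- every member of the family, at every background
    (∀ C : FormulationParameters, C.InNonSymFamily → ∀ b : Background,
      (grSystem C b).HasHamiltonianStructure fieldPairing ∧
      (grSystem C b).IsStronglyHyperbolic ∧
      ¬ (grSystem C b).IsSymmetricHyperbolic ∧
      ¬ ∃ H, (grSystem C b).IsCandidate H ∧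
          ∀ s : Fin 3 → ℝ, s ≠ 0 → IsPosDefForm (SecondOrderSystem.minor H s)) ∧
    -- generic members of the family, at every background
    (∃ P : MvPolynomial (Fin 2) ℝ, P ≠ 0 ∧
      ∀ C : FormulationParameters, C.InNonSymFamily →
        MvPolynomial.eval ![C.lamMinusSq, C.C₅] P ≠ 0 → ∀ b : Background,
          Module.finrank ℝ (blockCandidates (grSystem C b)) = 76 ∧
          ∀ H, (grSystem C b).IsCandidate H → ∀ s : Fin 3 → ℝ, s ≠ 0 →
            ¬ IsPosDefForm (SecondOrderSystem.minor H s)) ∧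
    -- the family is not empty: each admissible pair of parameters occurs
    (∀ l c : ℝ, 0 < l → -1 < c → c ≠ 0 →
      ∃ C : FormulationParameters, C.InNonSymFamily ∧ C.lamMinusSq = l ∧ C.C₅ = c) ∧
    -- hence there are strongly but not symmetric hyperbolic Hamiltonian formulations
    (∃ C : FormulationParameters, ∀ b : Background,
      (grSystem C b).HasHamiltonianStructure fieldPairing ∧
      (grSystem C b).IsStronglyHyperbolic ∧ ¬ (grSystem C b).IsSymmetricHyperbolic) := by
  have hsym : ∀ C : FormulationParameters, C.InNonSymFamily → ∀ b : Background,
      ∀ H, (grSystem C b).IsCandidate H → ∀ s : Fin 3 → ℝ,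
        ¬ IsPosDefForm (SecondOrderSystem.minor H s) := fun C hC b H hH s => by
    rw [hC.eq_familyParameters] at hH
    exact not_isPosDefForm_minor hC.lamMinus_pos hC.c5_ne (by linarith [hC.c5_gt]) b hH s
  have hall : ∀ C : FormulationParameters, C.InNonSymFamily → ∀ b : Background,
      (grSystem C b).HasHamiltonianStructure fieldPairing ∧
      (grSystem C b).IsStronglyHyperbolic ∧
      ¬ (grSystem C b).IsSymmetricHyperbolic ∧
      ¬ ∃ H, (grSystem C b).IsCandidate H ∧
          ∀ s : Fin 3 → ℝ, s ≠ 0 → IsPosDefForm (SecondOrderSystem.minor H s) := by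
    intro C hC b
    have hno : ¬ ∃ H, (grSystem C b).IsCandidate H ∧
        ∀ s : Fin 3 → ℝ, s ≠ 0 → IsPosDefForm (SecondOrderSystem.minor H s) := by
      rintro ⟨H, hH, hpos⟩
      exact hsym C hC b H hH _ (hpos (unitVec 0) (by simp))
    refine ⟨hasHamiltonianStructure_of_bijective C b ?_, ?_,
      fun h => hno (exists_candidate_of_isSymmetricHyperbolic h), hno⟩
    · obtain ⟨b, rfl⟩ := exists_framedBackground b
      rw [hC.eq_familyParameters]
      exact b.A₂_bijective hC.lamMinus_pos (by linarith [hC.c5_gt])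
    · rw [hC.eq_familyParameters]
      exact isStronglyHyperbolic_grSystem hC.lamMinus_pos hC.c5_gt b
  refine ⟨hall, ?_, fun l c hl hc hc' => ⟨familyParameters l c, familyParameters_mem hl hc hc',
    familyParameters_lamMinusSq l c, rfl⟩, familyParameters 1 1, fun b => ?_⟩
  · obtain ⟨P, hP⟩ := exists_generic_polynomial
    refine ⟨P, hP.1, fun C hC hgen b => ⟨?_, fun H hH s _ => hsym C hC b H hH s⟩⟩
    rw [hC.eq_familyParameters]
    exact finrank_blockCandidates hC.lamMinus_pos hC.c5_ne (by linarith [hC.c5_gt])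
      (hP.2 _ _ hgen) b
  · obtain ⟨h₁, h₂, h₃, -⟩ := hall (familyParameters 1 1)
      (familyParameters_mem one_pos (by norm_num) one_ne_zero) b
    exact ⟨h₁, h₂, h₃⟩
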